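/- Let $d\in\{1,2,3\}$, let $\Omega\subset\mathbb{R}^d$ be a bounded open set with Lipschitz boundary, let $b>0$, $c^2>0$, $0<\delta<1$, $k\in\mathbb{R}$, and let $q\ge 1$ with $q>d-1$. Consider $$(1-2ku)u_{tt}-c^2\Delta u-b\,\mathrm{div}\Bigl(\bigl((1-\delta)+\delta|\nabla u_t|^{q-1}\bigr)\nabla u_t\Bigr)=2k(u_t)^2\ \text{ in }(0,T)\times\Omega,\quad u|_{\partial\Omega}=0,\quad (u,u_t)|_{t=0}=(u_0,u_1).\tag{1}$$ For $T>0$ put $X=H^2(0,T;L_2(\Omega))\cap C^1([0,T];W_0^{1,q+1}(\Omega))$. A function $u\in X$ is a weak solution of (1) if $u(0)=u_0$, $u_t(0)=u_1$ and, for almost every $t\in(0,T)$ and all $w\in W_0^{1,q+1}(\Omega)$, $$\int_\Omega\Bigl\{(1-2ku)u_{tt}w+c^2\nabla u\cdot\nabla w+b\bigl((1-\delta)+\delta|\nabla u_t|^{q-1}\bigr)\nabla u_t\cdot\nabla w\Bigr\}\,dx=\int_\Omega 2k(u_t)^2w\,dx .$$ For $\overline m,\overline M>0$ let $$\mathcal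 W_{\overline m,\overline M}=\bigl\{v\in X:\ \|v_{tt}\|_{L_2(0,T;L_2(\Omega))}\le\overline m,\ \|\nabla v_t\|_{L_\infty(0,T;L_2(\Omega))}\le\overline m,\ \|\nabla v_t\|_{L_{q+1}(0,T;L_{q+1}(\Omega))}\le\overline M\bigr\},$$ and let $C_\Omega$ be the smallest constant with $\|w\|_{L_\infty(\Omega)}\le C_\Omega\|\nabla w\|_{L_{q+1}(\Omega)}$ for all $w\in W_0^{1,q+1}(\Omega)$. Let $T>0$ and let $\overline M>0$ satisfy $2|k|C_\Omega T^{q/(q+1)}\overline M<1$. Then for every sufficiently small $\overline m>0$ there is $\kappa_T>0$ with $$2|k|C_\Omega\bigl(\kappa_T+T^{q/(q+1)}\overline M\bigr)<1$$ such that for all $u_0,u_1\in W_0^{1,q+1}(\Omega)$ with $$|u_1|_{L_2(\Omega)}^2+|\nabla u_0|_{L_2(\Omega)}^2+|\nabla u_1|_{L_2(\Omega)}^2+|\nabla u_1|_{L_{q+1}(\Omega)}^{q+1}+|\nabla u_0|_{L_{q+1}(\Omega)}^2\le\kappa_T^2$$ there exists a weak solution $u\in\mathcal W_{\overline m,\overline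 M}$ of (1), and it is the only weak solution of (1) in $\mathcal W_{\overline m,\overline M}$. -/

import Mathlib

open MeasureTheory Set
open scoped ENNReal NNReal ContDiff

noncomputable section

namespace Westervelt

/-- Lipschitz boundary: near each boundary point, in a suitable orthonormal frame whose last axis
is `e`, the set is the strict epigraph of a Lipschitz function of the remaining coordinates. -/
def HasLipschitzBoundary {d : ℕ} (Ω : Set (EuclideanSpace ℝ (Fin d))) : Prop :=
  ∀ x ∈ frontier Ω, ∃ (e : EuclideanSpace ℝ (Fin d)) (K : ℝ≥0)
    (γ : (Submodule.span ℝ {e})ᗮ → ℝ) (r : ℝ),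
    ‖e‖ = 1 ∧ LipschitzWith K γ ∧ 0 < r ∧
      ∀ y ∈ Metric.ball x r,
        (y ∈ Ω ↔ γ ((Submodule.span ℝ {e})ᗮ.orthogonalProjectionOnto y) < inner ℝ e y)

/-- The pairs `(φ, ∇φ)` with `φ ∈ C_c^∞(Ω)`, as a subspace of `L_p(Ω) × L_p(Ω; ℝ^d)`. -/
def testPairs {d : ℕ} (Ω : Set (EuclideanSpace ℝ (Fin d))) (p : ℝ≥0∞) :
    Submodule ℝ (Lp ℝ p (volume.restrict Ω) ×
      Lp (EuclideanSpace ℝ (Fin d)) p (volume.restrict Ω)) where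
  carrier := {z | ∃ φ : EuclideanSpace ℝ (Fin d) → ℝ, ContDiff ℝ ∞ φ ∧ HasCompactSupport φ ∧
    tsupport φ ⊆ Ω ∧ (z.1 =ᵐ[volume.restrict Ω] φ) ∧ (z.2 =ᵐ[volume.restrict Ω] gradient φ)}
  zero_mem' := by
    refine ⟨0, contDiff_const, HasCompactSupport.zero, by simp, Lp.coeFn_zero _ _ _, ?_⟩
    filter_upwards [Lp.coeFn_zero (EuclideanSpace ℝ (Fin d)) p (volume.restrict Ω)] with x hx
    simpa [gradient] using hx
  add_mem' := by
    rintro z z' ⟨φ, h1, h2, h3, h4, h5⟩ ⟨ψ, k1, k2, k3, k4, k5⟩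
    refine ⟨φ + ψ, h1.add k1, h2.add k2,
      (tsupport_add φ ψ).trans (union_subset h3 k3), ?_, ?_⟩
    · filter_upwards [Lp.coeFn_add z.1 z'.1, h4, k4] with x hx hx1 hx2
      change (z.1 + z'.1 : Lp ℝ p (volume.restrict Ω)) x = φ x + ψ x
      rw [hx, Pi.add_apply, hx1, hx2]
    · filter_upwards [Lp.coeFn_add z.2 z'.2, h5, k5] with x hx hx1 hx2
      have e1 : DifferentiableAt ℝ φ x := (h1.differentiable (by simp)).differentiableAt
      have e2 : DifferentiableAt ℝ ψ x := (k1.differentiable (by simp)).differentiableAt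
      change (z.2 + z'.2 : Lp (EuclideanSpace ℝ (Fin d)) p (volume.restrict Ω)) x = _
      rw [hx, Pi.add_apply, hx1, hx2]
      simp [gradient, fderiv_add e1 e2]
  smul_mem' := by
    rintro a z ⟨φ, h1, h2, h3, h4, h5⟩
    refine ⟨a • φ, h1.const_smul a, h2.smul_left (f := fun _ => a),
      (tsupport_smul_subset_right (fun _ => a) φ).trans h3, ?_, ?_⟩
    · filter_upwards [Lp.coeFn_smul a z.1, h4] with x hx hx1
      simp [hx, hx1]
    · filter_upwards [Lp.coeFn_smul a z.2, h5] with x hx hx1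
      have e1 : DifferentiableAt ℝ φ x := (h1.differentiable (by simp)).differentiableAt
      simp [hx, hx1, gradient, fderiv_const_smul e1]

/-- `W_0^{1,p}(Ω)`: the closure of `C_c^∞(Ω)` in the `W^{1,p}` norm. An element is stored as the
pair consisting of the function and its weak gradient. -/
def W0 {d : ℕ} (Ω : Set (EuclideanSpace ℝ (Fin d))) (p : ℝ≥0∞) [Fact (1 ≤ p)] :
    Submodule ℝ (Lp ℝ p (volume.restrict Ω) ×
      Lp (EuclideanSpace ℝ (Fin d)) p (volume.restrict Ω)) :=
  (testPairs Ω p).topologicalClosure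

/-- The underlying function of an element of `W_0^{1,p}(Ω)`. -/
def fn {d : ℕ} {Ω : Set (EuclideanSpace ℝ (Fin d))} {p : ℝ≥0∞} [Fact (1 ≤ p)]
    (w : W0 Ω p) : EuclideanSpace ℝ (Fin d) → ℝ := w.1.1

/-- The weak gradient of an element of `W_0^{1,p}(Ω)`. -/
def grad {d : ℕ} {Ω : Set (EuclideanSpace ℝ (Fin d))} {p : ℝ≥0∞} [Fact (1 ≤ p)]
    (w : W0 Ω p) : EuclideanSpace ℝ (Fin d) → EuclideanSpace ℝ (Fin d) := w.1.2

/-- The Lebesgue exponent `q + 1`. -/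
abbrev expo (q : ℝ) : ℝ≥0∞ := ENNReal.ofReal (q + 1)

instance expo_fact (q : ℝ) [hq : Fact (1 ≤ q)] : Fact (1 ≤ expo q) :=
  ⟨by
    rw [expo, ENNReal.one_le_ofReal]
    linarith [hq.out]⟩

/-- The norm of the embedding `W_0^{1,q+1}(Ω) → L_∞(Ω)`, where `W_0^{1,q+1}(Ω)` is normed by
`|∇w|_{L_{q+1}}`. -/
def embConst {d : ℕ} (Ω : Set (EuclideanSpace ℝ (Fin d))) (q : ℝ) [Fact (1 ≤ q)] : ℝ :=
  sInf {C : ℝ | 0 ≤ C ∧ ∀ w : W0 Ω (expo q),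
    eLpNorm (fn w) ∞ (volume.restrict Ω) ≤
      ENNReal.ofReal C * eLpNorm (grad w) (expo q) (volume.restrict Ω)}

/-- `g` is the weak derivative of `f` on the time interval `(0,T)`. -/
def IsWeakTimeDeriv {H : Type*} [NormedAddCommGroup H] [NormedSpace ℝ H] (T : ℝ)
    (f g : ℝ → H) : Prop :=
  ∀ φ : ℝ → ℝ, ContDiff ℝ ∞ φ → HasCompactSupport φ → tsupport φ ⊆ Ioo 0 T →
    ∫ t in Ioo 0 T, deriv φ t • f t = - ∫ t in Ioo 0 T, φ t • g t

/-- `u ∈ H²(0,T;L_2(Ω))` with second time derivative `a`. -/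
def IsH2With {d : ℕ} {Ω : Set (EuclideanSpace ℝ (Fin d))} {p : ℝ≥0∞} [Fact (1 ≤ p)] (T : ℝ)
    (u : ℝ → W0 Ω p) (a : ℝ → Lp ℝ 2 (volume.restrict Ω)) : Prop :=
  ∃ U U' : ℝ → Lp ℝ 2 (volume.restrict Ω),
    (∀ t ∈ Icc 0 T, U t =ᵐ[volume.restrict Ω] fn (u t)) ∧
    MemLp U 2 (volume.restrict (Ioo 0 T)) ∧
    MemLp U' 2 (volume.restrict (Ioo 0 T)) ∧
    MemLp a 2 (volume.restrict (Ioo 0 T)) ∧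
    IsWeakTimeDeriv T U U' ∧ IsWeakTimeDeriv T U' a

/-- The time derivative on `[0,T]` (one-sided at the end points). -/
def dt {V : Type*} [NormedAddCommGroup V] [NormedSpace ℝ V] (T : ℝ) (u : ℝ → V) (t : ℝ) : V :=
  derivWithin u (Icc 0 T) t

/-- The space `X = H²(0,T;L_2(Ω)) ∩ C¹([0,T];W_0^{1,q+1}(Ω))`; only the values of `u` on `[0,T]`
matter. -/
def MemX {d : ℕ} {Ω : Set (EuclideanSpace ℝ (Fin d))} {q : ℝ} [Fact (1 ≤ q)] (T : ℝ)
    (u : ℝ → W0 Ω (expo q)) : Prop :=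
  ContDiffOn ℝ 1 u (Icc 0 T) ∧ ∃ a, IsH2With T u a

/-- The set `𝒲` with the bounds `m` and `M`. -/
def MemCalW {d : ℕ} {Ω : Set (EuclideanSpace ℝ (Fin d))} {q : ℝ} [Fact (1 ≤ q)] (T m M : ℝ)
    (v : ℝ → W0 Ω (expo q)) : Prop :=
  MemX T v ∧
  (∃ a, IsH2With T v a ∧ eLpNorm a 2 (volume.restrict (Ioo 0 T)) ≤ ENNReal.ofReal m) ∧
  eLpNorm (fun t => eLpNorm (grad (dt T v t)) 2 (volume.restrict Ω)) ∞
    (volume.restrict (Ioo 0 T)) ≤ ENNReal.ofReal m ∧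
  eLpNorm (fun t => eLpNorm (grad (dt T v t)) (expo q) (volume.restrict Ω)) (expo q)
    (volume.restrict (Ioo 0 T)) ≤ ENNReal.ofReal M

/-- `u ∈ X` is a weak solution on `[0,T]` of
`(1-2ku) u_tt - c² Δu - b div(((1-δ) + δ|∇u_t|^{q-1}) ∇u_t) = 2k (u_t)²`
with homogeneous Dirichlet data and `(u, u_t)(0) = (u₀, u₁)`. -/
def IsWeakSolution {d : ℕ} {Ω : Set (EuclideanSpace ℝ (Fin d))} {q : ℝ} [Fact (1 ≤ q)]
    (c b δ k T : ℝ) (u₀ u₁ : W0 Ω (expo q)) (u : ℝ → W0 Ω (expo q)) : Prop :=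
  MemX T u ∧ u 0 = u₀ ∧ dt T u 0 = u₁ ∧
  ∃ a, IsH2With T u a ∧
    ∀ᵐ t ∂(volume.restrict (Ioo 0 T)), ∀ w : W0 Ω (expo q),
      ∫ x in Ω, ((1 - 2 * k * fn (u t) x) * a t x * fn w x
          + c ^ 2 * inner ℝ (grad (u t) x) (grad w x)
          + b * ((1 - δ) + δ * ‖grad (dt T u t) x‖ ^ (q - 1))
            * inner ℝ (grad (dt T u t) x) (grad w x))
        = ∫ x in Ω, 2 * k * (fn (dt T u t) x) ^ 2 * fn w x

/-- The quantity `E_1[u](0) + |∇u₀|²_{L_{q+1}}` of the initial data. -/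
def dataEnergy {d : ℕ} {Ω : Set (EuclideanSpace ℝ (Fin d))} {q : ℝ} [Fact (1 ≤ q)]
    (u₀ u₁ : W0 Ω (expo q)) : ℝ≥0∞ :=
  eLpNorm (fn u₁) 2 (volume.restrict Ω) ^ 2
    + eLpNorm (grad u₀) 2 (volume.restrict Ω) ^ 2
    + eLpNorm (grad u₁) 2 (volume.restrict Ω) ^ 2
    + eLpNorm (grad u₁) (expo q) (volume.restrict Ω) ^ (q + 1)
    + eLpNorm (grad u₀) (expo q) (volume.restrict Ω) ^ 2

end Westervelt

end

set_option linter.unusedSectionVars false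

noncomputable section

namespace Westervelt

open Filter Topology

section UniformConvexity

variable {V H : Type*} [NormedAddCommGroup V] [NormedSpace ℝ V]
  [NormedAddCommGroup H] [NormedSpace ℝ H]

/-- `F` is uniformly convex of power type `p`, with `A x` a subgradient of `F` at `x`. -/
def IsUnifConvex (F : V → ℝ) (A : V → V →L[ℝ] ℝ) (γ p : ℝ) : Prop :=
  ∀ x y, F x + A x (y - x) + γ * ‖y - x‖ ^ p ≤ F y

variable {F : V → ℝ} {A : V → V →L[ℝ] ℝ} {γ p : ℝ}

theorem IsUnifConvex.midpoint (h : IsUnifConvex F A γ p) (x y : V) :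
    2 * F ((2 : ℝ)⁻¹ • (x + y)) + 2 * (γ * ‖(2 : ℝ)⁻¹ • (x - y)‖ ^ p) ≤ F x + F y := by
  have h1 := h ((2 : ℝ)⁻¹ • (x + y)) x
  have h2 := h ((2 : ℝ)⁻¹ • (x + y)) y
  have e1 : x - (2 : ℝ)⁻¹ • (x + y) = (2 : ℝ)⁻¹ • (x - y) := by module
  have e2 : y - (2 : ℝ)⁻¹ • (x + y) = -((2 : ℝ)⁻¹ • (x - y)) := by module
  rw [e1] at h1
  rw [e2, map_neg, norm_neg] at h2
  linarith

theorem IsUnifConvex.bddBelow (h : IsUnifConvex F A γ p) (hγ : 0 < γ) (hp : 1 < p) :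
    ∃ c, ∀ x, c ≤ F x := by
  set a := ‖A 0‖
  set R : ℝ := (a / γ) ^ (p - 1)⁻¹
  refine ⟨F 0 - a * R, fun x => ?_⟩
  have h1 := h 0 x
  rw [sub_zero] at h1
  have h2 : -(a * ‖x‖) ≤ A 0 x := (abs_le.1 ((A 0).le_opNorm x)).1
  have ha : 0 ≤ a := norm_nonneg _
  have hR : 0 ≤ R := by positivity
  rcases le_total ‖x‖ R with hx | hx
  · have : a * ‖x‖ ≤ a * R := by gcongr
    have : 0 ≤ γ * ‖x‖ ^ p := by positivity
    linarith
  · have h3 : a / γ ≤ ‖x‖ ^ (p - 1) := by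
      calc a / γ = R ^ (p - 1) := by
            rw [← Real.rpow_mul (by positivity), inv_mul_cancel₀ (by linarith), Real.rpow_one]
        _ ≤ ‖x‖ ^ (p - 1) := Real.rpow_le_rpow hR hx (by linarith)
    have h4 : ‖x‖ ^ p = ‖x‖ ^ (p - 1) * ‖x‖ := by
      rcases (norm_nonneg x).eq_or_lt with h0 | h0
      · rw [← h0, mul_zero, Real.zero_rpow (by linarith)]
      · rw [← Real.rpow_add_one h0.ne', sub_add_cancel]
    have h5 : a ≤ γ * ‖x‖ ^ (p - 1) := by
      rw [div_le_iff₀ hγ] at h3; linarith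
    have h6 : a * ‖x‖ ≤ γ * ‖x‖ ^ p := by
      rw [h4, ← mul_assoc]; gcongr
    have : 0 ≤ a * R := by positivity
    linarith

/-- Almost minimizers over a decreasing sequence of convex sets converge. -/
theorem IsUnifConvex.exists_tendsto [CompleteSpace V] (h : IsUnifConvex F A γ p) (hγ : 0 < γ)
    (hp : 1 < p) (C : ℕ → Set V) (hC : Antitone C)
    (hmid : ∀ n, ∀ x ∈ C n, ∀ y ∈ C n, (2 : ℝ)⁻¹ • (x + y) ∈ C n)
    (hne : ∀ n, (C n).Nonempty) (c : ℝ) (hc : ∀ n, ∃ x ∈ C n, F x ≤ c) :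
    ∃ g : ℕ → V, ∃ x : V, (∀ n, g n ∈ C n) ∧
      (∀ n, ∀ y ∈ C n, F (g n) ≤ F y + 1 / ((n : ℝ) + 1)) ∧ Tendsto g atTop (𝓝 x) := by
  obtain ⟨c₀, hc₀⟩ := h.bddBelow hγ hp
  have hbdd : ∀ n, BddBelow (F '' C n) := fun n => ⟨c₀, by rintro _ ⟨x, -, rfl⟩; exact hc₀ x⟩
  set d : ℕ → ℝ := fun n => sInf (F '' C n)
  have hd_le : ∀ n, ∀ y ∈ C n, d n ≤ F y := fun n y hy => csInf_le (hbdd n) ⟨y, hy, rfl⟩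
  have hex : ∀ n, ∃ x ∈ C n, F x < d n + 1 / ((n : ℝ) + 1) := by
    intro n
    obtain ⟨_, ⟨x, hx, rfl⟩, hlt⟩ := exists_lt_of_csInf_lt ((hne n).image F)
      (show d n < d n + 1 / ((n : ℝ) + 1) by have : 0 < 1 / ((n : ℝ) + 1) := by positivity
                                             linarith)
    exact ⟨x, hx, hlt⟩
  choose g hg hgd using hex
  have hdmono : Monotone d := fun i j hij =>
    csInf_le_csInf (hbdd i) ((hne j).image F) (image_mono (hC hij))
  have hdc : ∀ n, d n ≤ c := fun n => by
    obtain ⟨x, hx, hxc⟩ := hc n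
    exact (hd_le n x hx).trans hxc
  have hdtend : Tendsto d atTop (𝓝 (⨆ n, d n)) :=
    tendsto_atTop_ciSup hdmono ⟨c, by rintro _ ⟨n, rfl⟩; exact hdc n⟩
  have hdcauchy : CauchySeq d := hdtend.cauchySeq
  have key : ∀ n m, n ≤ m →
      2 * (γ * ‖(2 : ℝ)⁻¹ • (g n - g m)‖ ^ p) ≤ (d m - d n) + 2 * (1 / ((n : ℝ) + 1)) := by
    intro n m hnm
    have h1 := h.midpoint (g n) (g m)
    have h2 := hd_le n _ (hmid n _ (hg n) _ (hC hnm (hg m)))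
    have h3 := hgd n
    have h4 := hgd m
    have h5 : 1 / ((m : ℝ) + 1) ≤ 1 / ((n : ℝ) + 1) := by gcongr
    linarith
  have hcauchy : CauchySeq g := by
    rw [Metric.cauchySeq_iff']
    intro ε hε
    have hpos : 0 < γ * (ε / 2) ^ p := by positivity
    obtain ⟨N₁, hN₁⟩ := Metric.cauchySeq_iff.1 hdcauchy _ hpos
    obtain ⟨N₂, hN₂⟩ := exists_nat_one_div_lt (half_pos hpos)
    refine ⟨max N₁ N₂, fun n hn => ?_⟩
    have h1 := key _ _ hn
    have h2 := hN₁ n ((le_max_left _ _).trans hn) (max N₁ N₂) (le_max_left _ _)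
    rw [Real.dist_eq] at h2
    have h3 := (abs_lt.1 h2).2
    have h4 : 1 / (((max N₁ N₂ : ℕ) : ℝ) + 1) ≤ 1 / ((N₂ : ℝ) + 1) := by
      gcongr; exact le_max_right _ _
    have h5 : ‖(2 : ℝ)⁻¹ • (g (max N₁ N₂) - g n)‖ ^ p < (ε / 2) ^ p := by
      by_contra! hcon
      have := mul_le_mul_of_nonneg_left hcon hγ.le
      linarith
    have h6 := (Real.rpow_lt_rpow_iff (norm_nonneg _) (by positivity) (by linarith)).1 h5
    rw [norm_smul, Real.norm_of_nonneg (by norm_num)] at h6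
    rw [dist_comm, dist_eq_norm]
    linarith
  obtain ⟨x, hx⟩ := cauchySeq_tendsto_of_complete hcauchy
  exact ⟨g, x, hg, fun n y hy => by linarith [hgd n, hd_le n y hy], hx⟩

theorem IsUnifConvex.le_of_tendsto (h : IsUnifConvex F A γ p) (hγ : 0 < γ)
    {g : ℕ → V} {x : V} {c : ℕ → ℝ} {c' : ℝ} (hg : Tendsto g atTop (𝓝 x))
    (hc : Tendsto c atTop (𝓝 c')) (hF : ∀ n, F (g n) ≤ c n) : F x ≤ c' := by
  have h1 : Tendsto (fun n => F x + A x (g n - x)) atTop (𝓝 (F x + A x (x - x))) :=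
    tendsto_const_nhds.add (((A x).continuous.tendsto _).comp (hg.sub_const x))
  rw [sub_self, map_zero, add_zero] at h1
  refine le_of_tendsto_of_tendsto' h1 hc fun n => le_trans ?_ (hF n)
  have h2 := h x (g n)
  have : 0 ≤ γ * ‖g n - x‖ ^ p := by positivity
  linarith

/-- A uniformly convex functional has a critical point. -/
theorem IsUnifConvex.exists_critical [CompleteSpace V] (h : IsUnifConvex F A γ p) (hγ : 0 < γ)
    (hp : 1 < p)
    (hemi : ∀ x w, Tendsto (fun s : ℝ => A (x + s • w) w) (𝓝 0) (𝓝 (A x w))) :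
    ∃ x, A x = 0 := by
  obtain ⟨g, x, -, hg2, hg3⟩ := h.exists_tendsto hγ hp (fun _ => univ) (fun _ _ _ => le_rfl)
    (fun _ _ _ _ _ => mem_univ _) (fun _ => univ_nonempty) (F 0) (fun _ => ⟨0, mem_univ _, le_rfl⟩)
  have hmin : ∀ y, F x ≤ F y := fun y => by
    refine h.le_of_tendsto hγ hg3 (c := fun n => F y + 1 / ((n : ℝ) + 1)) ?_
      (fun n => hg2 n y (mem_univ _))
    simpa using (tendsto_const_nhds (x := F y)).add tendsto_one_div_add_atTop_nhds_zero_nat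
  have hnn : ∀ w, 0 ≤ A x w := by
    intro w
    have h1 : Tendsto (fun s : ℝ => A (x + s • w) w) (𝓝[>] 0) (𝓝 (A x w)) :=
      (hemi x w).mono_left nhdsWithin_le_nhds
    refine ge_of_tendsto h1 ?_
    filter_upwards [self_mem_nhdsWithin] with s hs
    have h2 := h (x + s • w) x
    have h3 := hmin (x + s • w)
    have e : x - (x + s • w) = (-s) • w := by module
    rw [e, map_smul, smul_eq_mul] at h2
    have h4 : 0 ≤ γ * ‖(-s) • w‖ ^ p := by positivity
    have h5 : 0 ≤ s * A (x + s • w) w := by linarith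
    exact nonneg_of_mul_nonneg_right h5 hs
  refine ⟨x, ?_⟩
  ext w
  have h1 := hnn w
  have h2 := hnn (-w)
  rw [map_neg] at h2
  simp only [zero_apply]
  linarith

/-- The image of a sublevel set under a continuous linear map is closed. -/
theorem IsUnifConvex.exists_of_tendsto [CompleteSpace V] (h : IsUnifConvex F A γ p) (hγ : 0 < γ)
    (hp : 1 < p) (ι : V →L[ℝ] H) {x : ℕ → V} {z : H} {c : ℝ}
    (hx : Tendsto (fun n => ι (x n)) atTop (𝓝 z)) (hF : ∀ n, F (x n) ≤ c) :
    ∃ y, ι y = z ∧ F y ≤ c := by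
  set C : ℕ → Set V := fun n => {w | F w ≤ c ∧ ‖ι w - z‖ ≤ 1 / ((n : ℝ) + 1)}
  have hCne : ∀ n, (C n).Nonempty := fun n => by
    have hpos : (0 : ℝ) < 1 / ((n : ℝ) + 1) := by positivity
    obtain ⟨N, hN⟩ := Metric.tendsto_atTop.1 hx _ hpos
    exact ⟨x N, hF N, by have := hN N le_rfl; rw [dist_eq_norm] at this; exact this.le⟩
  obtain ⟨g, y, hg1, -, hg3⟩ := h.exists_tendsto hγ hp C
    (fun i j hij w hw => ⟨hw.1, hw.2.trans (by gcongr)⟩)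
    (fun n a ha b hb => ⟨by
        have h1 := h.midpoint a b
        have h2 : 0 ≤ γ * ‖(2 : ℝ)⁻¹ • (a - b)‖ ^ p := by positivity
        linarith [ha.1, hb.1], by
        have e : ι ((2 : ℝ)⁻¹ • (a + b)) - z = (2 : ℝ)⁻¹ • ((ι a - z) + (ι b - z)) := by
          rw [map_smul, map_add]; module
        rw [e, norm_smul, Real.norm_of_nonneg (by norm_num)]
        have := norm_add_le (ι a - z) (ι b - z)
        linarith [ha.2, hb.2]⟩)
    hCne c (fun n => by obtain ⟨w, hw⟩ := hCne n; exact ⟨w, hw, hw.1⟩)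
  refine ⟨y, ?_, h.le_of_tendsto hγ hg3 tendsto_const_nhds (fun n => (hg1 n).1)⟩
  refine tendsto_nhds_unique ((ι.continuous.tendsto y).comp hg3) ?_
  rw [tendsto_iff_norm_sub_tendsto_zero]
  exact squeeze_zero (fun _ => norm_nonneg _) (fun n => (hg1 n).2)
    tendsto_one_div_add_atTop_nhds_zero_nat

/-- Lower semicontinuity with respect to a weaker norm. -/
theorem IsUnifConvex.exists_lsc [CompleteSpace V] (h : IsUnifConvex F A γ p) (hγ : 0 < γ)
    (hp : 1 < p) {ι : V →L[ℝ] H} (hι : Function.Injective ι) (x : V) {ε : ℝ} (hε : 0 < ε) :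
    ∃ η > 0, ∀ y, ‖ι y - ι x‖ < η → F x - ε < F y := by
  by_contra! hcon
  have : ∀ n : ℕ, ∃ y, ‖ι y - ι x‖ < 1 / ((n : ℝ) + 1) ∧ F y ≤ F x - ε := fun n =>
    hcon _ (by positivity)
  choose y hy1 hy2 using this
  obtain ⟨w, hw1, hw2⟩ := h.exists_of_tendsto hγ hp ι (x := y) (z := ι x) (c := F x - ε) (by
    rw [tendsto_iff_norm_sub_tendsto_zero]
    exact squeeze_zero (fun _ => norm_nonneg _) (fun n => (hy1 n).le)
      tendsto_one_div_add_atTop_nhds_zero_nat) hy2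
  rw [hι hw1] at hw2
  linarith

/-- Convergence in the weaker norm and of the energies implies strong convergence. -/
theorem IsUnifConvex.exists_norm_sub_lt [CompleteSpace V] (h : IsUnifConvex F A γ p) (hγ : 0 < γ)
    (hp : 1 < p) {ι : V →L[ℝ] H} (hι : Function.Injective ι) (x : V) {ε : ℝ} (hε : 0 < ε) :
    ∃ η > 0, ∀ y, ‖ι y - ι x‖ < η → F y ≤ F x + η → ‖y - x‖ < ε := by
  set θ : ℝ := γ * (ε / 2) ^ p with hθ
  have hθ0 : 0 < θ := by positivity
  obtain ⟨η, hη, hη'⟩ := h.exists_lsc hγ hp hι x (half_pos hθ0)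
  refine ⟨min η (θ / 2), lt_min hη (half_pos hθ0), fun y hy1 hy2 => ?_⟩
  have h1 := h.midpoint y x
  have h2 := hη' ((2 : ℝ)⁻¹ • (y + x)) (by
    have e : ι ((2 : ℝ)⁻¹ • (y + x)) - ι x = (2 : ℝ)⁻¹ • (ι y - ι x) := by
      rw [map_smul, map_add]; module
    rw [e, norm_smul, Real.norm_of_nonneg (by norm_num)]
    have := hy1.trans_le (min_le_left _ _)
    have := norm_nonneg (ι y - ι x)
    linarith)
  have h3 : F y ≤ F x + θ / 2 := hy2.trans (by gcongr; exact min_le_right _ _)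
  have h5 : ‖(2 : ℝ)⁻¹ • (y - x)‖ ^ p < (ε / 2) ^ p := by
    by_contra! hc
    have := mul_le_mul_of_nonneg_left hc hγ.le
    linarith
  have h6 := (Real.rpow_lt_rpow_iff (norm_nonneg _) (by positivity) (by linarith)).1 h5
  rw [norm_smul, Real.norm_of_nonneg (by norm_num)] at h6
  linarith

/-- A monotone, hemicontinuous, locally bounded operator is demicontinuous. -/
theorem continuous_apply_of_monotone
    (mono : ∀ x y, 0 ≤ (A y - A x) (y - x))
    (bdd : ∀ R, ∃ C, ∀ x, ‖x‖ ≤ R → ‖A x‖ ≤ C)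
    (hemi : ∀ x w, Tendsto (fun s : ℝ => A (x + s • w) w) (𝓝 0) (𝓝 (A x w))) (w : V) :
    Continuous fun x => A x w := by
  have upper : ∀ x w, ∀ ε > 0, ∀ᶠ y in 𝓝 x, A y w < A x w + ε := by
    intro x w ε hε
    obtain ⟨C, hC⟩ := bdd (‖x‖ + 1)
    obtain ⟨s, hs1, hs0⟩ : ∃ s : ℝ, A (x + s • w) w < A x w + ε / 2 ∧ 0 < s := by
      have h1 : ∀ᶠ s in 𝓝[>] (0 : ℝ), A (x + s • w) w < A x w + ε / 2 :=
        ((hemi x w).mono_left nhdsWithin_le_nhds).eventually_lt_const (by linarith)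
      exact (h1.and self_mem_nhdsWithin).exists
    set z := x + s • w
    have h2 : ∀ᶠ y in 𝓝 x, ‖y‖ ≤ ‖x‖ + 1 := by
      have := (continuous_norm.tendsto x).eventually_lt_const (show ‖x‖ < ‖x‖ + 1 by linarith)
      filter_upwards [this] with y hy using hy.le
    have h3 : ∀ᶠ y in 𝓝 x, (C + ‖A z‖) * ‖y - x‖ < s * (ε / 2) := by
      have hc : Continuous fun y : V => (C + ‖A z‖) * ‖y - x‖ := by fun_prop
      exact (hc.tendsto x).eventually_lt_const (by simp; positivity)
    filter_upwards [h2, h3] with y hy1 hy2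
    have h4 := mono z y
    have e : y - z = (y - x) - s • w := by simp only [z]; abel
    rw [e, map_sub, map_smul, sub_apply, sub_apply,
      smul_eq_mul] at h4
    have h5 : A y (y - x) ≤ C * ‖y - x‖ := (le_abs_self _).trans
      (((A y).le_opNorm _).trans (by gcongr; exact hC y hy1))
    have h6 : -(A z (y - x)) ≤ ‖A z‖ * ‖y - x‖ := (neg_le_abs _).trans ((A z).le_opNorm _)
    have h7 : s * A y w < s * (A x w + ε) := by
      nlinarith [mul_lt_mul_of_pos_left hs1 hs0]
    exact lt_of_mul_lt_mul_left h7 hs0.le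
  rw [continuous_iff_continuousAt]
  intro x
  rw [ContinuousAt, Metric.tendsto_nhds]
  intro ε hε
  filter_upwards [upper x w ε hε, upper x (-w) ε hε] with y h1 h2
  rw [map_neg, map_neg] at h2
  rw [Real.dist_eq, abs_lt]
  constructor <;> linarith

end UniformConvexity

end Westervelt

end

noncomputable section

namespace Westervelt

open Filter Topology

section Primitives

variable {E E' : Type*} [NormedAddCommGroup E] [NormedSpace ℝ E] [CompleteSpace E]
  [NormedAddCommGroup E'] [NormedSpace ℝ E'] [CompleteSpace E']

/-- `X` is a primitive on `[0, T]` of the integrable function `x`. -/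
structure IsPrim (T : ℝ) (X x : ℝ → E) : Prop where
  int : IntervalIntegrable x volume 0 T
  eq : ∀ t ∈ Icc 0 T, X t = X 0 + ∫ s in (0 : ℝ)..t, x s

theorem IsPrim.intervalIntegrable {T : ℝ} {X x : ℝ → E} (h : IsPrim T X x) {s t : ℝ}
    (hs : s ∈ Icc 0 T) (ht : t ∈ Icc 0 T) : IntervalIntegrable x volume s t := by
  have hT : 0 ≤ T := hs.1.trans hs.2
  exact h.int.mono_set (uIcc_subset_uIcc (by rwa [uIcc_of_le hT]) (by rwa [uIcc_of_le hT]))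

theorem IsPrim.sub_eq {T : ℝ} {X x : ℝ → E} (h : IsPrim T X x) {s t : ℝ}
    (hs : s ∈ Icc 0 T) (ht : t ∈ Icc 0 T) : X t - X s = ∫ r in s..t, x r := by
  have h0 : (0 : ℝ) ∈ Icc 0 T := ⟨le_rfl, hs.1.trans hs.2⟩
  rw [h.eq t ht, h.eq s hs, add_sub_add_left_eq_sub,
    intervalIntegral.integral_interval_sub_left (h.intervalIntegrable h0 ht)
      (h.intervalIntegrable h0 hs)]

theorem IsPrim.sub {T : ℝ} {X x Y y : ℝ → E} (hX : IsPrim T X x) (hY : IsPrim T Y y) :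
    IsPrim T (fun t => X t - Y t) (fun t => x t - y t) := by
  refine ⟨hX.int.sub hY.int, fun t ht => ?_⟩
  have h0 : (0 : ℝ) ∈ Icc 0 T := ⟨le_rfl, ht.1.trans ht.2⟩
  rw [intervalIntegral.integral_sub (hX.intervalIntegrable h0 ht) (hY.intervalIntegrable h0 ht),
    hX.eq t ht, hY.eq t ht]
  abel

theorem IsPrim.prodMk {T : ℝ} {X x : ℝ → E} {Y y : ℝ → E'} (hX : IsPrim T X x)
    (hY : IsPrim T Y y) : IsPrim T (fun t => (X t, Y t)) (fun t => (x t, y t)) := by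
  have h_int : IntervalIntegrable (fun t => (x t, y t)) volume 0 T :=
    ⟨hX.int.1.prodMk hY.int.1, hX.int.2.prodMk hY.int.2⟩
  refine ⟨h_int, fun t ht => ?_⟩
  have h0 : (0 : ℝ) ∈ Icc 0 T := ⟨le_rfl, ht.1.trans ht.2⟩
  have h_int' : IntervalIntegrable (fun t => (x t, y t)) volume 0 t :=
    ⟨(hX.intervalIntegrable h0 ht).1.prodMk (hY.intervalIntegrable h0 ht).1,
      (hX.intervalIntegrable h0 ht).2.prodMk (hY.intervalIntegrable h0 ht).2⟩
  have h1 := (ContinuousLinearMap.fst ℝ E E').intervalIntegral_comp_comm h_int'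
  have h2 := (ContinuousLinearMap.snd ℝ E E').intervalIntegral_comp_comm h_int'
  simp only [ContinuousLinearMap.coe_fst', ContinuousLinearMap.coe_snd'] at h1 h2
  refine Prod.ext ?_ ?_
  · rw [Prod.fst_add, ← h1]; exact hX.eq t ht
  · rw [Prod.snd_add, ← h2]; exact hY.eq t ht

theorem IsPrim.ae_hasDerivAt {T : ℝ} {X x : ℝ → E} (h : IsPrim T X x) :
    ∀ᵐ t, t ∈ Ioo 0 T → HasDerivAt X (x t) t := by
  filter_upwards [h.int.ae_hasDerivAt_integral] with t ht htm
  have hT : (0 : ℝ) ≤ T := (htm.1.trans htm.2).le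
  rw [uIcc_of_le hT] at ht
  have h1 := (ht (Ioo_subset_Icc_self htm) 0 ⟨le_rfl, hT⟩).const_add (X 0)
  refine h1.congr_of_eventuallyEq ?_
  filter_upwards [Ioo_mem_nhds htm.1 htm.2] with s hs using h.eq s (Ioo_subset_Icc_self hs)

theorem IsPrim.continuousOn {T : ℝ} {X x : ℝ → E} (h : IsPrim T X x) (hT : 0 ≤ T) :
    ContinuousOn X (Icc 0 T) := by
  have h1 : ContinuousOn (fun t => X 0 + ∫ s in (0 : ℝ)..t, x s) (Icc 0 T) := by
    have := intervalIntegral.continuousOn_primitive_interval (μ := volume) (f := x) (a := 0) (b := T)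
      (by rw [uIcc_of_le hT]; rw [← intervalIntegrable_iff_integrableOn_Icc_of_le hT]; exact h.int)
    rw [uIcc_of_le hT] at this
    exact continuousOn_const.add this
  exact h1.congr fun t ht => h.eq t ht

theorem IsPrim.absolutelyContinuous_comp {T : ℝ} {X x : ℝ → E} (h : IsPrim T X x) (hT : 0 ≤ T)
    {Ψ : E → ℝ} (hΨ : ContDiff ℝ 1 Ψ) :
    AbsolutelyContinuousOnInterval (fun t => Ψ (X t)) 0 T := by
  have hcomp : IsCompact (X '' Icc 0 T) := isCompact_Icc.image_of_continuousOn (h.continuousOn hT)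
  obtain ⟨K, hK⟩ := hΨ.locallyLipschitz.locallyLipschitzOn.exists_lipschitzOnWith_of_compact hcomp
  have hP := ((h.int.norm).absolutelyContinuousOnInterval_intervalIntegral (c := 0)
    left_mem_uIcc).const_mul (K : ℝ)
  refine squeeze_zero' (Eventually.of_forall fun _ => Finset.sum_nonneg fun _ _ => dist_nonneg) ?_ hP
  have : ∀ᶠ E in AbsolutelyContinuousOnInterval.totalLengthFilter ⊓
      𝓟 (AbsolutelyContinuousOnInterval.disjWithin 0 T),
      E ∈ AbsolutelyContinuousOnInterval.disjWithin 0 T :=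
    eventually_inf_principal.2 (Eventually.of_forall fun _ h => h)
  filter_upwards [this] with E hE
  refine Finset.sum_le_sum fun i hi => ?_
  obtain ⟨h1, h2⟩ := hE.1 i hi
  rw [uIcc_of_le hT] at h1 h2
  have h0 : (0 : ℝ) ∈ Icc 0 T := ⟨le_rfl, hT⟩
  refine (hK.dist_le_mul _ (mem_image_of_mem _ h1) _ (mem_image_of_mem _ h2)).trans ?_
  rw [Real.dist_eq, ← mul_sub, abs_mul, NNReal.abs_eq]
  gcongr
  rw [dist_comm, dist_eq_norm, h.sub_eq h1 h2,
    intervalIntegral.integral_interval_sub_left (h.intervalIntegrable h0 h1).norm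
      (h.intervalIntegrable h0 h2).norm, intervalIntegral.integral_symm (E.2 i).1, abs_neg]
  exact intervalIntegral.norm_integral_le_abs_integral_norm

/-- Differential inequalities along a primitive can be integrated. -/
theorem IsPrim.le_add_integral {T : ℝ} {X x : ℝ → E} (h : IsPrim T X x)
    {Ψ : E → ℝ} (hΨ : ContDiff ℝ 1 Ψ) {φ : ℝ → ℝ} (hφ : IntervalIntegrable φ volume 0 T)
    (hle : ∀ᵐ t, t ∈ Ioo 0 T → HasDerivAt X (x t) t →
      ∃ d ≤ φ t, HasDerivAt (fun s => Ψ (X s)) d t) {t : ℝ} (ht : t ∈ Icc 0 T) :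
    Ψ (X t) ≤ Ψ (X 0) + ∫ s in (0 : ℝ)..t, φ s := by
  have hT : 0 ≤ T := ht.1.trans ht.2
  have hac := (h.absolutelyContinuous_comp hT hΨ).mono
    (show uIcc 0 t ⊆ uIcc 0 T by rw [uIcc_of_le ht.1, uIcc_of_le hT]; exact Icc_subset_Icc_right ht.2)
  have h1 := hac.integral_deriv_eq_sub
  have h2 : ∫ s in (0 : ℝ)..t, deriv (fun t => Ψ (X t)) s ≤ ∫ s in (0 : ℝ)..t, φ s := by
    refine intervalIntegral.integral_mono_ae_restrict ht.1 hac.intervalIntegrable_deriv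
      (hφ.mono_set (by rw [uIcc_of_le ht.1, uIcc_of_le hT]; exact Icc_subset_Icc_right ht.2)) ?_
    have h0 : ∀ᵐ s : ℝ, s ≠ 0 := by simp [ae_iff]
    have h0' : ∀ᵐ s : ℝ, s ≠ T := by simp [ae_iff]
    rw [EventuallyLE, ae_restrict_iff' measurableSet_Icc]
    filter_upwards [hle, h.ae_hasDerivAt, h0, h0'] with s hs1 hs2 hs3 hs4 hs5
    have hmem : s ∈ Ioo 0 T := ⟨lt_of_le_of_ne hs5.1 (Ne.symm hs3),
      lt_of_le_of_ne (hs5.2.trans ht.2) hs4⟩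
    obtain ⟨d, hd1, hd2⟩ := hs1 hmem (hs2 hmem)
    rw [hd2.deriv]
    exact hd1
  linarith

end Primitives

/-- The data of an abstract strongly damped quasilinear wave equation
`u'' - B(u) u'' + c2 D* D u + A(u') = B(u') u'`. -/
structure DampedWave (V H G : Type*) [NormedAddCommGroup V] [NormedSpace ℝ V]
    [NormedAddCommGroup H] [InnerProductSpace ℝ H]
    [NormedAddCommGroup G] [InnerProductSpace ℝ G] where
  ι : V →L[ℝ] H
  D : V →L[ℝ] G
  B : V →L[ℝ] H →L[ℝ] H
  Φ : V → ℝ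
  A : V → V →L[ℝ] ℝ
  p : ℝ
  β : ℝ
  γ : ℝ
  c2 : ℝ
  C₁ : ℝ
  C₂ : ℝ
  one_lt_p : 1 < p
  β_pos : 0 < β
  γ_pos : 0 < γ
  c2_pos : 0 < c2
  C₁_nonneg : 0 ≤ C₁
  C₂_nonneg : 0 ≤ C₂
  ι_inj : Function.Injective ι
  B_symm : ∀ u h h', inner ℝ (B u h) h' = inner ℝ h (B u h')
  B_comm : ∀ u w, B u (ι w) = B w (ι u)
  B_bound : ∀ u h w, |inner ℝ (B u h) (ι w)| ≤ C₁ * ‖h‖ * ‖D u‖ * ‖D w‖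
  ι_le : ∀ w, ‖ι w‖ ≤ C₂ * ‖D w‖
  Φ_sub : ∀ x y, Φ x + A x (y - x) ≤ Φ y
  A_mono : ∀ x y, β * ‖D (y - x)‖ ^ 2 + γ * ‖y - x‖ ^ p ≤ (A y - A x) (y - x)
  Φ_zero : Φ 0 = 0
  A_zero : A 0 = 0
  A_bdd : ∀ R, ∃ C, ∀ x, ‖x‖ ≤ R → ‖A x‖ ≤ C
  A_hemi : ∀ x w, Tendsto (fun s : ℝ => A (x + s • w) w) (𝓝 0) (𝓝 (A x w))

variable {V H G : Type*} [NormedAddCommGroup V] [NormedSpace ℝ V] [CompleteSpace V]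
    [NormedAddCommGroup H] [InnerProductSpace ℝ H] [CompleteSpace H]
    [NormedAddCommGroup G] [InnerProductSpace ℝ G]

/-- `(u, v, Z, a)` solves the equation with initial data `(u₀, v₀)` up to residuals of size `τ`. -/
structure DampedWave.IsApproxSol (S : DampedWave V H G) (T τ K r : ℝ) (u₀ v₀ : V)
    (u v : ℝ → V) (Z a : ℝ → H) : Prop where
  v_meas : AEStronglyMeasurable v (volume.restrict (Ioc 0 T))
  v_bdd : ∀ t ∈ Ioc 0 T, ‖v t‖ ≤ K
  u_bdd : ∀ t ∈ Icc 0 T, ‖u t‖ ≤ K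
  a_memLp : MemLp a 2 (volume.restrict (Ioc 0 T))
  a_bdd : ∫ t in (0 : ℝ)..T, ‖a t‖ ^ 2 ≤ K
  u_zero : u 0 = u₀
  Z_zero : Z 0 = S.ι v₀
  u_prim : IsPrim T u v
  Z_prim : IsPrim T Z a
  near : ∀ᵐ t, t ∈ Ioo 0 T → ‖Z t - S.ι (v t)‖ ≤ τ * ‖a t‖
  eqn : ∀ᵐ t, t ∈ Ioo 0 T → ∀ w,
    |inner ℝ (a t - S.B (u t) (a t)) (S.ι w) + S.c2 * inner ℝ (S.D (u t)) (S.D w) + S.A (v t) w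
      - inner ℝ (S.B (v t) (S.ι (v t))) (S.ι w)|
      ≤ τ * K * ((1 + ‖a t‖) * ‖S.ι w‖ + ‖S.D w‖)
  coer : ∀ t ∈ Icc 0 T, ∀ h, r * ‖h‖ ^ 2 ≤ inner ℝ (h - S.B (u t) h) h

end Westervelt

end

noncomputable section

namespace Westervelt

open Filter Topology

variable {V H G : Type*} [NormedAddCommGroup V] [NormedSpace ℝ V] [CompleteSpace V]
    [NormedAddCommGroup H] [InnerProductSpace ℝ H] [CompleteSpace H]
    [NormedAddCommGroup G] [InnerProductSpace ℝ G]

theorem one_add_le_two_mul {α A : ℝ} (h : α ^ 2 ≤ A) : 1 + α ≤ 2 * (1 + A) := by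
  nlinarith [sq_nonneg (α - 1)]

theorem sq_add_le (x y : ℝ) : (x + y) ^ 2 ≤ 2 * x ^ 2 + 2 * y ^ 2 := by
  nlinarith [sq_nonneg (x - y)]

theorem mul_le_sq_add_sq_div {β : ℝ} (hβ : 0 < β) (P d : ℝ) :
    P * d ≤ β * d ^ 2 + P ^ 2 / (2 * β) := by
  have : P * d - β * d ^ 2 ≤ P ^ 2 / (2 * β) := by
    rw [le_div_iff₀ (by positivity)]
    nlinarith [sq_nonneg (P - β * d), sq_nonneg (β * d)]
  linarith

/-- The Gronwall rate in the stability estimate. -/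
def DampedWave.rate (S : DampedWave V H G) (K r : ℝ) : ℝ :=
  9 * ‖S.B‖ * K / r + S.C₁ ^ 2 / (S.β * S.c2)

/-- The factor of the residuals in the stability estimate. -/
def DampedWave.resid (S : DampedWave V H G) (K : ℝ) : ℝ :=
  4 * K ^ 2 * ‖S.D‖ * (S.C₂ + 1) + 2 * (1 + ‖S.B‖ * K) + 16 * ‖S.B‖ * K

theorem DampedWave.norm_B_le (S : DampedWave V H G) {K : ℝ} {u : V} (hu : ‖u‖ ≤ K) (h : H) :
    ‖S.B u h‖ ≤ ‖S.B‖ * K * ‖h‖ :=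
  ((S.B u).le_opNorm h).trans (by gcongr; exact (S.B.le_opNorm u).trans (by gcongr))

theorem DampedWave.stability_pointwise (S : DampedWave V H G) {K r τ σ : ℝ} (hr : 0 < r)
    (hτ : 0 ≤ τ) (hσ : 0 ≤ σ) (hτσ : τ + σ ≤ 2)
    {u₁ u₂ v₁ v₂ : V} {Z₁ Z₂ a₁ a₂ : H} (hu₁ : ‖u₁‖ ≤ K) (hv₁ : ‖v₁‖ ≤ K) (hv₂ : ‖v₂‖ ≤ K)
    (hn₁ : ‖Z₁ - S.ι v₁‖ ≤ τ * ‖a₁‖) (hn₂ : ‖Z₂ - S.ι v₂‖ ≤ σ * ‖a₂‖)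
    (he₁ : ∀ w, |inner ℝ (a₁ - S.B u₁ a₁) (S.ι w) + S.c2 * inner ℝ (S.D u₁) (S.D w) + S.A v₁ w
      - inner ℝ (S.B v₁ (S.ι v₁)) (S.ι w)| ≤ τ * K * ((1 + ‖a₁‖) * ‖S.ι w‖ + ‖S.D w‖))
    (he₂ : ∀ w, |inner ℝ (a₂ - S.B u₂ a₂) (S.ι w) + S.c2 * inner ℝ (S.D u₂) (S.D w) + S.A v₂ w
      - inner ℝ (S.B v₂ (S.ι v₂)) (S.ι w)| ≤ σ * K * ((1 + ‖a₂‖) * ‖S.ι w‖ + ‖S.D w‖))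
    (hcoer : ∀ h, r * ‖h‖ ^ 2 ≤ inner ℝ (h - S.B u₁ h) h) :
    inner ℝ ((a₁ - a₂) - S.B u₁ (a₁ - a₂)) (Z₁ - Z₂)
      - 2⁻¹ * inner ℝ (S.B v₁ (Z₁ - Z₂)) (Z₁ - Z₂)
      + S.c2 * inner ℝ (S.D (u₁ - u₂)) (S.D (v₁ - v₂)) + S.γ * ‖v₁ - v₂‖ ^ S.p
    ≤ S.rate K r * (1 + ‖a₂‖ ^ 2) * (2⁻¹ * inner ℝ ((Z₁ - Z₂) - S.B u₁ (Z₁ - Z₂)) (Z₁ - Z₂)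
        + S.c2 / 2 * ‖S.D (u₁ - u₂)‖ ^ 2)
      + S.resid K * (τ + σ) * (1 + ‖a₁‖ ^ 2 + ‖a₂‖ ^ 2) := by
  have hK : 0 ≤ K := (norm_nonneg _).trans hu₁
  have hβ := S.β_pos
  have hc := S.c2_pos
  have hC1 := S.C₁_nonneg
  have hC2 := S.C₂_nonneg
  set w := v₁ - v₂ with hw
  set b := ‖S.B‖ with hb
  have hb0 : 0 ≤ b := by rw [hb]; positivity
  set α₁ := ‖a₁‖
  set α₂ := ‖a₂‖
  have hα₁ : 0 ≤ α₁ := norm_nonneg _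
  have hα₂ : 0 ≤ α₂ := norm_nonneg _
  set d := ‖S.D w‖ with hd
  set n := ‖S.ι w‖ with hn
  set z := ‖Z₁ - Z₂‖ with hz
  set y := ‖S.D (u₁ - u₂)‖ with hy
  set e := τ * α₁ + σ * α₂ with he
  have hd0 : 0 ≤ d := norm_nonneg _
  have hn0 : 0 ≤ n := norm_nonneg _
  have hz0 : 0 ≤ z := norm_nonneg _
  have hy0 : 0 ≤ y := norm_nonneg _
  have he0 : 0 ≤ e := by positivity
  have hnd : n ≤ S.C₂ * d := S.ι_le w
  have hdK : d ≤ 2 * K * ‖S.D‖ := by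
    have h1 : ‖w‖ ≤ 2 * K := (norm_sub_le _ _).trans (by linarith)
    calc d ≤ ‖S.D‖ * ‖w‖ := S.D.le_opNorm w
      _ ≤ ‖S.D‖ * (2 * K) := by gcongr
      _ = _ := by ring
  have hZe : ‖S.ι w - (Z₁ - Z₂)‖ ≤ e := by
    have : S.ι w - (Z₁ - Z₂) = (Z₂ - S.ι v₂) - (Z₁ - S.ι v₁) := by rw [hw, map_sub]; abel
    rw [this]
    exact (norm_sub_le _ _).trans (by rw [he]; linarith)
  have hnz : n ≤ z + e := by
    calc n = ‖(Z₁ - Z₂) + (S.ι w - (Z₁ - Z₂))‖ := by rw [hn]; congr 1; abel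
      _ ≤ z + e := (norm_add_le _ _).trans (by gcongr)
  have hX : ∃ X, X = inner ℝ ((a₁ - a₂) - S.B u₁ (a₁ - a₂)) (Z₁ - Z₂) := ⟨_, rfl⟩
  obtain ⟨X, hX⟩ := hX
  have hT0 : |inner ℝ ((a₁ - a₂) - S.B u₁ (a₁ - a₂)) (S.ι w - (Z₁ - Z₂))|
      ≤ (1 + b * K) * (α₁ + α₂) * e := by
    refine (abs_real_inner_le_norm _ _).trans ?_
    gcongr
    have h1 := S.norm_B_le hu₁ (a₁ - a₂)
    have h2 : ‖a₁ - a₂‖ ≤ α₁ + α₂ := norm_sub_le _ _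
    calc ‖(a₁ - a₂) - S.B u₁ (a₁ - a₂)‖ ≤ ‖a₁ - a₂‖ + b * K * ‖a₁ - a₂‖ :=
          (norm_sub_le _ _).trans (by gcongr)
      _ = (1 + b * K) * ‖a₁ - a₂‖ := by ring
      _ ≤ (1 + b * K) * (α₁ + α₂) := by gcongr
  have hT1 : |inner ℝ (S.B (u₁ - u₂) a₂) (S.ι w)| ≤ S.C₁ * α₂ * y * d := S.B_bound _ _ _
  have hT2 : |inner ℝ (S.B v₁ (S.ι w) + S.B v₂ (S.ι w)) (S.ι w)| ≤ 2 * b * K * n ^ 2 := by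
    refine (abs_real_inner_le_norm _ _).trans ?_
    have h1 := S.norm_B_le hv₁ (S.ι w)
    have h2 := S.norm_B_le hv₂ (S.ι w)
    calc ‖S.B v₁ (S.ι w) + S.B v₂ (S.ι w)‖ * n ≤ (b * K * n + b * K * n) * n := by
          gcongr; exact (norm_add_le _ _).trans (add_le_add h1 h2)
      _ = _ := by ring
  have hT3 : |inner ℝ (S.B v₁ (Z₁ - Z₂)) (Z₁ - Z₂)| ≤ b * K * z ^ 2 := by
    refine (abs_real_inner_le_norm _ _).trans ?_
    calc ‖S.B v₁ (Z₁ - Z₂)‖ * z ≤ (b * K * z) * z := by gcongr; exact S.norm_B_le hv₁ _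
      _ = _ := by ring
  have hmono : S.β * d ^ 2 + S.γ * ‖w‖ ^ S.p ≤ S.A v₁ w - S.A v₂ w := by
    have := S.A_mono v₂ v₁
    rwa [sub_apply] at this
  have E1 := (abs_le.1 (he₁ w)).2
  have E2 := (abs_le.1 (he₂ w)).1
  have hsplit : inner ℝ (a₁ - S.B u₁ a₁) (S.ι w) - inner ℝ (a₂ - S.B u₂ a₂) (S.ι w)
      = X + inner ℝ ((a₁ - a₂) - S.B u₁ (a₁ - a₂)) (S.ι w - (Z₁ - Z₂))
        - inner ℝ (S.B (u₁ - u₂) a₂) (S.ι w) := by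
    rw [hX, ← inner_add_right, add_sub_cancel, ← inner_sub_left, ← inner_sub_left]
    congr 1
    simp only [map_sub, sub_apply]
    abel
  have hprod : inner ℝ (S.B v₁ (S.ι v₁)) (S.ι w) - inner ℝ (S.B v₂ (S.ι v₂)) (S.ι w)
      = inner ℝ (S.B v₁ (S.ι w) + S.B v₂ (S.ι w)) (S.ι w) := by
    rw [← inner_sub_left]
    congr 1
    rw [hw, map_sub, map_sub, map_sub, S.B_comm v₁ v₂]
    abel
  have hDD : inner ℝ (S.D (u₁ - u₂)) (S.D w)
      = inner ℝ (S.D u₁) (S.D w) - inner ℝ (S.D u₂) (S.D w) := by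
    rw [map_sub, inner_sub_left]
  have hcz := hcoer (Z₁ - Z₂)
  set Q := inner ℝ ((Z₁ - Z₂) - S.B u₁ (Z₁ - Z₂)) (Z₁ - Z₂) with hQ
  rw [← hX, hDD]
  have hs : 0 ≤ τ + σ := by positivity
  -- the residual terms
  have R1 : τ * K * ((1 + α₁) * n + d) + σ * K * ((1 + α₂) * n + d)
      ≤ 4 * K ^ 2 * ‖S.D‖ * (S.C₂ + 1) * (τ + σ) * (1 + α₁ ^ 2 + α₂ ^ 2) := by
    have h1 : ∀ α : ℝ, 0 ≤ α → α ^ 2 ≤ α₁ ^ 2 + α₂ ^ 2 →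
        (1 + α) * n + d ≤ 4 * K * ‖S.D‖ * (S.C₂ + 1) * (1 + α₁ ^ 2 + α₂ ^ 2) := by
      intro α hα hα'
      have h2 : 1 + α ≤ 2 * (1 + α₁ ^ 2 + α₂ ^ 2) := one_add_le_two_mul hα' |>.trans (by linarith only)
      calc (1 + α) * n + d ≤ (1 + α) * (S.C₂ * d) + (1 + α) * d := by
            gcongr
            exact le_mul_of_one_le_left hd0 (by linarith only [hα])
        _ = (1 + α) * ((S.C₂ + 1) * d) := by ring
        _ ≤ (2 * (1 + α₁ ^ 2 + α₂ ^ 2)) * ((S.C₂ + 1) * (2 * K * ‖S.D‖)) := by gcongr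
        _ = _ := by ring
    have h3 := h1 α₁ hα₁ (le_add_of_nonneg_right (sq_nonneg _))
    have h4 := h1 α₂ hα₂ (le_add_of_nonneg_left (sq_nonneg _))
    calc _ ≤ τ * K * (4 * K * ‖S.D‖ * (S.C₂ + 1) * (1 + α₁ ^ 2 + α₂ ^ 2))
          + σ * K * (4 * K * ‖S.D‖ * (S.C₂ + 1) * (1 + α₁ ^ 2 + α₂ ^ 2)) := by gcongr
      _ = _ := by ring
  have hes : e ≤ (τ + σ) * (α₁ + α₂) := by
    rw [he]; linarith only [mul_nonneg hτ hα₂, mul_nonneg hσ hα₁]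
  have hsq : (α₁ + α₂) ^ 2 ≤ 2 * (1 + α₁ ^ 2 + α₂ ^ 2) := by
    linarith only [sq_add_le α₁ α₂]
  have R2 : (1 + b * K) * (α₁ + α₂) * e
      ≤ 2 * (1 + b * K) * (τ + σ) * (1 + α₁ ^ 2 + α₂ ^ 2) := by
    calc (1 + b * K) * (α₁ + α₂) * e ≤ (1 + b * K) * (α₁ + α₂) * ((τ + σ) * (α₁ + α₂)) := by gcongr
      _ = (1 + b * K) * (τ + σ) * (α₁ + α₂) ^ 2 := by ring
      _ ≤ (1 + b * K) * (τ + σ) * (2 * (1 + α₁ ^ 2 + α₂ ^ 2)) := by gcongr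
      _ = _ := by ring
  have R3 : e ^ 2 ≤ 4 * (τ + σ) * (1 + α₁ ^ 2 + α₂ ^ 2) := by
    calc e ^ 2 ≤ ((τ + σ) * (α₁ + α₂)) ^ 2 := by gcongr
      _ = (τ + σ) * (τ + σ) * (α₁ + α₂) ^ 2 := by ring
      _ ≤ (τ + σ) * 2 * (2 * (1 + α₁ ^ 2 + α₂ ^ 2)) := by gcongr
      _ = _ := by ring
  have R4 : n ^ 2 ≤ 2 * z ^ 2 + 2 * e ^ 2 := by
    calc n ^ 2 ≤ (z + e) ^ 2 := by gcongr
      _ ≤ _ := sq_add_le z e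
  have R5 : 2 * b * K * n ^ 2
      ≤ 4 * b * K * z ^ 2 + 16 * b * K * (τ + σ) * (1 + α₁ ^ 2 + α₂ ^ 2) := by
    calc 2 * b * K * n ^ 2 ≤ 2 * b * K * (2 * z ^ 2 + 2 * (4 * (τ + σ) * (1 + α₁ ^ 2 + α₂ ^ 2))) := by
          gcongr; linarith only [R3, R4]
      _ = _ := by ring
  have R6 : S.C₁ * α₂ * y * d ≤ S.β * d ^ 2 + S.C₁ ^ 2 / (2 * S.β) * α₂ ^ 2 * y ^ 2 := by
    have h1 : S.C₁ ^ 2 / (2 * S.β) * α₂ ^ 2 * y ^ 2 = (S.C₁ * α₂ * y) ^ 2 / (2 * S.β) := by ring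
    rw [h1]
    exact mul_le_sq_add_sq_div hβ _ _
  -- the Gronwall terms
  have G1 : 9 / 2 * b * K * z ^ 2 ≤ 9 * b * K / r * (2⁻¹ * Q) := by
    have : z ^ 2 ≤ Q / r := by rw [le_div_iff₀ hr]; linarith
    calc 9 / 2 * b * K * z ^ 2 ≤ 9 / 2 * b * K * (Q / r) := by gcongr
      _ = _ := by ring
  have hQ0 : 0 ≤ Q := le_trans (by positivity) hcz
  have G2 : S.C₁ ^ 2 / (2 * S.β) * α₂ ^ 2 * y ^ 2
      = S.C₁ ^ 2 / (S.β * S.c2) * α₂ ^ 2 * (S.c2 / 2 * y ^ 2) := by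
    field_simp
  have G3 : 9 * b * K / r * (2⁻¹ * Q) + S.C₁ ^ 2 / (S.β * S.c2) * α₂ ^ 2 * (S.c2 / 2 * y ^ 2)
      ≤ S.rate K r * (1 + α₂ ^ 2) * (2⁻¹ * Q + S.c2 / 2 * y ^ 2) := by
    rw [DampedWave.rate]
    have p1 : 0 ≤ 9 * b * K / r := by positivity
    have p2 : 0 ≤ S.C₁ ^ 2 / (S.β * S.c2) := by positivity
    have p3 : 0 ≤ 2⁻¹ * Q := by positivity
    have p4 : 0 ≤ S.c2 / 2 * y ^ 2 := by positivity
    have p5 : 0 ≤ α₂ ^ 2 := by positivity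
    generalize 9 * b * K / r = P at *
    generalize S.C₁ ^ 2 / (S.β * S.c2) = P' at *
    generalize 2⁻¹ * Q = P₃ at *
    generalize S.c2 / 2 * y ^ 2 = P₄ at *
    generalize α₂ ^ 2 = P₅ at *
    have : (P + P') * (1 + P₅) * (P₃ + P₄) - (P * P₃ + P' * P₅ * P₄)
        = P * P₄ + P * P₅ * (P₃ + P₄) + P' * (P₃ + P₄) + P' * P₅ * P₃ := by ring
    have : 0 ≤ P * P₄ + P * P₅ * (P₃ + P₄) + P' * (P₃ + P₄) + P' * P₅ * P₃ := by positivity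
    linarith only [this, ‹(P + P') * (1 + P₅) * (P₃ + P₄) - (P * P₃ + P' * P₅ * P₄)
        = P * P₄ + P * P₅ * (P₃ + P₄) + P' * (P₃ + P₄) + P' * P₅ * P₃›]
  have hres : S.resid K * (τ + σ) * (1 + α₁ ^ 2 + α₂ ^ 2)
      = 4 * K ^ 2 * ‖S.D‖ * (S.C₂ + 1) * (τ + σ) * (1 + α₁ ^ 2 + α₂ ^ 2)
        + 2 * (1 + b * K) * (τ + σ) * (1 + α₁ ^ 2 + α₂ ^ 2)
        + 16 * b * K * (τ + σ) * (1 + α₁ ^ 2 + α₂ ^ 2) := by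
    rw [DampedWave.resid]; ring
  have A0 := (abs_le.1 hT0).1
  have A1 := (abs_le.1 hT1).2
  have A2 := (abs_le.1 hT2).2
  have A3 := (abs_le.1 hT3).1
  rw [hres]
  linarith only [A0, A1, A2, A3, E1, E2, hsplit, hprod, hmono, R1, R2, R5, R6, G1, G2, G3]

theorem DampedWave.rate_nonneg (S : DampedWave V H G) {K r : ℝ} (hK : 0 ≤ K) (hr : 0 < r) :
    0 ≤ S.rate K r := by
  have := S.β_pos
  have := S.c2_pos
  unfold DampedWave.rate
  positivity

theorem DampedWave.resid_nonneg (S : DampedWave V H G) {K : ℝ} (hK : 0 ≤ K) :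
    0 ≤ S.resid K := by
  have := S.C₂_nonneg
  unfold DampedWave.resid
  positivity

end Westervelt

end

noncomputable section

namespace Westervelt

open Filter Topology

variable {V H G : Type*} [NormedAddCommGroup V] [NormedSpace ℝ V] [CompleteSpace V]
    [NormedAddCommGroup H] [InnerProductSpace ℝ H] [CompleteSpace H]
    [NormedAddCommGroup G] [InnerProductSpace ℝ G]

theorem intervalIntegrable_norm_sq {E : Type*} [NormedAddCommGroup E] {T : ℝ} (hT : 0 ≤ T)
    {a : ℝ → E} (ha : MemLp a 2 (volume.restrict (Ioc 0 T))) :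
    IntervalIntegrable (fun t => ‖a t‖ ^ 2) volume 0 T := by
  rw [intervalIntegrable_iff_integrableOn_Ioc_of_le hT]
  exact ha.integrable_norm_pow two_ne_zero

theorem intervalIntegrable_norm_rpow {E : Type*} [NormedAddCommGroup E] {T K p : ℝ}
    (hT : 0 ≤ T) (hp : 0 ≤ p) {v : ℝ → E}
    (hv : AEStronglyMeasurable v (volume.restrict (Ioc 0 T))) (hK : ∀ t ∈ Ioc 0 T, ‖v t‖ ≤ K) :
    IntervalIntegrable (fun t => ‖v t‖ ^ p) volume 0 T := by
  rw [intervalIntegrable_iff_integrableOn_Ioc_of_le hT]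
  refine Integrable.of_bound (C := K ^ p) ?_ ?_
  · exact (Real.continuous_rpow_const hp).comp_aestronglyMeasurable hv.norm
  · refine (ae_restrict_iff' measurableSet_Ioc).2 (Eventually.of_forall fun t ht => ?_)
    rw [Real.norm_of_nonneg (by positivity)]
    exact Real.rpow_le_rpow (norm_nonneg _) (hK t ht) hp

theorem DampedWave.hasDerivAt_energy (S : DampedWave V H G) {u y : ℝ → V} {Z : ℝ → H}
    {v w : V} {a : H} {t : ℝ} (hu : HasDerivAt u v t) (hy : HasDerivAt y w t)
    (hZ : HasDerivAt Z a t) :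
    HasDerivAt (fun s => 2⁻¹ * inner ℝ (Z s - S.B (u s) (Z s)) (Z s)
        + S.c2 / 2 * ‖S.D (y s)‖ ^ 2)
      (inner ℝ (a - S.B (u t) a) (Z t) - 2⁻¹ * inner ℝ (S.B v (Z t)) (Z t)
        + S.c2 * inner ℝ (S.D (y t)) (S.D w)) t := by
  have hB : HasDerivAt (fun s => S.B (u s) (Z s)) (S.B v (Z t) + S.B (u t) a) t :=
    (S.B.hasFDerivAt.comp_hasDerivAt t hu).clm_apply hZ
  have h1 := ((hZ.sub hB).inner ℝ hZ).const_mul (2⁻¹ : ℝ)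
  have hD : HasDerivAt (fun s => S.D (y s)) (S.D w) t := S.D.hasFDerivAt.comp_hasDerivAt t hy
  have h2 := (hD.norm_sq).const_mul (S.c2 / 2)
  refine (h1.add h2).congr_deriv ?_
  have e1 : inner ℝ (Z t - S.B (u t) (Z t)) a = inner ℝ (a - S.B (u t) a) (Z t) := by
    rw [inner_sub_left, inner_sub_left, S.B_symm, real_inner_comm, real_inner_comm (Z t) (S.B (u t) a)]
  simp only [Pi.sub_apply]
  rw [e1, ← sub_sub, sub_right_comm, inner_sub_left (a - S.B (u t) a)]
  ring

/-- Stability: approximate solutions with the same data differ by the size of the residuals. -/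
theorem DampedWave.stability (S : DampedWave V H G) {T K r : ℝ} (hT : 0 < T) (hK : 0 ≤ K)
    (hr : 0 < r) :
    ∃ C, 0 ≤ C ∧ ∀ (τ σ : ℝ) (u₀ v₀ : V) (u₁ v₁ u₂ v₂ : ℝ → V) (Z₁ a₁ Z₂ a₂ : ℝ → H),
      0 ≤ τ → τ ≤ 1 → 0 ≤ σ → σ ≤ 1 →
      S.IsApproxSol T τ K r u₀ v₀ u₁ v₁ Z₁ a₁ → S.IsApproxSol T σ K r u₀ v₀ u₂ v₂ Z₂ a₂ →
      (∀ t ∈ Icc 0 T, ‖Z₁ t - Z₂ t‖ ^ 2 ≤ C * (τ + σ) ∧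
        ‖S.D (u₁ t - u₂ t)‖ ^ 2 ≤ C * (τ + σ)) ∧
      ∫ t in (0 : ℝ)..T, ‖v₁ t - v₂ t‖ ^ S.p ≤ C * (τ + σ) := by
  set R := S.rate K r
  have hR : 0 ≤ R := S.rate_nonneg hK hr
  have hρ : 0 ≤ S.resid K := S.resid_nonneg hK
  set M := Real.exp (R * (T + K)) with hM
  have hM0 : 0 < M := Real.exp_pos _
  set C₀ := S.resid K * (T + 2 * K) * M
  have hC₀ : 0 ≤ C₀ := by positivity
  have hc := S.c2_pos
  have hγ := S.γ_pos
  have hp := S.one_lt_p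
  refine ⟨C₀ * (2 / r + 2 / S.c2 + 1 / S.γ), by positivity, ?_⟩
  intro τ σ u₀ v₀ u₁ v₁ u₂ v₂ Z₁ a₁ Z₂ a₂ hτ0 hτ1 hσ0 hσ1 h₁ h₂
  have ia₁ := intervalIntegrable_norm_sq hT.le h₁.a_memLp
  have ia₂ := intervalIntegrable_norm_sq hT.le h₂.a_memLp
  have iv : IntervalIntegrable (fun t => ‖v₁ t - v₂ t‖ ^ S.p) volume 0 T :=
    intervalIntegrable_norm_rpow (K := 2 * K) hT.le (by linarith) (h₁.v_meas.sub h₂.v_meas)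
      (fun t ht => (norm_sub_le _ _).trans (by linarith [h₁.v_bdd t ht, h₂.v_bdd t ht]))
  set g : ℝ → ℝ := fun t => R * (1 + ‖a₂ t‖ ^ 2)
  have ig : IntervalIntegrable g volume 0 T := (intervalIntegrable_const.add ia₂).const_mul R
  set Γ : ℝ → ℝ := fun t => ∫ s in (0 : ℝ)..t, g s with hΓ
  have hΓp : IsPrim T Γ g := ⟨ig, fun t _ => by simp [hΓ]⟩
  have hg0 : ∀ t, 0 ≤ g t := fun t => by positivity
  have hΓ0 : ∀ t ∈ Icc 0 T, 0 ≤ Γ t := fun t ht =>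
    intervalIntegral.integral_nonneg ht.1 fun s _ => hg0 s
  have hΓM : ∀ t ∈ Icc 0 T, Γ t ≤ R * (T + K) := by
    intro t ht
    have h1 : Γ t ≤ ∫ s in (0 : ℝ)..T, g s :=
      intervalIntegral.integral_mono_interval le_rfl ht.1 ht.2
        (Eventually.of_forall fun s => hg0 s) ig
    refine h1.trans ?_
    simp only [g]
    rw [intervalIntegral.integral_const_mul,
      intervalIntegral.integral_add intervalIntegrable_const ia₂]
    simp only [intervalIntegral.integral_const, sub_zero, smul_eq_mul, mul_one]
    gcongr
    exact h₂.a_bdd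
  set X : ℝ → ℝ × V × H × V := fun t => (Γ t, u₁ t, Z₁ t - Z₂ t, u₁ t - u₂ t) with hXdef
  have hX : IsPrim T X (fun t => (g t, v₁ t, a₁ t - a₂ t, v₁ t - v₂ t)) :=
    hΓp.prodMk (h₁.u_prim.prodMk ((h₁.Z_prim.sub h₂.Z_prim).prodMk (h₁.u_prim.sub h₂.u_prim)))
  set Ψ : ℝ × V × H × V → ℝ := fun x => Real.exp (-x.1) *
    (2⁻¹ * inner ℝ (x.2.2.1 - S.B x.2.1 x.2.2.1) x.2.2.1 + S.c2 / 2 * ‖S.D x.2.2.2‖ ^ 2)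
    with hΨdef
  have hz : ContDiff ℝ 1 fun x : ℝ × V × H × V => x.2.2.1 := by fun_prop
  have hΨ : ContDiff ℝ 1 Ψ := by
    have h1 : ContDiff ℝ 1 fun x : ℝ × V × H × V => S.B x.2.1 x.2.2.1 :=
      (S.B.contDiff.comp (contDiff_fst.comp contDiff_snd)).clm_apply hz
    have h2 : ContDiff ℝ 1 fun x : ℝ × V × H × V => S.D x.2.2.2 :=
      S.D.contDiff.comp (contDiff_snd.comp (contDiff_snd.comp contDiff_snd))
    exact (Real.contDiff_exp.comp contDiff_fst.neg).mul
      ((contDiff_const.mul ((hz.sub h1).inner ℝ hz)).add (contDiff_const.mul (h2.norm_sq ℝ)))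
  set h : ℝ → ℝ := fun t => S.resid K * (τ + σ) * (1 + ‖a₁ t‖ ^ 2 + ‖a₂ t‖ ^ 2) with hh
  have ih : IntervalIntegrable h volume 0 T :=
    ((intervalIntegrable_const.add ia₁).add ia₂).const_mul _
  have hh0 : ∀ t, 0 ≤ h t := fun t => by positivity
  set φ : ℝ → ℝ := fun t => h t - M⁻¹ * S.γ * ‖v₁ t - v₂ t‖ ^ S.p with hφdef
  have iφ : IntervalIntegrable φ volume 0 T := ih.sub (iv.const_mul _)
  have hη0 : ∀ t ∈ Icc 0 T, r / 2 * ‖Z₁ t - Z₂ t‖ ^ 2 + S.c2 / 2 * ‖S.D (u₁ t - u₂ t)‖ ^ 2 ≤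
      2⁻¹ * inner ℝ ((Z₁ t - Z₂ t) - S.B (u₁ t) (Z₁ t - Z₂ t)) (Z₁ t - Z₂ t)
        + S.c2 / 2 * ‖S.D (u₁ t - u₂ t)‖ ^ 2 := fun t ht => by
    have := h₁.coer t ht (Z₁ t - Z₂ t)
    linarith
  have main : ∀ t ∈ Icc 0 T, Ψ (X t) ≤ ∫ s in (0 : ℝ)..t, φ s := by
    intro t ht
    have h0 : Ψ (X 0) = 0 := by
      simp [hΨdef, hXdef, h₁.u_zero, h₂.u_zero, h₁.Z_zero, h₂.Z_zero]
    have := hX.le_add_integral hΨ iφ ?_ ht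
    · rwa [h0, zero_add] at this
    filter_upwards [h₁.near, h₂.near, h₁.eqn, h₂.eqn] with t n₁ n₂ e₁ e₂ ht hder
    have htc := Ioo_subset_Icc_self ht
    have hto : t ∈ Ioc 0 T := Ioo_subset_Ioc_self ht
    have dΓ : HasDerivAt Γ (g t) t := hder.fst
    have du : HasDerivAt u₁ (v₁ t) t := hder.snd.fst
    have dZ : HasDerivAt (fun s => Z₁ s - Z₂ s) (a₁ t - a₂ t) t := hder.snd.snd.fst
    have dy : HasDerivAt (fun s => u₁ s - u₂ s) (v₁ t - v₂ t) t := hder.snd.snd.snd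
    have hpt := S.stability_pointwise hr hτ0 hσ0 (by linarith) (h₁.u_bdd t htc)
      (h₁.v_bdd t hto) (h₂.v_bdd t hto) (n₁ ht) (n₂ ht) (e₁ ht) (e₂ ht) (h₁.coer t htc)
    have hE := dΓ.neg.exp.mul (S.hasDerivAt_energy du dy dZ)
    refine ⟨_, ?_, hE⟩
    have hexp1 : Real.exp (-Γ t) ≤ 1 := Real.exp_le_one_iff.2 (by linarith [hΓ0 t htc])
    have hexp2 : M⁻¹ ≤ Real.exp (-Γ t) := by
      rw [hM, ← Real.exp_neg]; exact Real.exp_le_exp.2 (by linarith [hΓM t htc])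
    have hexp0 := Real.exp_pos (-Γ t)
    generalize hηt : 2⁻¹ * inner ℝ ((Z₁ t - Z₂ t) - S.B (u₁ t) (Z₁ t - Z₂ t)) (Z₁ t - Z₂ t)
        + S.c2 / 2 * ‖S.D (u₁ t - u₂ t)‖ ^ 2 = η at hpt
    generalize hη't : inner ℝ (a₁ t - a₂ t - S.B (u₁ t) (a₁ t - a₂ t)) (Z₁ t - Z₂ t)
      - 2⁻¹ * inner ℝ (S.B (v₁ t) (Z₁ t - Z₂ t)) (Z₁ t - Z₂ t)
      + S.c2 * inner ℝ (S.D (u₁ t - u₂ t)) (S.D (v₁ t - v₂ t)) = η' at hpt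
    have hvp : 0 ≤ S.γ * ‖v₁ t - v₂ t‖ ^ S.p := by positivity
    simp only [Pi.neg_apply]
    have hpt' : η' - g t * η ≤ h t - S.γ * ‖v₁ t - v₂ t‖ ^ S.p := by
      simp only [g, hh]; linarith
    calc Real.exp (-Γ t) * -g t * η + Real.exp (-Γ t) * η'
        = Real.exp (-Γ t) * (η' - g t * η) := by ring
      _ ≤ Real.exp (-Γ t) * (h t - S.γ * ‖v₁ t - v₂ t‖ ^ S.p) := by gcongr
      _ = Real.exp (-Γ t) * h t - Real.exp (-Γ t) * (S.γ * ‖v₁ t - v₂ t‖ ^ S.p) := by ring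
      _ ≤ 1 * h t - M⁻¹ * (S.γ * ‖v₁ t - v₂ t‖ ^ S.p) := by
          have := hh0 t
          gcongr
      _ = φ t := by simp only [hφdef]; ring
  have hhT : ∀ t ∈ Icc 0 T, ∫ s in (0 : ℝ)..t, h s ≤ S.resid K * (T + 2 * K) * (τ + σ) := by
    intro t ht
    have h1 : ∫ s in (0 : ℝ)..t, h s ≤ ∫ s in (0 : ℝ)..T, h s :=
      intervalIntegral.integral_mono_interval le_rfl ht.1 ht.2
        (Eventually.of_forall fun s => hh0 s) ih
    refine h1.trans ?_
    simp only [hh]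
    rw [intervalIntegral.integral_const_mul, intervalIntegral.integral_add
      (intervalIntegrable_const.add ia₁) ia₂,
      intervalIntegral.integral_add intervalIntegrable_const ia₁]
    simp only [intervalIntegral.integral_const, sub_zero, smul_eq_mul, mul_one]
    calc _ ≤ S.resid K * (τ + σ) * (T + K + K) := by
          gcongr
          exacts [h₁.a_bdd, h₂.a_bdd]
      _ = _ := by ring
  have main' : ∀ t ∈ Icc 0 T, Ψ (X t) + M⁻¹ * S.γ * ∫ s in (0 : ℝ)..t, ‖v₁ s - v₂ s‖ ^ S.p
      ≤ S.resid K * (T + 2 * K) * (τ + σ) := by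
    intro t ht
    have hsub : uIcc 0 t ⊆ uIcc 0 T := by
      rw [uIcc_of_le ht.1, uIcc_of_le hT.le]; exact Icc_subset_Icc_right ht.2
    have h1 := main t ht
    simp only [hφdef] at h1
    rw [intervalIntegral.integral_sub (ih.mono_set hsub) ((iv.const_mul _).mono_set hsub)] at h1
    have h2 : ∫ s in (0 : ℝ)..t, M⁻¹ * S.γ * ‖v₁ s - v₂ s‖ ^ S.p
        = M⁻¹ * S.γ * ∫ s in (0 : ℝ)..t, ‖v₁ s - v₂ s‖ ^ S.p :=
      intervalIntegral.integral_const_mul _ _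
    linarith [hhT t ht]
  have hΨlow : ∀ t ∈ Icc 0 T, M⁻¹ * (r / 2 * ‖Z₁ t - Z₂ t‖ ^ 2
      + S.c2 / 2 * ‖S.D (u₁ t - u₂ t)‖ ^ 2) ≤ Ψ (X t) := by
    intro t ht
    simp only [hΨdef, hXdef]
    have hexp2 : M⁻¹ ≤ Real.exp (-Γ t) := by
      rw [hM, ← Real.exp_neg]; exact Real.exp_le_exp.2 (by linarith [hΓM t ht])
    exact mul_le_mul hexp2 (hη0 t ht) (by positivity) (Real.exp_pos _).le
  have hC₀e : S.resid K * (T + 2 * K) * (τ + σ) = M⁻¹ * (C₀ * (τ + σ)) := by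
    simp only [C₀]; field_simp
  have hs : 0 ≤ τ + σ := by linarith
  have h_int0 : ∀ t ∈ Icc 0 T, 0 ≤ ∫ s in (0 : ℝ)..t, ‖v₁ s - v₂ s‖ ^ S.p := fun t ht =>
    intervalIntegral.integral_nonneg ht.1 fun s _ => by positivity
  have hfin : ∀ t ∈ Icc 0 T, r / 2 * ‖Z₁ t - Z₂ t‖ ^ 2 + S.c2 / 2 * ‖S.D (u₁ t - u₂ t)‖ ^ 2
      + S.γ * ∫ s in (0 : ℝ)..t, ‖v₁ s - v₂ s‖ ^ S.p ≤ C₀ * (τ + σ) := by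
    intro t ht
    have h1 := main' t ht
    have h2 := hΨlow t ht
    rw [hC₀e] at h1
    refine le_of_mul_le_mul_left ?_ (inv_pos.2 hM0)
    calc _ = M⁻¹ * (r / 2 * ‖Z₁ t - Z₂ t‖ ^ 2 + S.c2 / 2 * ‖S.D (u₁ t - u₂ t)‖ ^ 2)
          + M⁻¹ * S.γ * ∫ s in (0 : ℝ)..t, ‖v₁ s - v₂ s‖ ^ S.p := by ring
      _ ≤ _ := by linarith
  have hfac : ∀ x y : ℝ, 0 < y → y * x ≤ C₀ * (τ + σ) → x ≤ C₀ * (1 / y) * (τ + σ) := by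
    intro x y hy hxy
    have : x ≤ (C₀ * (τ + σ)) / y := by rw [le_div_iff₀ hy]; linarith
    exact this.trans (le_of_eq (by ring))
  have hexpand : C₀ * (2 / r + 2 / S.c2 + 1 / S.γ) * (τ + σ)
      = C₀ * (1 / (r / 2)) * (τ + σ) + C₀ * (1 / (S.c2 / 2)) * (τ + σ)
        + C₀ * (1 / S.γ) * (τ + σ) := by
    rw [one_div_div, one_div_div]; ring
  have p1 : 0 ≤ C₀ * (1 / (r / 2)) * (τ + σ) := by positivity
  have p2 : 0 ≤ C₀ * (1 / (S.c2 / 2)) * (τ + σ) := by positivity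
  have p3 : 0 ≤ C₀ * (1 / S.γ) * (τ + σ) := by positivity
  rw [hexpand]
  refine ⟨fun t ht => ⟨?_, ?_⟩, ?_⟩
  · have h1 := hfin t ht
    have h2 := mul_nonneg hγ.le (h_int0 t ht)
    have h3 : 0 ≤ S.c2 / 2 * ‖S.D (u₁ t - u₂ t)‖ ^ 2 := by positivity
    have := hfac (‖Z₁ t - Z₂ t‖ ^ 2) (r / 2) (by positivity) (by linarith)
    linarith
  · have h1 := hfin t ht
    have h2 := mul_nonneg hγ.le (h_int0 t ht)
    have h3 : 0 ≤ r / 2 * ‖Z₁ t - Z₂ t‖ ^ 2 := by positivity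
    have := hfac (‖S.D (u₁ t - u₂ t)‖ ^ 2) (S.c2 / 2) (by positivity) (by linarith)
    linarith
  · have h1 := hfin T ⟨hT.le, le_rfl⟩
    have h3 : 0 ≤ r / 2 * ‖Z₁ T - Z₂ T‖ ^ 2 := by positivity
    have h4 : 0 ≤ S.c2 / 2 * ‖S.D (u₁ T - u₂ T)‖ ^ 2 := by positivity
    have := hfac (∫ s in (0 : ℝ)..T, ‖v₁ s - v₂ s‖ ^ S.p) S.γ hγ (by linarith)
    linarith

end Westervelt

end

noncomputable section

namespace Westervelt

open Filter Topology

variable {V H G : Type*} [NormedAddCommGroup V] [NormedSpace ℝ V] [CompleteSpace V]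
    [NormedAddCommGroup H] [InnerProductSpace ℝ H] [CompleteSpace H]
    [NormedAddCommGroup G] [InnerProductSpace ℝ G]

namespace DampedWave

/-- The modulus of uniform convexity of `Φ` with respect to the norm of `V`. -/
def γ' (S : DampedWave V H G) : ℝ := S.γ * (1 / 2) ^ S.p

theorem γ'_pos (S : DampedWave V H G) : 0 < S.γ' := by
  have := S.γ_pos
  unfold γ'
  positivity

theorem Φ_strong (S : DampedWave V H G) (x y : V) :
    S.Φ x + S.A x (y - x) + S.β / 4 * ‖S.D (y - x)‖ ^ 2 + S.γ' * ‖y - x‖ ^ S.p ≤ S.Φ y := by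
  set m := x + (1 / 2 : ℝ) • (y - x) with hm
  have e1 : m - x = (1 / 2 : ℝ) • (y - x) := by rw [hm]; abel
  have e2 : y - m = (1 / 2 : ℝ) • (y - x) := by rw [hm]; module
  have h1 := S.Φ_sub x m
  have h2 := S.Φ_sub m y
  have h3 := S.A_mono x m
  rw [e1] at h1 h3
  rw [e2] at h2
  simp only [map_smul, sub_apply, smul_eq_mul, norm_smul, Real.norm_of_nonneg
    (show (0 : ℝ) ≤ 1 / 2 by norm_num)] at h1 h2 h3
  rw [Real.mul_rpow (by norm_num) (norm_nonneg _)] at h3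
  unfold γ'
  linarith

theorem Φ_ge (S : DampedWave V H G) (x : V) :
    S.β / 4 * ‖S.D x‖ ^ 2 + S.γ' * ‖x‖ ^ S.p ≤ S.Φ x := by
  have h := S.Φ_strong 0 x
  rw [S.Φ_zero, S.A_zero, sub_zero, zero_apply] at h
  linarith

theorem norm_D_sq_le (S : DampedWave V H G) (x : V) : S.β / 4 * ‖S.D x‖ ^ 2 ≤ S.Φ x := by
  have h := S.Φ_ge x
  have := S.γ'_pos
  have : 0 ≤ S.γ' * ‖x‖ ^ S.p := by positivity
  linarith

theorem norm_rpow_le (S : DampedWave V H G) (x : V) : S.γ' * ‖x‖ ^ S.p ≤ S.Φ x := by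
  have h := S.Φ_ge x
  have := S.β_pos
  have : 0 ≤ S.β / 4 * ‖S.D x‖ ^ 2 := by positivity
  linarith

theorem Φ_nonneg (S : DampedWave V H G) (x : V) : 0 ≤ S.Φ x := by
  have := S.γ'_pos
  exact le_trans (by positivity) (S.norm_rpow_le x)

theorem norm_le_of_Φ_le (S : DampedWave V H G) {x : V} {ρ : ℝ} (hρ : 0 ≤ ρ)
    (h : S.Φ x ≤ S.γ' * ρ ^ S.p) : ‖x‖ ≤ ρ := by
  have h1 := (S.norm_rpow_le x).trans h
  have h2 := le_of_mul_le_mul_left h1 S.γ'_pos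
  exact (Real.rpow_le_rpow_iff (norm_nonneg _) hρ (by linarith [S.one_lt_p])).1 h2

theorem continuous_A_apply (S : DampedWave V H G) (w : V) : Continuous fun x => S.A x w := by
  refine continuous_apply_of_monotone (fun x y => ?_) S.A_bdd S.A_hemi w
  have := S.β_pos
  have := S.γ_pos
  exact le_trans (by positivity) (S.A_mono x y)

/-- `w` is the velocity after one semi-implicit time step of length `τ` from `(u, v)`. -/
def IsStep (S : DampedWave V H G) (τ : ℝ) (u v w : V) : Prop :=
  ∀ z, inner ℝ (τ⁻¹ • (S.ι w - S.ι v) - S.B u (τ⁻¹ • (S.ι w - S.ι v))) (S.ι z)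
    + S.c2 * inner ℝ (S.D (u + τ • w)) (S.D z) + S.A w z = inner ℝ (S.B v (S.ι v)) (S.ι z)

theorem exists_isStep (S : DampedWave V H G) {τ : ℝ} (hτ : 0 < τ) {u : V} (v : V)
    (hu : ∀ h, 0 ≤ inner ℝ (h - S.B u h) h) : ∃ w, S.IsStep τ u v w := by
  set F : V → ℝ := fun w => τ⁻¹ / 2 * inner ℝ ((S.ι w - S.ι v) - S.B u (S.ι w - S.ι v))
      (S.ι w - S.ι v) + S.c2 * inner ℝ (S.D u) (S.D w) + S.c2 * τ / 2 * ‖S.D w‖ ^ 2 + S.Φ w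
      - inner ℝ (S.B v (S.ι v)) (S.ι w) with hF
  set P : V → V →L[ℝ] ℝ := fun w =>
    (innerSL ℝ (τ⁻¹ • (S.ι w - S.ι v) - S.B u (τ⁻¹ • (S.ι w - S.ι v)))).comp S.ι
    + S.c2 • (innerSL ℝ (S.D (u + τ • w))).comp S.D + S.A w
    - (innerSL ℝ (S.B v (S.ι v))).comp S.ι with hP
  have hPapp : ∀ w z, P w z = inner ℝ (τ⁻¹ • (S.ι w - S.ι v) - S.B u (τ⁻¹ • (S.ι w - S.ι v)))
      (S.ι z) + S.c2 * inner ℝ (S.D (u + τ • w)) (S.D z) + S.A w z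
      - inner ℝ (S.B v (S.ι v)) (S.ι z) := by
    intro w z
    simp only [hP, sub_apply, add_apply, smul_apply, ContinuousLinearMap.comp_apply,
      innerSL_apply_apply, smul_eq_mul]
  have hconv : IsUnifConvex F P S.γ' S.p := by
    intro x y
    have h1 := S.Φ_strong x y
    have h2 := hu (S.ι (y - x))
    have h3 : 0 ≤ S.c2 * τ / 2 * ‖S.D (y - x)‖ ^ 2 := by have := S.c2_pos; positivity
    have h4 : 0 ≤ S.β / 4 * ‖S.D (y - x)‖ ^ 2 := by have := S.β_pos; positivity
    have h5 : 0 ≤ τ⁻¹ / 2 * inner ℝ (S.ι (y - x) - S.B u (S.ι (y - x))) (S.ι (y - x)) := by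
      positivity
    rw [hPapp]
    simp only [hF]
    have key : ∀ X Y : H, inner ℝ (Y - S.B u Y) Y = inner ℝ (X - S.B u X) X
        + 2 * inner ℝ (X - S.B u X) (Y - X) + inner ℝ ((Y - X) - S.B u (Y - X)) (Y - X) := by
      intro X Y
      have e1 : inner ℝ (Y - X) (S.B u X) = inner ℝ (S.B u (Y - X)) X := (S.B_symm _ _ _).symm
      have e2 : inner ℝ (S.B u X) X = inner ℝ X (S.B u X) := S.B_symm _ _ _
      have e3 : inner ℝ (S.B u Y) X = inner ℝ Y (S.B u X) := S.B_symm _ _ _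
      have e4 : inner ℝ (S.B u X) Y = inner ℝ Y (S.B u X) := real_inner_comm _ _
      have e5 : inner ℝ X Y = inner ℝ Y X := real_inner_comm _ _
      simp only [map_sub, inner_sub_left, inner_sub_right, e2, e3, e4, e5]
      ring
    have k1 := key (S.ι x - S.ι v) (S.ι y - S.ι v)
    have e6 : (S.ι y - S.ι v) - (S.ι x - S.ι v) = S.ι (y - x) := by rw [map_sub]; abel
    rw [e6] at k1
    have e7 : ‖S.D y‖ ^ 2 = ‖S.D x‖ ^ 2 + 2 * inner ℝ (S.D x) (S.D (y - x))
        + ‖S.D (y - x)‖ ^ 2 := by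
      rw [← norm_add_sq_real, ← map_add, add_sub_cancel]
    have e8 : inner ℝ (S.D (u + τ • x)) (S.D (y - x))
        = inner ℝ (S.D u) (S.D y) - inner ℝ (S.D u) (S.D x)
          + τ * inner ℝ (S.D x) (S.D (y - x)) := by
      rw [map_add, map_smul, inner_add_left, inner_smul_left, map_sub, inner_sub_right]
      simp
    have e9 : inner ℝ (τ⁻¹ • (S.ι x - S.ι v) - S.B u (τ⁻¹ • (S.ι x - S.ι v))) (S.ι (y - x))
        = τ⁻¹ * inner ℝ ((S.ι x - S.ι v) - S.B u (S.ι x - S.ι v)) (S.ι (y - x)) := by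
      rw [map_smul, ← smul_sub, inner_smul_left]; simp
    have e10 : inner ℝ (S.B v (S.ι v)) (S.ι (y - x))
        = inner ℝ (S.B v (S.ι v)) (S.ι y) - inner ℝ (S.B v (S.ι v)) (S.ι x) := by
      rw [map_sub, inner_sub_right]
    rw [k1, e7, e8, e9, e10]
    linarith
  have hhemi : ∀ x w, Tendsto (fun s : ℝ => P (x + s • w) w) (𝓝 0) (𝓝 (P x w)) := by
    intro x w
    simp only [hPapp]
    refine Tendsto.sub_const (Tendsto.add ?_ (S.A_hemi x w)) _
    have hc : Continuous fun s : ℝ =>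
        inner ℝ (τ⁻¹ • (S.ι (x + s • w) - S.ι v) - S.B u (τ⁻¹ • (S.ι (x + s • w) - S.ι v)))
        (S.ι w) + S.c2 * inner ℝ (S.D (u + τ • (x + s • w))) (S.D w) := by fun_prop
    have := hc.tendsto 0
    simpa using this
  obtain ⟨w, hw⟩ := hconv.exists_critical S.γ'_pos S.one_lt_p hhemi
  refine ⟨w, fun z => ?_⟩
  have := hPapp w z
  rw [hw, zero_apply] at this
  linarith

/-- The energy of the state `(u, v)`. -/
def energy (S : DampedWave V H G) (u v : V) : ℝ := S.Φ v + S.c2 * inner ℝ (S.D u) (S.D v)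

theorem coercive_of_norm_le (S : DampedWave V H G) {u : V} (hu : ‖S.B u‖ ≤ 1 / 2) (h : H) :
    1 / 2 * ‖h‖ ^ 2 ≤ inner ℝ (h - S.B u h) h := by
  rw [inner_sub_left, real_inner_self_eq_norm_sq]
  have h1 : inner ℝ (S.B u h) h ≤ ‖S.B u h‖ * ‖h‖ := real_inner_le_norm _ _
  have h2 : ‖S.B u h‖ * ‖h‖ ≤ (1 / 2 * ‖h‖) * ‖h‖ := by
    gcongr; exact (S.B u).le_of_opNorm_le hu h
  linarith

/-- The growth rate of the energy along the time steps. -/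
def growth (S : DampedWave V H G) : ℝ := ((‖S.B‖ * S.C₂) ^ 2 + S.c2) / (S.β / 4)

theorem growth_nonneg (S : DampedWave V H G) : 0 ≤ S.growth := by
  have := S.β_pos
  have := S.c2_pos
  unfold growth
  positivity

theorem energy_step (S : DampedWave V H G) {τ : ℝ} (hτ : 0 < τ) {u v w : V}
    (hs : S.IsStep τ u v w) (hu : ‖S.B u‖ ≤ 1 / 2) (hv : ‖v‖ ≤ 1) :
    S.energy (u + τ • w) w + τ / 4 * ‖τ⁻¹ • (S.ι w - S.ι v)‖ ^ 2
      ≤ S.energy u v + τ * S.growth * (S.Φ v + S.Φ w) := by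
  set δ := τ⁻¹ • (S.ι w - S.ι v) with hδ
  have hιδ : S.ι (w - v) = τ • δ := by
    rw [hδ, smul_smul, mul_inv_cancel₀ hτ.ne', one_smul, map_sub]
  have h1 := hs (w - v)
  rw [← hδ, hιδ, real_inner_smul_right _ δ τ, real_inner_smul_right _ δ τ] at h1
  have h2 := S.Φ_sub w v
  have e2 : S.A w (v - w) = - S.A w (w - v) := by rw [← map_neg, neg_sub]
  rw [e2] at h2
  have h3 := S.coercive_of_norm_le hu δ
  have hf : ‖S.B v (S.ι v)‖ ≤ ‖S.B‖ * S.C₂ * ‖S.D v‖ := by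
    have := S.norm_B_le hv (S.ι v)
    have h5 := S.ι_le v
    calc _ ≤ ‖S.B‖ * 1 * ‖S.ι v‖ := this
      _ ≤ ‖S.B‖ * 1 * (S.C₂ * ‖S.D v‖) := by gcongr
      _ = _ := by ring
  have h4 : inner ℝ (S.B v (S.ι v)) δ ≤ (‖S.B‖ * S.C₂) ^ 2 * ‖S.D v‖ ^ 2 + 1 / 4 * ‖δ‖ ^ 2 := by
    have h5 : inner ℝ (S.B v (S.ι v)) δ ≤ (‖S.B‖ * S.C₂ * ‖S.D v‖) * ‖δ‖ :=
      (real_inner_le_norm _ _).trans (by gcongr)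
    have h6 : ∀ x y : ℝ, x * y ≤ x ^ 2 + 1 / 4 * y ^ 2 := fun x y => by
      linarith [sq_nonneg (x - y / 2)]
    have := h6 (‖S.B‖ * S.C₂ * ‖S.D v‖) ‖δ‖
    rw [mul_pow _ ‖S.D v‖] at this
    linarith
  have e5 : inner ℝ (S.D (u + τ • w)) (S.D w) - inner ℝ (S.D u) (S.D v)
      = inner ℝ (S.D (u + τ • w)) (S.D (w - v)) + τ * inner ℝ (S.D w) (S.D v) := by
    simp only [map_add, map_smul, map_sub, inner_add_left, inner_smul_left, inner_sub_right]
    simp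
    ring
  have h6 : inner ℝ (S.D w) (S.D v) ≤ ‖S.D v‖ ^ 2 + ‖S.D w‖ ^ 2 := by
    have := real_inner_le_norm (S.D w) (S.D v)
    linarith [sq_nonneg (‖S.D v‖ - ‖S.D w‖), sq_nonneg (‖S.D v‖), sq_nonneg (‖S.D w‖)]
  have hc := S.c2_pos
  have hb := S.β_pos
  have h7 : (‖S.B‖ * S.C₂) ^ 2 * ‖S.D v‖ ^ 2 + S.c2 * (‖S.D v‖ ^ 2 + ‖S.D w‖ ^ 2)
      ≤ S.growth * (S.Φ v + S.Φ w) := by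
    have h8 : ‖S.D v‖ ^ 2 ≤ S.Φ v / (S.β / 4) := by
      rw [le_div_iff₀ (by positivity)]; linarith [S.norm_D_sq_le v]
    have h9 : ‖S.D w‖ ^ 2 ≤ S.Φ w / (S.β / 4) := by
      rw [le_div_iff₀ (by positivity)]; linarith [S.norm_D_sq_le w]
    have h10 : S.growth * (S.Φ v + S.Φ w)
        = ((‖S.B‖ * S.C₂) ^ 2 + S.c2) * (S.Φ v / (S.β / 4) + S.Φ w / (S.β / 4)) := by
      unfold growth; ring
    rw [h10]
    calc _ ≤ ((‖S.B‖ * S.C₂) ^ 2 + S.c2) * (‖S.D v‖ ^ 2 + ‖S.D w‖ ^ 2) := by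
          have : 0 ≤ (‖S.B‖ * S.C₂) ^ 2 * ‖S.D w‖ ^ 2 := by positivity
          linarith
      _ ≤ _ := by gcongr
  unfold energy
  have h11 : S.c2 * inner ℝ (S.D w) (S.D v) ≤ S.c2 * (‖S.D v‖ ^ 2 + ‖S.D w‖ ^ 2) := by gcongr
  have h12 : τ * (inner ℝ (S.B v (S.ι v)) δ - inner ℝ (δ - S.B u δ) δ
      + S.c2 * inner ℝ (S.D w) (S.D v)) ≤ τ * (S.growth * (S.Φ v + S.Φ w) - 1 / 4 * ‖δ‖ ^ 2) := by
    gcongr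
    linarith
  have e13 : S.c2 * inner ℝ (S.D (u + τ • w)) (S.D w) = S.c2 * inner ℝ (S.D u) (S.D v)
      + S.c2 * inner ℝ (S.D (u + τ • w)) (S.D (w - v)) + τ * (S.c2 * inner ℝ (S.D w) (S.D v)) := by
    linear_combination S.c2 * e5
  linarith

end DampedWave

end Westervelt

end

noncomputable section

namespace Westervelt

open Filter Topology

variable {V H G : Type*} [NormedAddCommGroup V] [NormedSpace ℝ V] [CompleteSpace V]
    [NormedAddCommGroup H] [InnerProductSpace ℝ H] [CompleteSpace H]
    [NormedAddCommGroup G] [InnerProductSpace ℝ G]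

theorem discrete_gronwall {φ : ℕ → ℝ} {a b : ℝ} (hb : 0 ≤ b) {N : ℕ}
    (h : ∀ n ≤ N, φ n ≤ a + b * ∑ j ∈ Finset.range n, φ j) :
    ∀ n ≤ N, φ n ≤ a * (1 + b) ^ n := by
  have key : ∀ n ≤ N, a + b * ∑ j ∈ Finset.range n, φ j ≤ a * (1 + b) ^ n := by
    intro n
    induction n with
    | zero => intro _; simp
    | succ n ih =>
      intro hn
      have h1 := ih (by omega)
      have h2 := h n (by omega)
      rw [Finset.sum_range_succ, pow_succ]
      have h3 : b * φ n ≤ b * (a * (1 + b) ^ n) := by gcongr; linarith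
      linarith
  exact fun n hn => (h n hn).trans (key n hn)

namespace DampedWave

/-- The Gronwall rate in the a priori estimate on `[0, T]`. -/
def apRate (S : DampedWave V H G) (T : ℝ) : ℝ := 2 * S.growth + S.c2 ^ 2 * T / (S.β / 4) ^ 2

/-- The initial energy in the a priori estimate. -/
def initEnergy (S : DampedWave V H G) (u v : V) : ℝ :=
  S.energy u v + S.c2 ^ 2 / (S.β / 4) * ‖S.D u‖ ^ 2

theorem apRate_nonneg (S : DampedWave V H G) {T : ℝ} (hT : 0 ≤ T) : 0 ≤ S.apRate T := by
  have := S.growth_nonneg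
  have := S.β_pos
  unfold apRate
  positivity

theorem abs_coupling_le (S : DampedWave V H G) (u v : V) :
    |S.c2 * inner ℝ (S.D u) (S.D v)|
      ≤ 1 / 2 * S.Φ v + S.c2 ^ 2 / (2 * (S.β / 4)) * ‖S.D u‖ ^ 2 := by
  have hb := S.β_pos
  have hc := S.c2_pos
  have h1 : |S.c2 * inner ℝ (S.D u) (S.D v)| ≤ S.c2 * ‖S.D u‖ * ‖S.D v‖ := by
    rw [abs_mul, abs_of_pos hc, mul_assoc]
    gcongr
    exact abs_real_inner_le_norm _ _
  have h2 : S.c2 * ‖S.D u‖ * ‖S.D v‖ ≤ 1 / 2 * (S.β / 4 * ‖S.D v‖ ^ 2)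
      + (S.c2 * ‖S.D u‖) ^ 2 / (2 * (S.β / 4)) := by
    have : S.c2 * ‖S.D u‖ * ‖S.D v‖ - 1 / 2 * (S.β / 4 * ‖S.D v‖ ^ 2)
        ≤ (S.c2 * ‖S.D u‖) ^ 2 / (2 * (S.β / 4)) := by
      rw [le_div_iff₀ (by positivity)]
      linarith [sq_nonneg (S.c2 * ‖S.D u‖ - S.β / 4 * ‖S.D v‖)]
    linarith
  have h3 := S.norm_D_sq_le v
  have h4 : (S.c2 * ‖S.D u‖) ^ 2 / (2 * (S.β / 4))
      = S.c2 ^ 2 / (2 * (S.β / 4)) * ‖S.D u‖ ^ 2 := by ring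
  linarith

theorem norm_D_sq_le_sum (S : DampedWave V H G) {T τ : ℝ} (hτ : 0 < τ) {U W : ℕ → V} {n : ℕ}
    (hn : n * τ ≤ T) (hU : ∀ j, U (j + 1) = U j + τ • W (j + 1)) :
    ‖S.D (U n)‖ ^ 2 ≤ 2 * ‖S.D (U 0)‖ ^ 2
      + 2 * T * τ / (S.β / 4) * ∑ j ∈ Finset.range (n + 1), S.Φ (W j) := by
  have hb := S.β_pos
  have h1 : ∀ m, ‖S.D (U m)‖ ≤ ‖S.D (U 0)‖ + τ * ∑ j ∈ Finset.range m, ‖S.D (W (j + 1))‖ := by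
    intro m
    induction m with
    | zero => simp
    | succ m ih =>
      rw [hU, map_add, map_smul, Finset.sum_range_succ, mul_add]
      have := norm_add_le (S.D (U m)) (τ • S.D (W (m + 1)))
      rw [norm_smul, Real.norm_of_nonneg hτ.le] at this
      linarith
  have h2 : (∑ j ∈ Finset.range n, ‖S.D (W (j + 1))‖) ^ 2
      ≤ n * ∑ j ∈ Finset.range n, ‖S.D (W (j + 1))‖ ^ 2 := by
    have := sq_sum_le_card_mul_sum_sq (s := Finset.range n) (f := fun j => ‖S.D (W (j + 1))‖)
    simpa using this
  have h3 : ∑ j ∈ Finset.range n, ‖S.D (W (j + 1))‖ ^ 2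
      ≤ (∑ j ∈ Finset.range (n + 1), S.Φ (W j)) / (S.β / 4) := by
    rw [Finset.sum_range_succ', le_div_iff₀ (by positivity), Finset.sum_mul]
    have : ∑ i ∈ Finset.range n, ‖S.D (W (i + 1))‖ ^ 2 * (S.β / 4)
        ≤ ∑ i ∈ Finset.range n, S.Φ (W (i + 1)) :=
      Finset.sum_le_sum fun i _ => by linarith [S.norm_D_sq_le (W (i + 1))]
    linarith [S.Φ_nonneg (W 0)]
  have hs : 0 ≤ ∑ j ∈ Finset.range n, ‖S.D (W (j + 1))‖ ^ 2 :=
    Finset.sum_nonneg fun _ _ => by positivity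
  have hs' : 0 ≤ ∑ j ∈ Finset.range n, ‖S.D (W (j + 1))‖ :=
    Finset.sum_nonneg fun _ _ => by positivity
  calc ‖S.D (U n)‖ ^ 2 ≤ (‖S.D (U 0)‖ + τ * ∑ j ∈ Finset.range n, ‖S.D (W (j + 1))‖) ^ 2 := by
        gcongr; exact h1 n
    _ ≤ 2 * ‖S.D (U 0)‖ ^ 2 + 2 * (τ * ∑ j ∈ Finset.range n, ‖S.D (W (j + 1))‖) ^ 2 :=
        sq_add_le _ _
    _ = 2 * ‖S.D (U 0)‖ ^ 2 + 2 * τ ^ 2 * (∑ j ∈ Finset.range n, ‖S.D (W (j + 1))‖) ^ 2 := by ring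
    _ ≤ 2 * ‖S.D (U 0)‖ ^ 2
        + 2 * τ ^ 2 * (n * ∑ j ∈ Finset.range n, ‖S.D (W (j + 1))‖ ^ 2) := by gcongr
    _ = 2 * ‖S.D (U 0)‖ ^ 2
        + 2 * τ * (n * τ) * ∑ j ∈ Finset.range n, ‖S.D (W (j + 1))‖ ^ 2 := by ring
    _ ≤ 2 * ‖S.D (U 0)‖ ^ 2
        + 2 * τ * T * ((∑ j ∈ Finset.range (n + 1), S.Φ (W j)) / (S.β / 4)) := by
        have hT0 : 0 ≤ T := le_trans (by positivity) hn
        gcongr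
    _ = _ := by ring

theorem apriori (S : DampedWave V H G) {T τ : ℝ} (hτ : 0 < τ) {U W : ℕ → V} {n : ℕ}
    (hn : n * τ ≤ T) (hU : ∀ j, U (j + 1) = U j + τ • W (j + 1))
    (hs : ∀ j < n, S.IsStep τ (U j) (W j) (W (j + 1)))
    (hB : ∀ j < n, ‖S.B (U j)‖ ≤ 1 / 2) (hW : ∀ j < n, ‖W j‖ ≤ 1) :
    S.Φ (W n) + 1 / 2 * ∑ j ∈ Finset.range n, τ * ‖τ⁻¹ • (S.ι (W (j + 1)) - S.ι (W j))‖ ^ 2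
      ≤ 2 * S.initEnergy (U 0) (W 0)
        + 2 * S.apRate T * τ * ∑ j ∈ Finset.range (n + 1), S.Φ (W j) := by
  have hb := S.β_pos
  have hg := S.growth_nonneg
  have h1 : ∀ m ≤ n, S.energy (U m) (W m)
      + ∑ j ∈ Finset.range m, τ / 4 * ‖τ⁻¹ • (S.ι (W (j + 1)) - S.ι (W j))‖ ^ 2
      ≤ S.energy (U 0) (W 0)
        + τ * S.growth * ∑ j ∈ Finset.range m, (S.Φ (W j) + S.Φ (W (j + 1))) := by
    intro m
    induction m with
    | zero => intro _; simp
    | succ m ih =>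
      intro hm
      have h2 := S.energy_step hτ (hs m (by omega)) (hB m (by omega)) (hW m (by omega))
      rw [← hU] at h2
      have h3 := ih (by omega)
      rw [Finset.sum_range_succ, Finset.sum_range_succ, mul_add]
      linarith
  have h2 := h1 n le_rfl
  have h3 : ∑ j ∈ Finset.range n, (S.Φ (W j) + S.Φ (W (j + 1)))
      ≤ 2 * ∑ j ∈ Finset.range (n + 1), S.Φ (W j) := by
    rw [Finset.sum_add_distrib]
    have e1 := Finset.sum_range_succ (fun j => S.Φ (W j)) n
    have e2 := Finset.sum_range_succ' (fun j => S.Φ (W j)) n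
    linarith [S.Φ_nonneg (W 0), S.Φ_nonneg (W n)]
  have h4 : τ * S.growth * ∑ j ∈ Finset.range n, (S.Φ (W j) + S.Φ (W (j + 1)))
      ≤ τ * S.growth * (2 * ∑ j ∈ Finset.range (n + 1), S.Φ (W j)) := by gcongr
  have h5 := (abs_le.1 (S.abs_coupling_le (U n) (W n))).1
  have h6 := S.norm_D_sq_le_sum hτ hn hU
  have h7 : S.c2 ^ 2 / (2 * (S.β / 4)) * ‖S.D (U n)‖ ^ 2 ≤
      S.c2 ^ 2 / (2 * (S.β / 4)) * (2 * ‖S.D (U 0)‖ ^ 2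
      + 2 * T * τ / (S.β / 4) * ∑ j ∈ Finset.range (n + 1), S.Φ (W j)) := by gcongr
  have e8 : S.c2 ^ 2 / (2 * (S.β / 4)) * (2 * ‖S.D (U 0)‖ ^ 2
      + 2 * T * τ / (S.β / 4) * ∑ j ∈ Finset.range (n + 1), S.Φ (W j))
      = S.c2 ^ 2 / (S.β / 4) * ‖S.D (U 0)‖ ^ 2
        + (S.c2 ^ 2 * T / (S.β / 4) ^ 2) * τ * ∑ j ∈ Finset.range (n + 1), S.Φ (W j) := by
    field_simp
  have e9 : ∑ j ∈ Finset.range n, τ / 4 * ‖τ⁻¹ • (S.ι (W (j + 1)) - S.ι (W j))‖ ^ 2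
      = 1 / 4 * ∑ j ∈ Finset.range n, τ * ‖τ⁻¹ • (S.ι (W (j + 1)) - S.ι (W j))‖ ^ 2 := by
    rw [Finset.mul_sum]
    exact Finset.sum_congr rfl fun j _ => by ring
  unfold initEnergy apRate
  unfold energy at *
  rw [e9] at h2
  linarith

theorem initEnergy_le (S : DampedWave V H G) (u v : V) :
    S.initEnergy u v ≤ (2 + 2 * S.c2 ^ 2 / (S.β / 4) * ‖S.D‖ ^ 2) * (S.Φ v + ‖u‖ ^ 2) := by
  have hb := S.β_pos
  have h1 := (abs_le.1 (S.abs_coupling_le u v)).2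
  have h2 : ‖S.D u‖ ^ 2 ≤ ‖S.D‖ ^ 2 * ‖u‖ ^ 2 := by
    rw [← mul_pow]; gcongr; exact S.D.le_opNorm u
  have h3 : 2 * S.c2 ^ 2 / (S.β / 4) * ‖S.D u‖ ^ 2
      ≤ 2 * S.c2 ^ 2 / (S.β / 4) * (‖S.D‖ ^ 2 * ‖u‖ ^ 2) := by gcongr
  have e4 : S.c2 ^ 2 / (2 * (S.β / 4)) * ‖S.D u‖ ^ 2
      = 1 / 4 * (2 * S.c2 ^ 2 / (S.β / 4) * ‖S.D u‖ ^ 2) := by field_simp; norm_num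
  have e5 : S.c2 ^ 2 / (S.β / 4) * ‖S.D u‖ ^ 2
      = 1 / 2 * (2 * S.c2 ^ 2 / (S.β / 4) * ‖S.D u‖ ^ 2) := by field_simp
  have h6 : 0 ≤ 2 * S.c2 ^ 2 / (S.β / 4) * ‖S.D u‖ ^ 2 := by positivity
  have h7 : 0 ≤ 2 * S.c2 ^ 2 / (S.β / 4) * ‖S.D‖ ^ 2 * S.Φ v := by
    have := S.Φ_nonneg v; positivity
  unfold initEnergy energy
  nlinarith [S.Φ_nonneg v, sq_nonneg ‖u‖]

/-- Discrete solutions of the semi-implicit scheme with `N` steps on `[0, T]`, with bounds. -/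
structure IsRothe (S : DampedWave V H G) (T ε C : ℝ) (N : ℕ) (u₀ v₀ : V) (U W : ℕ → V) :
    Prop where
  U_zero : U 0 = u₀
  W_zero : W 0 = v₀
  U_succ : ∀ n, U (n + 1) = U n + (T / N) • W (n + 1)
  step : ∀ n < N, S.IsStep (T / N) (U n) (W n) (W (n + 1))
  Φ_le : ∀ n ≤ N, S.Φ (W n) ≤ ε
  W_le : ∀ n ≤ N, ‖W n‖ ≤ 1
  U_le : ∀ n ≤ N, ‖U n‖ ≤ 1
  B_le : ∀ n ≤ N, ‖S.B (U n)‖ ≤ 1 / 2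
  sum_le : ∑ j ∈ Finset.range N, T / N * ‖(T / N)⁻¹ • (S.ι (W (j + 1)) - S.ι (W j))‖ ^ 2 ≤ ε
  energy_le : ∀ n < N, S.energy (U (n + 1)) (W (n + 1)) ≤ S.energy (U n) (W n) + T / N * C

open Classical in
/-- One step of the scheme. -/
def next (S : DampedWave V H G) (τ : ℝ) (x : V × V) : V × V :=
  let w := if h : ∃ w, S.IsStep τ x.1 x.2 w then h.choose else x.2
  (x.1 + τ • w, w)

theorem next_isStep (S : DampedWave V H G) {τ : ℝ} {x : V × V}
    (h : ∃ w, S.IsStep τ x.1 x.2 w) : S.IsStep τ x.1 x.2 (S.next τ x).2 := by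
  simp only [next, dif_pos h]
  exact h.choose_spec

theorem exists_isRothe (S : DampedWave V H G) {T : ℝ} (hT : 0 < T) :
    ∃ ε₀ > 0, ∃ C ≥ 0, ∃ N₀ : ℕ, 0 < N₀ ∧ ∀ u₀ v₀ : V, S.Φ v₀ + ‖u₀‖ ^ 2 ≤ ε₀ →
      ∀ N ≥ N₀, ∃ U W, S.IsRothe T (C * (S.Φ v₀ + ‖u₀‖ ^ 2)) (2 * S.growth * (C * ε₀))
        N u₀ v₀ U W := by
  set Λ := S.apRate T
  have hΛ : 0 ≤ Λ := S.apRate_nonneg hT.le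
  set b := ‖S.B‖ with hb
  have hb0 : 0 ≤ b := by rw [hb]; positivity
  have hβ := S.β_pos
  set C' := 2 + 2 * S.c2 ^ 2 / (S.β / 4) * ‖S.D‖ ^ 2
  have hC' : 0 < C' := by positivity
  set Cφ := 4 * Real.exp (4 * Λ * T) * C'
  have hCφ : 0 < Cφ := by positivity
  set ρ := 1 / (4 * (b + 1) * (T + 1)) with hρ
  have hρ0 : 0 < ρ := by positivity
  have hρ1 : ρ ≤ 1 := by
    rw [hρ, div_le_one (by positivity)]; nlinarith
  have hTρ : T * ρ ≤ 1 / (4 * (b + 1)) := by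
    rw [hρ, mul_one_div, div_le_div_iff₀ (by positivity) (by positivity)]; nlinarith
  have hγ := S.γ'_pos
  set ε₀ := min (S.γ' * ρ ^ S.p / Cφ) ((1 / (4 * (b + 1))) ^ 2) with hε₀
  have hε₀0 : 0 < ε₀ := lt_min (by positivity) (by positivity)
  set C := Cφ + 4 * C' + 8 * Λ * T * Cφ
  have hC : 0 ≤ C := by positivity
  obtain ⟨N₀, hN₀⟩ := exists_nat_gt (4 * Λ * T)
  refine ⟨ε₀, hε₀0, C, hC, N₀ + 1, by omega, ?_⟩
  intro u₀ v₀ he N hN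
  have hN0 : 0 < N := by omega
  have hNr : (0 : ℝ) < N := by exact_mod_cast hN0
  set e := S.Φ v₀ + ‖u₀‖ ^ 2 with he'
  have he0 : 0 ≤ e := by have := S.Φ_nonneg v₀; positivity
  set τ := T / N with hτ
  have hτ0 : 0 < τ := by positivity
  have hNτ : N * τ = T := by rw [hτ]; field_simp
  have hnτ : ∀ n ≤ N, (n : ℝ) * τ ≤ T := fun n hn => by
    rw [← hNτ]; gcongr
  have hΛτ : 2 * Λ * τ ≤ 1 / 2 := by
    have h1 : (N₀ : ℝ) ≤ N := by exact_mod_cast (by omega : N₀ ≤ N)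
    rw [hτ, mul_div_assoc', div_le_iff₀ hNr]
    linarith
  set X : ℕ → V × V := fun n => (S.next τ)^[n] (u₀, v₀)
  have hXs : ∀ n, X (n + 1) = S.next τ (X n) := fun n => Function.iterate_succ_apply' _ _ _
  set U : ℕ → V := fun n => (X n).1
  set W : ℕ → V := fun n => (X n).2
  have hUs : ∀ n, U (n + 1) = U n + τ • W (n + 1) := fun n => by
    simp only [U, W, hXs]; rfl
  have hU0 : U 0 = u₀ := rfl
  have hW0 : W 0 = v₀ := rfl
  have hu₀ : ‖u₀‖ ≤ 1 / (4 * (b + 1)) := by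
    have h1 : ‖u₀‖ ^ 2 ≤ (1 / (4 * (b + 1))) ^ 2 := by
      have := he.trans (min_le_right _ _)
      have := S.Φ_nonneg v₀
      linarith
    exact (sq_le_sq₀ (norm_nonneg _) (by positivity)).1 h1
  have hUle : ∀ n ≤ N, (∀ j ≤ n, ‖W j‖ ≤ ρ) → ‖U n‖ ≤ 1 / (2 * (b + 1)) := by
    intro n hn hW
    have h1 : ∀ m ≤ n, ‖U m‖ ≤ ‖u₀‖ + m * τ * ρ := by
      intro m
      induction m with
      | zero => intro _; simp [hU0]
      | succ m ih =>
        intro hm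
        have h2 := ih (by omega)
        have h3 : ‖U (m + 1)‖ ≤ ‖U m‖ + τ * ρ := by
          rw [hUs]
          refine (norm_add_le _ _).trans ?_
          rw [norm_smul, Real.norm_of_nonneg hτ0.le]
          gcongr
          exact hW _ hm
        push_cast
        linarith
    have h2 := h1 n le_rfl
    have h3 : n * τ * ρ ≤ T * ρ := by gcongr; exact hnτ n hn
    have h4 : 1 / (2 * (b + 1)) = 1 / (4 * (b + 1)) + 1 / (4 * (b + 1)) := by field_simp; norm_num
    linarith
  have hBle : ∀ u : V, ‖u‖ ≤ 1 / (2 * (b + 1)) → ‖S.B u‖ ≤ 1 / 2 := by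
    intro u hu
    refine (S.B.le_opNorm u).trans ?_
    calc b * ‖u‖ ≤ (b + 1) * (1 / (2 * (b + 1))) := by gcongr; linarith
      _ = 1 / 2 := by field_simp
  have hstep : ∀ n ≤ N, (∀ j ≤ n, ‖W j‖ ≤ ρ) → S.IsStep τ (U n) (W n) (W (n + 1)) := by
    intro n hn hW
    have h1 := S.exists_isStep hτ0 (u := U n) (W n) fun h =>
      le_trans (by positivity) (S.coercive_of_norm_le (hBle _ (hUle n hn hW)) h)
    have := S.next_isStep h1
    simp only [W, hXs]
    exact this
  have hinit : S.initEnergy (U 0) (W 0) ≤ C' * e := S.initEnergy_le _ _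
  have hap : ∀ n ≤ N, (∀ j < n, ‖W j‖ ≤ ρ) → S.Φ (W n)
      + 1 / 2 * ∑ j ∈ Finset.range n, τ * ‖τ⁻¹ • (S.ι (W (j + 1)) - S.ι (W j))‖ ^ 2
      ≤ 2 * (C' * e) + 2 * Λ * τ * ∑ j ∈ Finset.range (n + 1), S.Φ (W j) := by
    intro n hn hW
    have := S.apriori hτ0 (hnτ n hn) hUs
      (fun j hj => hstep j (by omega) fun i hi => hW i (by omega))
      (fun j hj => hBle _ (hUle j (by omega) fun i hi => hW i (by omega)))
      (fun j hj => (hW j hj).trans hρ1)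
    linarith
  have hpow : ∀ n ≤ N, (1 + 4 * Λ * τ) ^ n ≤ Real.exp (4 * Λ * T) := by
    intro n hn
    calc (1 + 4 * Λ * τ) ^ n ≤ (Real.exp (4 * Λ * τ)) ^ n := by
          gcongr; linarith [Real.add_one_le_exp (4 * Λ * τ)]
      _ = Real.exp (4 * Λ * (n * τ)) := by rw [← Real.exp_nat_mul]; congr 1; ring
      _ ≤ Real.exp (4 * Λ * T) := by gcongr; exact hnτ n hn
  have hΦn : ∀ n ≤ N, (∀ j < n, ‖W j‖ ≤ ρ) → S.Φ (W n) ≤ Cφ * e := by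
    intro n hn hW
    have h1 : ∀ m ≤ n, S.Φ (W m)
        ≤ 4 * (C' * e) + 4 * Λ * τ * ∑ j ∈ Finset.range m, S.Φ (W j) := by
      intro m hm
      have h2 := hap m (by omega) fun j hj => hW j (by omega)
      have h3 : 0 ≤ ∑ j ∈ Finset.range m, τ * ‖τ⁻¹ • (S.ι (W (j + 1)) - S.ι (W j))‖ ^ 2 :=
        Finset.sum_nonneg fun _ _ => by positivity
      rw [Finset.sum_range_succ, mul_add] at h2
      have h4 : 2 * Λ * τ * S.Φ (W m) ≤ 1 / 2 * S.Φ (W m) := by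
        gcongr; exact S.Φ_nonneg _
      linarith
    have h5 := discrete_gronwall (by positivity) h1 n le_rfl
    refine h5.trans ?_
    calc 4 * (C' * e) * (1 + 4 * Λ * τ) ^ n ≤ 4 * (C' * e) * Real.exp (4 * Λ * T) := by
          gcongr; exact hpow n hn
      _ = Cφ * e := by simp only [Cφ]; ring
  have hsmall : Cφ * e ≤ S.γ' * ρ ^ S.p := by
    have h1 := he.trans (min_le_left _ _)
    rw [le_div_iff₀ hCφ] at h1
    linarith
  have hWρ : ∀ n, n ≤ N → ‖W n‖ ≤ ρ := by
    intro n
    induction n using Nat.strong_induction_on with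
    | _ n ih =>
      intro hn
      exact S.norm_le_of_Φ_le hρ0.le ((hΦn n hn fun j hj => ih j hj (by omega)).trans hsmall)
  have hΦ : ∀ n ≤ N, S.Φ (W n) ≤ C * e := by
    intro n hn
    refine (hΦn n hn fun j hj => hWρ j (by omega)).trans ?_
    have : 0 ≤ (4 * C' + 8 * Λ * T * Cφ) * e := by positivity
    simp only [C]; linarith
  have hUN : ∀ n ≤ N, ‖U n‖ ≤ 1 / (2 * (b + 1)) := fun n hn =>
    hUle n hn fun j hj => hWρ j (by omega)
  refine ⟨U, W, ⟨hU0, hW0, hUs, fun n hn => hstep n (by omega) fun j hj => hWρ j (by omega), hΦ,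
    fun n hn => (hWρ n hn).trans hρ1, fun n hn => (hUN n hn).trans ?_,
    fun n hn => hBle _ (hUN n hn), ?_, fun n hn => ?_⟩⟩
  · rw [div_le_one (by positivity)]; linarith
  · have h1 := hap N le_rfl fun j hj => hWρ j (by omega)
    have h2 : ∑ j ∈ Finset.range (N + 1), S.Φ (W j) ≤ (N + 1) * (Cφ * e) := by
      calc _ ≤ ∑ j ∈ Finset.range (N + 1), Cφ * e := Finset.sum_le_sum fun j hj =>
            hΦn j (by have := Finset.mem_range.1 hj; omega) fun i hi => hWρ i (by
              have := Finset.mem_range.1 hj; omega)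
        _ = _ := by simp
    have h3 : 2 * Λ * τ * ∑ j ∈ Finset.range (N + 1), S.Φ (W j) ≤ 4 * Λ * T * (Cφ * e) := by
      have h4 : (1 : ℝ) ≤ N := by exact_mod_cast hN0
      calc _ ≤ 2 * Λ * τ * ((N + 1) * (Cφ * e)) := by gcongr
        _ ≤ 2 * Λ * τ * ((N + N) * (Cφ * e)) := by gcongr
        _ = 4 * Λ * (N * τ) * (Cφ * e) := by ring
        _ = _ := by rw [hNτ]
    have h5 := S.Φ_nonneg (W N)
    have h6 : 0 ≤ Cφ * e := by positivity
    simp only [C]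
    linarith
  · have h1 := S.energy_step hτ0 (hstep n (by omega) fun j hj => hWρ j (by omega))
      (hBle _ (hUN n (by omega))) ((hWρ n (by omega)).trans hρ1)
    rw [← hUs] at h1
    have h2 : 0 ≤ τ / 4 * ‖τ⁻¹ • (S.ι (W (n + 1)) - S.ι (W n))‖ ^ 2 := by positivity
    have h3 : C * e ≤ C * ε₀ := by gcongr
    have h4 : τ * S.growth * (S.Φ (W n) + S.Φ (W (n + 1))) ≤ τ * S.growth * (2 * (C * ε₀)) := by
      have := S.growth_nonneg
      gcongr
      linarith [hΦ n (by omega), hΦ (n + 1) (by omega)]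
    linarith

end DampedWave

end Westervelt

end

noncomputable section

namespace Westervelt

open Filter Topology

section StepFunctions

variable {E : Type*} [NormedAddCommGroup E] [NormedSpace ℝ E] [CompleteSpace E]

/-- The number of the time step of length `τ` that contains `t`. -/
def idx (τ t : ℝ) : ℕ := ⌈t / τ⌉₊

theorem idx_eq {τ : ℝ} (hτ : 0 < τ) {t : ℝ} {n : ℕ} (ht : t ∈ Ioc (n * τ) ((n + 1 : ℕ) * τ)) :
    idx τ t = n + 1 := by
  rw [idx, Nat.ceil_eq_iff (by omega)]
  constructor
  · rw [lt_div_iff₀ hτ]; simpa using ht.1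
  · rw [div_le_iff₀ hτ]; exact ht.2

theorem idx_zero (τ : ℝ) : idx τ 0 = 0 := by simp [idx]

theorem le_idx_mul {τ : ℝ} (hτ : 0 < τ) (t : ℝ) : t ≤ idx τ t * τ := by
  have := Nat.le_ceil (t / τ)
  rwa [div_le_iff₀ hτ] at this

theorem idx_mul_lt {τ : ℝ} (hτ : 0 < τ) {t : ℝ} (ht : 0 ≤ t) : idx τ t * τ < t + τ := by
  have := Nat.ceil_lt_add_one (div_nonneg ht hτ.le)
  have h2 := mul_lt_mul_of_pos_right this hτ
  rw [add_mul, div_mul_cancel₀ _ hτ.ne', one_mul] at h2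
  exact h2

theorem idx_le {τ : ℝ} (hτ : 0 < τ) {t : ℝ} {N : ℕ} (ht : t ≤ N * τ) : idx τ t ≤ N := by
  rw [idx, Nat.ceil_le, div_le_iff₀ hτ]; exact ht

theorem idx_mono {τ : ℝ} (hτ : 0 < τ) {s t : ℝ} (h : s ≤ t) : idx τ s ≤ idx τ t :=
  Nat.ceil_mono (by gcongr)

theorem measurable_idx (τ : ℝ) : Measurable (idx τ) :=
  Nat.measurable_ceil.comp (measurable_id.div_const τ)

theorem stronglyMeasurable_comp_idx (τ : ℝ) (s : ℕ → E) :
    StronglyMeasurable fun t => s (idx τ t) :=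
  (StronglyMeasurable.of_discrete (f := s)).comp_measurable (measurable_idx τ)

theorem exists_idx {τ : ℝ} (hτ : 0 < τ) {t : ℝ} (ht : 0 < t) :
    ∃ n : ℕ, idx τ t = n + 1 ∧ t ∈ Ioc (n * τ) ((n + 1 : ℕ) * τ) := by
  have h0 : idx τ t ≠ 0 := by
    rw [idx, Ne, Nat.ceil_eq_zero, not_le]; positivity
  obtain ⟨n, hn⟩ := Nat.exists_eq_succ_of_ne_zero h0
  refine ⟨n, hn, ?_, ?_⟩
  · have := idx_mul_lt hτ ht.le
    rw [hn] at this
    push_cast at this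
    linarith
  · have := le_idx_mul hτ t
    rwa [hn] at this

theorem eqOn_const_step {τ : ℝ} (hτ : 0 < τ) (s : ℕ → E) {n : ℕ} {t : ℝ}
    (ht : t ∈ Icc (n * τ) ((n + 1 : ℕ) * τ)) :
    EqOn (fun r => s (idx τ r)) (fun _ => s (n + 1)) (uIoc (n * τ) t) := by
  intro r hr
  rw [uIoc_of_le ht.1] at hr
  simp only
  rw [idx_eq hτ ⟨hr.1, hr.2.trans ht.2⟩]

theorem intervalIntegrable_step_aux {τ : ℝ} (hτ : 0 < τ) (s : ℕ → E) {n : ℕ} {t : ℝ}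
    (ht : t ∈ Icc (n * τ) ((n + 1 : ℕ) * τ)) :
    IntervalIntegrable (fun r => s (idx τ r)) volume (n * τ) t :=
  (intervalIntegrable_congr (eqOn_const_step hτ s ht)).2 intervalIntegrable_const

theorem integral_step_aux {τ : ℝ} (hτ : 0 < τ) (s : ℕ → E) {n : ℕ} {t : ℝ}
    (ht : t ∈ Icc (n * τ) ((n + 1 : ℕ) * τ)) :
    ∫ r in (n * τ)..t, s (idx τ r) = (t - n * τ) • s (n + 1) := by
  rw [intervalIntegral.integral_congr_ae (Eventually.of_forall (eqOn_const_step hτ s ht)),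
    intervalIntegral.integral_const]

theorem intervalIntegrable_step {τ : ℝ} (hτ : 0 < τ) (s : ℕ → E) {t : ℝ} (ht : 0 ≤ t) :
    IntervalIntegrable (fun r => s (idx τ r)) volume 0 t := by
  have h1 : ∀ n : ℕ, IntervalIntegrable (fun r => s (idx τ r)) volume 0 (n * τ) := by
    intro n
    induction n with
    | zero => simp
    | succ n ih =>
      exact ih.trans (intervalIntegrable_step_aux hτ s ⟨by gcongr; omega, le_rfl⟩)
  rcases ht.eq_or_lt with rfl | ht
  · simp
  · obtain ⟨n, -, hn⟩ := exists_idx hτ ht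
    exact (h1 n).trans (intervalIntegrable_step_aux hτ s (Ioc_subset_Icc_self hn))

theorem integral_step {τ : ℝ} (hτ : 0 < τ) {s X : ℕ → E} (hX : ∀ n, X (n + 1) = X n + τ • s (n + 1))
    {t : ℝ} (ht : 0 ≤ t) :
    X (idx τ t) - (idx τ t * τ - t) • s (idx τ t) = X 0 + ∫ r in (0 : ℝ)..t, s (idx τ r) := by
  have h1 : ∀ n : ℕ, ∫ r in (0 : ℝ)..(n * τ), s (idx τ r) = X n - X 0 := by
    intro n
    induction n with
    | zero => simp
    | succ n ih =>
      have hmem : ((n + 1 : ℕ) * τ) ∈ Icc (n * τ) ((n + 1 : ℕ) * τ) := ⟨by gcongr; omega, le_rfl⟩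
      rw [← intervalIntegral.integral_add_adjacent_intervals
        (intervalIntegrable_step hτ s (by positivity)) (intervalIntegrable_step_aux hτ s hmem), ih,
        integral_step_aux hτ s hmem, hX]
      have : ((n + 1 : ℕ) : ℝ) * τ - n * τ = τ := by push_cast; ring
      rw [this]
      abel
  rcases ht.eq_or_lt with rfl | ht
  · simp [idx_zero]
  · obtain ⟨n, hn1, hn⟩ := exists_idx hτ ht
    rw [← intervalIntegral.integral_add_adjacent_intervals
      (intervalIntegrable_step hτ s (t := n * τ) (by positivity))
      (intervalIntegrable_step_aux hτ s (Ioc_subset_Icc_self hn)), h1,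
      integral_step_aux hτ s (Ioc_subset_Icc_self hn), hn1, hX]
    push_cast
    module

theorem isPrim_step {τ T : ℝ} (hτ : 0 < τ) (hT : 0 ≤ T) {s X : ℕ → E}
    (hX : ∀ n, X (n + 1) = X n + τ • s (n + 1)) :
    IsPrim T (fun t => X (idx τ t) - (idx τ t * τ - t) • s (idx τ t)) (fun t => s (idx τ t)) := by
  refine ⟨intervalIntegrable_step hτ s hT, fun t ht => ?_⟩
  rw [integral_step hτ hX ht.1]
  simp [idx_zero]

end StepFunctions

variable {V H G : Type*} [NormedAddCommGroup V] [NormedSpace ℝ V] [CompleteSpace V]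
    [NormedAddCommGroup H] [InnerProductSpace ℝ H] [CompleteSpace H]
    [NormedAddCommGroup G] [InnerProductSpace ℝ G]

namespace DampedWave

/-- The properties of the time interpolants of a discrete solution. -/
structure IsInterp (S : DampedWave V H G) (T τ K ε : ℝ) (u₀ v₀ : V) (u v : ℝ → V)
    (Z a : ℝ → H) : Prop extends S.IsApproxSol T τ K (1 / 2) u₀ v₀ u v Z a where
  v_zero : v 0 = v₀
  Φ_le : ∀ t ∈ Icc 0 T, S.Φ (v t) ≤ ε
  v_le : ∀ t ∈ Icc 0 T, ‖v t‖ ≤ 1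
  near' : ∀ t ∈ Icc 0 T, ‖Z t - S.ι (v t)‖ ^ 2 ≤ τ * ε
  a_le : ∫ t in (0 : ℝ)..T, ‖a t‖ ^ 2 ≤ ε
  energy_le : ∀ s ∈ Icc 0 T, ∀ t ∈ Icc 0 T, s ≤ t →
    S.energy (u t) (v t) ≤ S.energy (u s) (v s) + K * (t - s + τ)

theorem IsRothe.energy_le_of_le {S : DampedWave V H G} {T ε C : ℝ} {N : ℕ} {u₀ v₀ : V}
    {U W : ℕ → V} (h : S.IsRothe T ε C N u₀ v₀ U W) {j n : ℕ} (hj : j ≤ n) (hn : n ≤ N) :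
    S.energy (U n) (W n) ≤ S.energy (U j) (W j) + ((n : ℝ) - j) * (T / N * C) := by
  induction n, hj using Nat.le_induction with
  | base => simp
  | succ n hjn ih =>
    have h1 := ih (by omega)
    have h2 := h.energy_le n (by omega)
    push_cast
    linarith

theorem abs_energy_sub_le (S : DampedWave V H G) (u u' v : V) :
    |S.energy u v - S.energy u' v| ≤ S.c2 * ‖S.D‖ ^ 2 * ‖u - u'‖ * ‖v‖ := by
  have hc := S.c2_pos
  have e : S.energy u v - S.energy u' v = S.c2 * inner ℝ (S.D (u - u')) (S.D v) := by
    unfold energy; rw [map_sub, inner_sub_left]; ring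
  rw [e, abs_mul, abs_of_pos hc]
  calc S.c2 * |inner ℝ (S.D (u - u')) (S.D v)| ≤ S.c2 * (‖S.D (u - u')‖ * ‖S.D v‖) := by
        gcongr; exact abs_real_inner_le_norm _ _
    _ ≤ S.c2 * ((‖S.D‖ * ‖u - u'‖) * (‖S.D‖ * ‖v‖)) := by
        gcongr <;> exact S.D.le_opNorm _
    _ = _ := by ring

theorem IsRothe.exists_isInterp {S : DampedWave V H G} {T ε C K : ℝ} {N : ℕ} {u₀ v₀ : V}
    {U W : ℕ → V} (h : S.IsRothe T ε C N u₀ v₀ U W) (hT : 0 < T) (hN : 0 < N) (hC : 0 ≤ C)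
    (hK1 : 1 ≤ K)
    (hKB : 3 * ‖S.B‖ ≤ K) (hKD : S.c2 * ‖S.D‖ ≤ K) (hKε : ε ≤ K)
    (hKC : C + 2 * S.c2 * ‖S.D‖ ^ 2 ≤ K) :
    ∃ u v Z a, S.IsInterp T (T / N) K ε u₀ v₀ u v Z a := by
  have hNr : (0 : ℝ) < N := by exact_mod_cast hN
  set τ := T / N with hτd
  have hτ : 0 < τ := by positivity
  have hNτ : N * τ = T := by rw [hτd]; field_simp
  have hc := S.c2_pos
  set δ : ℕ → H := fun n => τ⁻¹ • (S.ι (W n) - S.ι (W (n - 1))) with hδ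
  have hδs : ∀ n, δ (n + 1) = τ⁻¹ • (S.ι (W (n + 1)) - S.ι (W n)) := fun n => rfl
  set u : ℝ → V := fun t => U (idx τ t) - (idx τ t * τ - t) • W (idx τ t) with hu
  set v : ℝ → V := fun t => W (idx τ t) with hv
  set Z : ℝ → H := fun t => S.ι (W (idx τ t)) - (idx τ t * τ - t) • δ (idx τ t) with hZ
  set a : ℝ → H := fun t => δ (idx τ t) with ha
  have hidx : ∀ t ∈ Icc 0 T, idx τ t ≤ N := fun t ht => idx_le hτ (by rw [hNτ]; exact ht.2)
  have hθ0 : ∀ t, 0 ≤ idx τ t * τ - t := fun t => by linarith [le_idx_mul hτ t]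
  have hθ1 : ∀ t, 0 ≤ t → idx τ t * τ - t ≤ τ := fun t ht => by linarith [idx_mul_lt hτ ht]
  have hZs : ∀ n, S.ι (W (n + 1)) = S.ι (W n) + τ • δ (n + 1) := fun n => by
    rw [hδs, smul_smul, mul_inv_cancel₀ hτ.ne', one_smul]; abel
  have hsum : ∫ t in (0 : ℝ)..T, ‖a t‖ ^ 2 ≤ ε := by
    have h1 := integral_step hτ (s := fun n => ‖δ n‖ ^ 2)
      (X := fun n => ∑ j ∈ Finset.range n, τ * ‖δ (j + 1)‖ ^ 2)
      (fun n => by rw [Finset.sum_range_succ, smul_eq_mul]) hT.le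
    have h2 : idx τ T = N := by
      obtain ⟨m, rfl⟩ := Nat.exists_eq_succ_of_ne_zero hN.ne'
      refine idx_eq hτ ⟨?_, ?_⟩
      · rw [← hNτ]; gcongr; omega
      · exact hNτ.ge
    rw [h2] at h1
    simp only [hNτ, sub_self, zero_smul, sub_zero, Finset.range_zero, Finset.sum_empty,
      zero_add] at h1
    simp only [ha]
    rw [← h1]
    exact h.sum_le
  have hδle : ∀ n ≤ N, 0 < n → τ * ‖δ n‖ ^ 2 ≤ ε := by
    intro n hn hn0
    obtain ⟨m, rfl⟩ := Nat.exists_eq_succ_of_ne_zero hn0.ne'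
    refine le_trans ?_ h.sum_le
    exact Finset.single_le_sum (f := fun j => τ * ‖τ⁻¹ • (S.ι (W (j + 1)) - S.ι (W j))‖ ^ 2)
      (fun _ _ => by positivity) (Finset.mem_range.2 (by omega))
  have hε : 0 ≤ ε := le_trans (S.Φ_nonneg _) (h.Φ_le 0 (by omega))
  have hW1 : ∀ t ∈ Icc 0 T, ‖v t‖ ≤ 1 := fun t ht => h.W_le _ (hidx t ht)
  have huconv : ∀ t ∈ Icc 0 T, ∃ x ∈ Icc (0 : ℝ) 1, ∃ n ≤ N, ∃ m ≤ N,
      u t = (1 - x) • U n + x • U m := by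
    intro t ht
    rcases ht.1.eq_or_lt with rfl | ht0
    · exact ⟨0, by simp, 0, by omega, 0, by omega, by simp [hu, idx_zero]⟩
    · obtain ⟨n, hn1, hn⟩ := exists_idx hτ ht0
      have h1 := hidx t ht
      have h2 := hθ0 t
      have h3 := hθ1 t ht.1
      rw [hn1] at h1 h2 h3
      refine ⟨(((n + 1 : ℕ) : ℝ) * τ - t) / τ, ⟨by positivity, by rwa [div_le_one hτ]⟩, n + 1, h1,
        n, by omega, ?_⟩
      simp only [hu, hn1]
      rw [h.U_succ n, ← hτd]
      have : (((n + 1 : ℕ) : ℝ) * τ - t) • W (n + 1)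
          = ((((n + 1 : ℕ) : ℝ) * τ - t) / τ) • (τ • W (n + 1)) := by
        rw [smul_smul, div_mul_cancel₀ _ hτ.ne']
      rw [this]
      module
  have hule : ∀ t ∈ Icc 0 T, ‖u t‖ ≤ 1 := by
    intro t ht
    obtain ⟨x, hx, n, hn, m, hm, he⟩ := huconv t ht
    rw [he]
    refine (norm_add_le _ _).trans ?_
    rw [norm_smul, norm_smul, Real.norm_of_nonneg hx.1, Real.norm_of_nonneg (by linarith [hx.2])]
    have h1 := mul_le_mul_of_nonneg_left (h.U_le n hn) (by linarith [hx.2] : 0 ≤ 1 - x)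
    have h2 := mul_le_mul_of_nonneg_left (h.U_le m hm) hx.1
    linarith
  have hBle : ∀ t ∈ Icc 0 T, ‖S.B (u t)‖ ≤ 1 / 2 := by
    intro t ht
    obtain ⟨x, hx, n, hn, m, hm, he⟩ := huconv t ht
    rw [he, map_add, map_smul, map_smul]
    refine (norm_add_le _ _).trans ?_
    rw [norm_smul, norm_smul, Real.norm_of_nonneg hx.1, Real.norm_of_nonneg (by linarith [hx.2])]
    have h1 := mul_le_mul_of_nonneg_left (h.B_le n hn) (by linarith [hx.2] : 0 ≤ 1 - x)
    have h2 := mul_le_mul_of_nonneg_left (h.B_le m hm) hx.1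
    linarith
  have hud : ∀ t ∈ Icc 0 T, ‖u t - U (idx τ t)‖ ≤ τ := by
    intro t ht
    have : u t - U (idx τ t) = -((idx τ t * τ - t) • W (idx τ t)) := by simp only [hu]; abel
    rw [this, norm_neg, norm_smul, Real.norm_of_nonneg (hθ0 t)]
    calc _ ≤ τ * 1 := by gcongr; exacts [hθ1 t ht.1, hW1 t ht]
      _ = τ := mul_one _
  have hnear : ∀ t ∈ Icc 0 T, ‖Z t - S.ι (v t)‖ ≤ τ * ‖a t‖ := by
    intro t ht
    have : Z t - S.ι (v t) = -((idx τ t * τ - t) • δ (idx τ t)) := by simp only [hZ, hv]; abel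
    rw [this, norm_neg, norm_smul, Real.norm_of_nonneg (hθ0 t)]
    gcongr
    exact hθ1 t ht.1
  have hZ0 : Z 0 = S.ι v₀ := by simp [hZ, idx_zero, h.W_zero]
  refine ⟨u, v, Z, a, ⟨⟨?_, fun t ht => (hW1 t (Ioc_subset_Icc_self ht)).trans hK1,
    fun t ht => (hule t ht).trans hK1, ?_, hsum.trans hKε, by simp [hu, idx_zero, h.U_zero], hZ0,
    isPrim_step hτ hT.le h.U_succ, isPrim_step hτ hT.le (s := δ) (X := fun n => S.ι (W n)) hZs, ?_, ?_, ?_⟩, ?_, ?_, hW1, ?_, hsum,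
    ?_⟩⟩
  · exact (stronglyMeasurable_comp_idx τ W).aestronglyMeasurable
  · obtain ⟨M, hM⟩ : ∃ M, ∀ n ∈ Finset.range (N + 1), ‖δ n‖ ≤ M :=
      ⟨∑ n ∈ Finset.range (N + 1), ‖δ n‖, fun n hn =>
        Finset.single_le_sum (f := fun n => ‖δ n‖) (fun _ _ => norm_nonneg _) hn⟩
    refine MemLp.of_bound (stronglyMeasurable_comp_idx τ δ).aestronglyMeasurable M ?_
    refine (ae_restrict_iff' measurableSet_Ioc).2 (Eventually.of_forall fun t ht => ?_)
    exact hM _ (Finset.mem_range.2 (by have := hidx t (Ioc_subset_Icc_self ht); omega))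
  · exact Eventually.of_forall fun t ht => hnear t (Ioo_subset_Icc_self ht)
  · refine Eventually.of_forall fun t ht w => ?_
    obtain ⟨n, hn1, hn⟩ := exists_idx hτ ht.1
    have htc := Ioo_subset_Icc_self ht
    have h1 := hidx t htc
    rw [hn1] at h1
    have hs := h.step n (by omega) w
    rw [← hτd, ← hδs, ← h.U_succ] at hs
    have hat : a t = δ (n + 1) := by simp only [ha, hn1]
    have hvt : v t = W (n + 1) := by simp only [hv, hn1]
    have hut : ‖u t - U (n + 1)‖ ≤ τ := by have := hud t htc; rwa [hn1] at this
    have hut' : ‖u t - U n‖ ≤ τ := by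
      have : u t - U n = (t - n * τ) • W (n + 1) := by
        simp only [hu, hn1]
        rw [h.U_succ n, ← hτd]
        push_cast
        module
      rw [this, norm_smul, Real.norm_of_nonneg (by linarith [hn.1])]
      have h2 := hn.2
      push_cast at h2
      calc _ ≤ τ * 1 := by
            gcongr
            · linarith
            · exact h.W_le _ h1
        _ = τ := mul_one _
    rw [hat, hvt]
    have e1 : inner ℝ (δ (n + 1) - S.B (u t) (δ (n + 1))) (S.ι w)
        = inner ℝ (δ (n + 1) - S.B (U n) (δ (n + 1))) (S.ι w)
          - inner ℝ (S.B (u t - U n) (δ (n + 1))) (S.ι w) := by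
      rw [← inner_sub_left, map_sub S.B (u t) (U n), sub_apply]; congr 1; abel
    have e2 : inner ℝ (S.D (u t)) (S.D w) = inner ℝ (S.D (U (n + 1))) (S.D w)
        + inner ℝ (S.D (u t - U (n + 1))) (S.D w) := by
      rw [← inner_add_left, map_sub S.D (u t)]; congr 1; abel
    have e3 : inner ℝ (S.B (W (n + 1)) (S.ι (W (n + 1)))) (S.ι w)
        = inner ℝ (S.B (W n) (S.ι (W n))) (S.ι w)
          + inner ℝ (S.B (W (n + 1)) (τ • δ (n + 1)) + S.B (W n) (τ • δ (n + 1))) (S.ι w) := by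
      rw [← inner_add_left]
      congr 1
      have : τ • δ (n + 1) = S.ι (W (n + 1)) - S.ι (W n) := by rw [hZs n]; abel
      rw [this, map_sub, map_sub, S.B_comm (W (n + 1)) (W n)]
      abel
    have b1 : |inner ℝ (S.B (u t - U n) (δ (n + 1))) (S.ι w)|
        ≤ ‖S.B‖ * τ * ‖δ (n + 1)‖ * ‖S.ι w‖ :=
      (abs_real_inner_le_norm _ _).trans (by gcongr; exact S.norm_B_le hut' _)
    have b2 : |inner ℝ (S.D (u t - U (n + 1))) (S.D w)| ≤ ‖S.D‖ * τ * ‖S.D w‖ :=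
      (abs_real_inner_le_norm _ _).trans (by
        gcongr; exact (S.D.le_opNorm _).trans (by gcongr))
    have b3 : |inner ℝ (S.B (W (n + 1)) (τ • δ (n + 1)) + S.B (W n) (τ • δ (n + 1))) (S.ι w)|
        ≤ 2 * ‖S.B‖ * τ * ‖δ (n + 1)‖ * ‖S.ι w‖ := by
      refine (abs_real_inner_le_norm _ _).trans ?_
      gcongr
      have c1 := S.norm_B_le (h.W_le (n + 1) h1) (τ • δ (n + 1))
      have c2 := S.norm_B_le (h.W_le n (by omega)) (τ • δ (n + 1))
      rw [norm_smul, Real.norm_of_nonneg hτ.le] at c1 c2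
      refine (norm_add_le _ _).trans ?_
      linarith
    have e4 : inner ℝ (δ (n + 1) - S.B (u t) (δ (n + 1))) (S.ι w)
        + S.c2 * inner ℝ (S.D (u t)) (S.D w) + S.A (W (n + 1)) w
        - inner ℝ (S.B (W (n + 1)) (S.ι (W (n + 1)))) (S.ι w)
        = - inner ℝ (S.B (u t - U n) (δ (n + 1))) (S.ι w)
          + S.c2 * inner ℝ (S.D (u t - U (n + 1))) (S.D w)
          - inner ℝ (S.B (W (n + 1)) (τ • δ (n + 1)) + S.B (W n) (τ • δ (n + 1))) (S.ι w) := by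
      rw [e1, e2, e3]
      linarith
    rw [e4]
    have b2' : |S.c2 * inner ℝ (S.D (u t - U (n + 1))) (S.D w)|
        ≤ S.c2 * (‖S.D‖ * τ * ‖S.D w‖) := by
      rw [abs_mul, abs_of_pos hc]; gcongr
    calc _ ≤ ‖S.B‖ * τ * ‖δ (n + 1)‖ * ‖S.ι w‖ + S.c2 * (‖S.D‖ * τ * ‖S.D w‖)
          + 2 * ‖S.B‖ * τ * ‖δ (n + 1)‖ * ‖S.ι w‖ := by
          refine (abs_sub _ _).trans (add_le_add ((abs_add_le _ _).trans (add_le_add ?_ b2')) b3)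
          rw [abs_neg]; exact b1
      _ = τ * (3 * ‖S.B‖ * (‖δ (n + 1)‖ * ‖S.ι w‖) + S.c2 * ‖S.D‖ * ‖S.D w‖) := by ring
      _ ≤ τ * (K * ((1 + ‖δ (n + 1)‖) * ‖S.ι w‖) + K * ‖S.D w‖) := by
          gcongr
          linarith
      _ = _ := by ring
  · exact fun t ht => S.coercive_of_norm_le (hBle t ht)
  · simp [hv, idx_zero, h.W_zero]
  · exact fun t ht => h.Φ_le _ (hidx t ht)
  · intro t ht
    rcases ht.1.eq_or_lt with rfl | ht0
    · have : Z 0 - S.ι (v 0) = 0 := by simp [hZ, hv, idx_zero]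
      rw [this, norm_zero, zero_pow two_ne_zero]; positivity
    · obtain ⟨n, hn1, hn⟩ := exists_idx hτ ht0
      have h1 := hidx t ht
      have h2 : a t = δ (n + 1) := by simp only [ha, hn1]
      have h3 := hδle (n + 1) (by omega) (by omega)
      calc ‖Z t - S.ι (v t)‖ ^ 2 ≤ (τ * ‖a t‖) ^ 2 := by gcongr; exact hnear t ht
        _ = τ * (τ * ‖δ (n + 1)‖ ^ 2) := by rw [h2]; ring
        _ ≤ τ * ε := by gcongr
  · intro s hs t ht hst
    have h1 := h.energy_le_of_le (idx_mono hτ hst) (hidx t ht)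
    have h2 : ∀ r ∈ Icc 0 T, |S.energy (u r) (v r) - S.energy (U (idx τ r)) (W (idx τ r))|
        ≤ S.c2 * ‖S.D‖ ^ 2 * τ := by
      intro r hr
      refine (S.abs_energy_sub_le _ _ _).trans ?_
      calc _ ≤ S.c2 * ‖S.D‖ ^ 2 * τ * 1 := by gcongr; exacts [hud r hr, hW1 r hr]
        _ = _ := mul_one _
    have h3 := (abs_le.1 (h2 t ht)).2
    have h4 := (abs_le.1 (h2 s hs)).1
    have h5 : ((idx τ t : ℝ) - idx τ s) * (τ * C) ≤ (t - s + τ) * C := by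
      rw [← mul_assoc]
      gcongr
      linarith [le_idx_mul hτ s, idx_mul_lt hτ ht.1]
    have h6 : (C + 2 * S.c2 * ‖S.D‖ ^ 2) * (t - s + τ) ≤ K * (t - s + τ) := by
      gcongr
    have h7 : 2 * S.c2 * ‖S.D‖ ^ 2 * τ ≤ 2 * S.c2 * ‖S.D‖ ^ 2 * (t - s + τ) := by
      gcongr; linarith
    linarith

end DampedWave

end Westervelt

end

noncomputable section

namespace Westervelt

open Filter Topology

/-- A bounded sequence in a Hilbert space converges weakly along an ultrafilter. -/
theorem exists_weak_limit {E : Type*} [NormedAddCommGroup E] [InnerProductSpace ℝ E]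
    [CompleteSpace E] (𝒰 : Ultrafilter ℕ) {x : ℕ → E} {C : ℝ} (hx : ∀ n, ‖x n‖ ≤ C) :
    ∃ z, ‖z‖ ≤ C ∧ ∀ y, Tendsto (fun n => inner ℝ (x n) y) 𝒰 (𝓝 (inner ℝ z y)) := by
  have hC : 0 ≤ C := (norm_nonneg _).trans (hx 0)
  have hlim : ∀ y, ∃ l ∈ Icc (-(C * ‖y‖)) (C * ‖y‖),
      Tendsto (fun n => inner ℝ (x n) y) 𝒰 (𝓝 l) := by
    intro y
    obtain ⟨l, hl, hle⟩ := isCompact_Icc (a := -(C * ‖y‖)) (b := C * ‖y‖)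
      |>.ultrafilter_le_nhds (𝒰.map fun n => inner ℝ (x n) y) (by
        rw [le_principal_iff, Ultrafilter.mem_coe, Ultrafilter.mem_map]
        refine Filter.mem_of_superset (x := univ) univ_mem fun n _ => ?_
        rw [mem_preimage, mem_Icc, ← abs_le]
        exact (abs_real_inner_le_norm _ _).trans (by gcongr; exact hx n))
    exact ⟨l, hl, hle⟩
  choose l hl hlim using hlim
  set L : E →ₗ[ℝ] ℝ :=
    { toFun := l
      map_add' := fun y y' => tendsto_nhds_unique (hlim _) (by
        simpa only [inner_add_right] using (hlim y).add (hlim y'))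
      map_smul' := fun c y => tendsto_nhds_unique (hlim _) (by
        simpa only [real_inner_smul_right, RingHom.id_apply, smul_eq_mul] using
          (hlim y).const_mul c) }
  set L' := L.mkContinuous C fun y => by
    rw [Real.norm_eq_abs]; exact abs_le.2 (hl y)
  refine ⟨(InnerProductSpace.toDual ℝ E).symm L', ?_, fun y => ?_⟩
  · rw [LinearIsometryEquiv.norm_map]
    exact LinearMap.mkContinuous_norm_le _ hC _
  · rw [InnerProductSpace.toDual_symm_apply]
    exact hlim y

variable {V H G : Type*} [NormedAddCommGroup V] [NormedSpace ℝ V] [CompleteSpace V]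
    [NormedAddCommGroup H] [InnerProductSpace ℝ H] [CompleteSpace H]
    [NormedAddCommGroup G] [InnerProductSpace ℝ G]

namespace DampedWave

theorem isUnifConvex (S : DampedWave V H G) : IsUnifConvex S.Φ S.A S.γ' S.p := fun x y => by
  have h := S.Φ_strong x y
  have := S.β_pos
  have : 0 ≤ S.β / 4 * ‖S.D (y - x)‖ ^ 2 := by positivity
  linarith

/-- A sequence of interpolants of discrete solutions together with its limit `v`. -/
structure IsLimit (S : DampedWave V H G) (T K ε : ℝ) (u₀ v₀ : V) (τ : ℕ → ℝ)
    (un vn : ℕ → ℝ → V) (Zn an : ℕ → ℝ → H) (v : ℝ → V) : Prop where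
  interp : ∀ i, S.IsInterp T (τ i) K ε u₀ v₀ (un i) (vn i) (Zn i) (an i)
  τ_nonneg : ∀ i, 0 ≤ τ i
  τ_lim : Tendsto τ atTop (𝓝 0)
  Z_lim : ∀ t ∈ Icc 0 T, Tendsto (fun i => Zn i t) atTop (𝓝 (S.ι (v t)))
  ι_lim : ∀ t ∈ Icc 0 T, Tendsto (fun i => S.ι (vn i t)) atTop (𝓝 (S.ι (v t)))
  ae_lim : ∀ᵐ t, t ∈ Ioc 0 T → Tendsto (fun i => vn i t) atTop (𝓝 (v t))
  Φ_le : ∀ t ∈ Icc 0 T, S.Φ (v t) ≤ ε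
  v_zero : v 0 = v₀

theorem exists_isLimit (S : DampedWave V H G) {T : ℝ} (hT : 0 < T) :
    ∃ ε₀ > 0, ∃ C ≥ 0, ∃ K ≥ 1, ∀ u₀ v₀ : V, S.Φ v₀ + ‖u₀‖ ^ 2 ≤ ε₀ →
      ∃ τ un vn Zn an v, S.IsLimit T K (C * (S.Φ v₀ + ‖u₀‖ ^ 2)) u₀ v₀ τ un vn Zn an v := by
  obtain ⟨ε₀, hε₀, C, hC, N₀, hN₀, hR⟩ := S.exists_isRothe hT
  have hc := S.c2_pos
  have hg := S.growth_nonneg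
  set C₃ := 2 * S.growth * (C * ε₀)
  have hC₃ : 0 ≤ C₃ := by positivity
  set K := 1 + 3 * ‖S.B‖ + S.c2 * ‖S.D‖ + C * ε₀ + (C₃ + 2 * S.c2 * ‖S.D‖ ^ 2) with hK
  have k1 : 0 ≤ 3 * ‖S.B‖ := by positivity
  have k2 : 0 ≤ S.c2 * ‖S.D‖ := by positivity
  have k3 : 0 ≤ C * ε₀ := by positivity
  have k4 : 0 ≤ C₃ + 2 * S.c2 * ‖S.D‖ ^ 2 := by positivity
  have hK1 : 1 ≤ K := by linarith
  obtain ⟨M, hM, hstab⟩ := S.stability hT (by linarith : 0 ≤ K) (show (0 : ℝ) < 1 / 2 by norm_num)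
  refine ⟨ε₀, hε₀, C, hC, K, hK1, fun u₀ v₀ he => ?_⟩
  set ε := C * (S.Φ v₀ + ‖u₀‖ ^ 2)
  have hεK : ε ≤ C * ε₀ := mul_le_mul_of_nonneg_left he hC
  have hp := S.one_lt_p
  have hp0 : 0 < S.p := by linarith
  -- step sizes decaying fast enough
  set η : ℕ → ℝ := fun i => ((1 / 2 : ℝ) ^ (i + 1)) ^ S.p / (2 * M + 1) with hη
  have hη0 : ∀ i, 0 < η i := fun i => by positivity
  have hηanti : Antitone η := by
    intro i j hij
    simp only [hη]
    gcongr ?_ ^ S.p / _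
    exact pow_le_pow_of_le_one (by norm_num) (by norm_num) (by omega)
  have hex : ∀ i, ∃ N : ℕ, N₀ ≤ N ∧ 0 < N ∧ T / N ≤ η i ∧ T / N ≤ 1 := by
    intro i
    obtain ⟨N, hN⟩ := exists_nat_gt (max (T / η i) T)
    have hNpos : (0 : ℝ) < max N N₀ := by
      have : 0 < max N N₀ := lt_max_of_lt_right hN₀
      exact_mod_cast this
    have hNle : (N : ℝ) ≤ (max N N₀ : ℕ) := by exact_mod_cast le_max_left _ _
    refine ⟨max N N₀, le_max_right _ _, lt_max_of_lt_right hN₀, ?_, ?_⟩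
    · rw [div_le_iff₀ (by exact_mod_cast hNpos), ← div_le_iff₀' (hη0 i)]
      linarith [le_max_left (T / η i) T]
    · rw [div_le_one (by exact_mod_cast hNpos)]
      linarith [le_max_right (T / η i) T]
  choose N hN1 hN2 hN3 hN4 using hex
  have h_int : ∀ i, ∃ u v Z a, S.IsInterp T (T / N i) K ε u₀ v₀ u v Z a := by
    intro i
    obtain ⟨U, W, hUW⟩ := hR u₀ v₀ he (N i) (hN1 i)
    exact hUW.exists_isInterp hT (hN2 i) hC₃ hK1 (by linarith) (by linarith) (by linarith)
      (by linarith)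
  choose un vn Zn an hI using h_int
  have hτ0 : ∀ i, 0 ≤ T / N i := fun i => by positivity
  have hηlim : Tendsto η atTop (𝓝 0) := by
    have h1 : Tendsto (fun i : ℕ => (1 / 2 : ℝ) ^ (i + 1)) atTop (𝓝 0) :=
      (tendsto_pow_atTop_nhds_zero_of_lt_one (by norm_num) (by norm_num)).comp
        (tendsto_add_atTop_nat 1)
    have h2 := (h1.rpow_const (p := S.p) (Or.inr hp0.le)).div_const (2 * M + 1)
    rwa [Real.zero_rpow hp0.ne', zero_div] at h2
  have hτlim : Tendsto (fun i => T / N i) atTop (𝓝 0) :=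
    squeeze_zero hτ0 hN3 hηlim
  have hst := fun i j => hstab _ _ u₀ v₀ _ _ _ _ _ _ _ _ (hτ0 i) (hN4 i) (hτ0 j) (hN4 j)
    (hI i).toIsApproxSol (hI j).toIsApproxSol
  have hCau : ∀ n i j, n ≤ i → n ≤ j → M * (T / N i + T / N j) ≤ ((1 / 2 : ℝ) ^ (n + 1)) ^ S.p := by
    intro n i j hi hj
    have h1 : T / N i ≤ η n := (hN3 i).trans (hηanti hi)
    have h2 : T / N j ≤ η n := (hN3 j).trans (hηanti hj)
    have h3 : (2 * M + 1) * η n = ((1 / 2 : ℝ) ^ (n + 1)) ^ S.p := by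
      simp only [hη]; field_simp
    calc M * (T / N i + T / N j) ≤ M * (η n + η n) := by gcongr
      _ ≤ (2 * M + 1) * η n := by nlinarith [hη0 n]
      _ = _ := h3
  -- almost everywhere convergence of the velocities
  have hae : ∀ᵐ t ∂(volume.restrict (Ioc 0 T)), ∃ l, Tendsto (fun i => vn i t) atTop (𝓝 l) := by
    refine Lp.ae_tendsto_of_cauchy_eLpNorm (p := ENNReal.ofReal S.p) (fun i => (hI i).v_meas)
      (ENNReal.one_le_ofReal.2 hp.le) (B := fun n => ENNReal.ofReal ((1 / 2 : ℝ) ^ n)) ?_ ?_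
    · rw [← ENNReal.ofReal_tsum_of_nonneg (fun n => by positivity) summable_geometric_two]
      exact ENNReal.ofReal_ne_top
    · intro n i j hi hj
      have h1 := (hst i j).2.trans (hCau n i j hi hj)
      have hbd : ∀ t ∈ Ioc 0 T, ‖vn i t - vn j t‖ ≤ 2 * K := fun t ht =>
        (norm_sub_le _ _).trans (by linarith [(hI i).v_bdd t ht, (hI j).v_bdd t ht])
      have h_int := intervalIntegrable_norm_rpow hT.le hp0.le
        ((hI i).v_meas.sub (hI j).v_meas) hbd
      rw [intervalIntegrable_iff_integrableOn_Ioc_of_le hT.le] at h_int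
      simp only [Pi.sub_apply] at h_int
      rw [intervalIntegral.integral_of_le hT.le] at h1
      rw [eLpNorm_eq_lintegral_rpow_enorm_toReal (by simpa using hp0) ENNReal.ofReal_ne_top,
        ENNReal.toReal_ofReal hp0.le]
      have h2 : ∫⁻ t in Ioc 0 T, ‖(vn i - vn j) t‖ₑ ^ S.p
          = ENNReal.ofReal (∫ t in Ioc 0 T, ‖vn i t - vn j t‖ ^ S.p) := by
        rw [ofReal_integral_eq_lintegral_ofReal h_int (Eventually.of_forall fun t => by positivity)]
        refine lintegral_congr fun t => ?_
        rw [Pi.sub_apply, ← ofReal_norm, ENNReal.ofReal_rpow_of_nonneg (norm_nonneg _)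
          hp0.le]
      rw [h2]
      calc _ ≤ (ENNReal.ofReal (((1 / 2 : ℝ) ^ (n + 1)) ^ S.p)) ^ (1 / S.p) := by gcongr
        _ = ENNReal.ofReal ((1 / 2 : ℝ) ^ (n + 1)) := by
            rw [ENNReal.ofReal_rpow_of_nonneg (by positivity) (by positivity),
              ← Real.rpow_mul (by positivity), mul_one_div_cancel hp0.ne', Real.rpow_one]
        _ < ENNReal.ofReal ((1 / 2 : ℝ) ^ n) := by
            rw [ENNReal.ofReal_lt_ofReal_iff (by positivity), pow_succ]
            have : (0 : ℝ) < (1 / 2) ^ n := by positivity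
            linarith
  -- convergence in `H` at every time
  have hZ : ∀ t ∈ Icc 0 T, ∃ z, Tendsto (fun i => Zn i t) atTop (𝓝 z) := by
    intro t ht
    refine cauchySeq_tendsto_of_complete (Metric.cauchySeq_iff.2 fun e he => ?_)
    have h1 : Tendsto (fun n : ℕ => ((1 / 2 : ℝ) ^ (n + 1)) ^ S.p) atTop (𝓝 0) := by
      have h1 : Tendsto (fun i : ℕ => (1 / 2 : ℝ) ^ (i + 1)) atTop (𝓝 0) :=
        (tendsto_pow_atTop_nhds_zero_of_lt_one (by norm_num) (by norm_num)).comp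
          (tendsto_add_atTop_nat 1)
      have h2 := h1.rpow_const (p := S.p) (Or.inr hp0.le)
      rwa [Real.zero_rpow hp0.ne'] at h2
    obtain ⟨n, hn⟩ := (h1.eventually_lt_const (show 0 < e ^ 2 by positivity)).exists
    refine ⟨n, fun i hi j hj => ?_⟩
    have h2 := ((hst i j).1 t ht).1.trans (hCau n i j hi hj)
    rw [dist_eq_norm]
    exact lt_of_pow_lt_pow_left₀ 2 he.le (h2.trans_lt hn)
  choose! Zl hZl using hZ
  have hιl : ∀ t ∈ Icc 0 T, Tendsto (fun i => S.ι (vn i t)) atTop (𝓝 (Zl t)) := by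
    intro t ht
    have h1 : Tendsto (fun i => Zn i t - S.ι (vn i t)) atTop (𝓝 0) := by
      rw [tendsto_zero_iff_norm_tendsto_zero]
      have h2 : Tendsto (fun i => √(T / N i * ε)) atTop (𝓝 0) := by
        have h3 := (hτlim.mul_const ε).sqrt
        rwa [zero_mul, Real.sqrt_zero] at h3
      exact squeeze_zero (fun _ => norm_nonneg _)
        (fun i => Real.le_sqrt_of_sq_le ((hI i).near' t ht)) h2
    simpa using (hZl t ht).sub h1
  have hv : ∀ t ∈ Icc 0 T, ∃ y, S.ι y = Zl t ∧ S.Φ y ≤ ε := fun t ht =>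
    S.isUnifConvex.exists_of_tendsto S.γ'_pos hp S.ι (hιl t ht) (fun i => (hI i).Φ_le t ht)
  choose! v hv1 hv2 using hv
  refine ⟨fun i => T / N i, un, vn, Zn, an, v, hI, hτ0, hτlim, fun t ht => ?_, fun t ht => ?_, ?_,
    hv2, ?_⟩
  · rw [hv1 t ht]; exact hZl t ht
  · rw [hv1 t ht]; exact hιl t ht
  · rw [ae_restrict_iff' measurableSet_Ioc] at hae
    filter_upwards [hae] with t ht htm
    obtain ⟨l, hl⟩ := ht htm
    have h1 := tendsto_nhds_unique ((S.ι.continuous.tendsto l).comp hl)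
      (hιl t (Ioc_subset_Icc_self htm))
    rw [← hv1 t (Ioc_subset_Icc_self htm)] at h1
    rwa [← S.ι_inj h1]
  · have h0 : (0 : ℝ) ∈ Icc 0 T := ⟨le_rfl, hT.le⟩
    refine S.ι_inj (tendsto_nhds_unique (by rw [hv1 0 h0]; exact hιl 0 h0) ?_)
    simp only [fun i => (hI i).v_zero]
    exact tendsto_const_nhds

end DampedWave

end Westervelt

end

noncomputable section

namespace Westervelt

open Filter Topology

variable {V H G : Type*} [NormedAddCommGroup V] [NormedSpace ℝ V] [CompleteSpace V]
    [NormedAddCommGroup H] [InnerProductSpace ℝ H] [CompleteSpace H]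
    [NormedAddCommGroup G] [InnerProductSpace ℝ G]

theorem norm_toLp_sq {E : Type*} [NormedAddCommGroup E] [InnerProductSpace ℝ E] {T : ℝ}
    (hT : 0 ≤ T) {a : ℝ → E} (ha : MemLp a 2 (volume.restrict (Ioc 0 T))) :
    ‖ha.toLp a‖ ^ 2 = ∫ t in (0 : ℝ)..T, ‖a t‖ ^ 2 := by
  rw [← real_inner_self_eq_norm_sq, L2.inner_def, intervalIntegral.integral_of_le hT]
  refine integral_congr_ae ?_
  filter_upwards [ha.coeFn_toLp] with t ht
  rw [ht, real_inner_self_eq_norm_sq]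

theorem inner_toLp {E : Type*} [NormedAddCommGroup E] [InnerProductSpace ℝ E] {μ : Measure ℝ}
    {a b : ℝ → E} (ha : MemLp a 2 μ) (hb : MemLp b 2 μ) :
    inner ℝ (ha.toLp a) (hb.toLp b) = ∫ t, inner ℝ (a t) (b t) ∂μ := by
  rw [L2.inner_def]
  refine integral_congr_ae ?_
  filter_upwards [ha.coeFn_toLp, hb.coeFn_toLp] with t h1 h2
  rw [h1, h2]

namespace DampedWave

namespace IsLimit

variable {S : DampedWave V H G} {T K ε : ℝ} {u₀ v₀ : V} {τ : ℕ → ℝ} {un vn : ℕ → ℝ → V}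
  {Zn an : ℕ → ℝ → H} {v : ℝ → V}

theorem exists_bound (h : S.IsLimit T K ε u₀ v₀ τ un vn Zn an v) :
    ∃ R, 1 ≤ R ∧ ∀ t ∈ Icc 0 T, ‖v t‖ ≤ R := by
  have hγ := S.γ'_pos
  have hp := S.one_lt_p
  refine ⟨max 1 ((ε / S.γ') ^ (1 / S.p)), le_max_left _ _, fun t ht => ?_⟩
  have hε : 0 ≤ ε := (S.Φ_nonneg _).trans (h.Φ_le t ht)
  refine le_trans ?_ (le_max_right _ _)
  refine S.norm_le_of_Φ_le (by positivity) ((h.Φ_le t ht).trans ?_)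
  rw [← Real.rpow_mul (by positivity), one_div_mul_cancel (by linarith), Real.rpow_one,
    mul_div_cancel₀ _ hγ.ne']

theorem v_meas (h : S.IsLimit T K ε u₀ v₀ τ un vn Zn an v) :
    AEStronglyMeasurable v (volume.restrict (Ioc 0 T)) :=
  aestronglyMeasurable_of_tendsto_ae atTop (fun i => (h.interp i).v_meas)
    ((ae_restrict_iff' measurableSet_Ioc).2 h.ae_lim)

theorem v_int (h : S.IsLimit T K ε u₀ v₀ τ un vn Zn an v) (hT : 0 < T) :
    IntervalIntegrable v volume 0 T := by
  obtain ⟨R, -, hR⟩ := h.exists_bound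
  rw [intervalIntegrable_iff_integrableOn_Ioc_of_le hT.le]
  refine Integrable.of_bound (C := R) h.v_meas ?_
  exact (ae_restrict_iff' measurableSet_Ioc).2
    (Eventually.of_forall fun t ht => hR t (Ioc_subset_Icc_self ht))

theorem exists_uniform (h : S.IsLimit T K ε u₀ v₀ τ un vn Zn an v) (hT : 0 < T) {u : ℝ → V}
    (hu : IsPrim T u v) (hu0 : u 0 = u₀) :
    ∃ θ : ℕ → ℝ, Tendsto θ atTop (𝓝 0) ∧ ∀ i, ∀ t ∈ Icc 0 T, ‖un i t - u t‖ ≤ θ i := by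
  obtain ⟨R, -, hR⟩ := h.exists_bound
  refine ⟨fun i => ∫ t in (0 : ℝ)..T, ‖vn i t - v t‖, ?_, fun i t ht => ?_⟩
  · have := intervalIntegral.tendsto_integral_filter_of_dominated_convergence
      (μ := volume) (a := 0) (b := T) (l := atTop) (F := fun i t => ‖vn i t - v t‖)
      (f := fun _ => (0 : ℝ)) (fun _ => 1 + R) ?_ ?_ intervalIntegrable_const ?_
    · simpa using this
    · refine Eventually.of_forall fun i => ?_
      rw [uIoc_of_le hT.le]
      exact ((h.interp i).v_meas.sub h.v_meas).norm
    · refine Eventually.of_forall fun i => Eventually.of_forall fun t ht => ?_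
      rw [uIoc_of_le hT.le] at ht
      have ht' := Ioc_subset_Icc_self ht
      rw [norm_norm]
      exact (norm_sub_le _ _).trans (add_le_add ((h.interp i).v_le t ht') (hR t ht'))
    · filter_upwards [h.ae_lim] with t ht htm
      rw [uIoc_of_le hT.le] at htm
      exact tendsto_iff_norm_sub_tendsto_zero.1 (ht htm)
  · have h1 := (h.interp i).u_prim.sub hu
    have h2 := h1.eq t ht
    simp only [(h.interp i).u_zero, hu0, sub_self, zero_add] at h2
    rw [h2]
    have h0 : (0 : ℝ) ∈ Icc 0 T := ⟨le_rfl, hT.le⟩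
    refine (intervalIntegral.norm_integral_le_integral_norm ht.1).trans ?_
    exact intervalIntegral.integral_mono_interval le_rfl ht.1 ht.2
      (Eventually.of_forall fun _ => norm_nonneg _) h1.int.norm

theorem exists_acceleration (h : S.IsLimit T K ε u₀ v₀ τ un vn Zn an v) (hT : 0 < T)
    (𝒰 : Ultrafilter ℕ) (h𝒰 : (𝒰 : Filter ℕ) ≤ atTop) :
    ∃ a : ℝ → H, MemLp a 2 (volume.restrict (Ioc 0 T)) ∧ ∫ t in (0 : ℝ)..T, ‖a t‖ ^ 2 ≤ ε ∧
      IsPrim T (fun t => S.ι (v t)) a ∧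
      ∀ ψ : ℝ → H, MemLp ψ 2 (volume.restrict (Ioc 0 T)) →
        Tendsto (fun i => ∫ t in Ioc 0 T, inner ℝ (an i t) (ψ t)) 𝒰
          (𝓝 (∫ t in Ioc 0 T, inner ℝ (a t) (ψ t))) := by
  have hε : 0 ≤ ε := (S.Φ_nonneg _).trans (h.Φ_le 0 ⟨le_rfl, hT.le⟩)
  obtain ⟨α, hα, hw⟩ := exists_weak_limit 𝒰 (x := fun i => (h.interp i).a_memLp.toLp (an i))
    (C := √ε) (fun i => Real.le_sqrt_of_sq_le (by
      rw [norm_toLp_sq hT.le]; exact (h.interp i).a_le))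
  have hm : MemLp α 2 (volume.restrict (Ioc 0 T)) := Lp.memLp α
  have hwk : ∀ ψ : ℝ → H, MemLp ψ 2 (volume.restrict (Ioc 0 T)) →
        Tendsto (fun i => ∫ t in Ioc 0 T, inner ℝ (an i t) (ψ t)) 𝒰
          (𝓝 (∫ t in Ioc 0 T, inner ℝ (α t) (ψ t))) := by
    intro ψ hψ
    have h1 := hw (hψ.toLp ψ)
    simp only [inner_toLp (h.interp _).a_memLp hψ] at h1
    have h2 := inner_toLp hm hψ
    rw [Lp.toLp_coeFn] at h2
    rwa [h2] at h1
  refine ⟨α, hm, ?_, ⟨?_, fun t ht => ?_⟩, hwk⟩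
  · have h1 := norm_toLp_sq hT.le hm
    rw [Lp.toLp_coeFn] at h1
    rw [← h1]
    calc ‖α‖ ^ 2 ≤ √ε ^ 2 := by gcongr
      _ = ε := Real.sq_sqrt hε
  · rw [intervalIntegrable_iff_integrableOn_Ioc_of_le hT.le]
    exact hm.integrable one_le_two
  · have hsub : Ioc 0 t ⊆ Ioc 0 T := Ioc_subset_Ioc_right ht.2
    have hi : Integrable α (volume.restrict (Ioc 0 T)) := hm.integrable one_le_two
    have hset : ∀ f : ℝ → H, ∀ y : H, IntegrableOn f (Ioc 0 T) →
        ∫ s in Ioc 0 T, inner ℝ (f s) ((Ioc 0 t).indicator (fun _ => y) s)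
          = inner ℝ (∫ s in (0 : ℝ)..t, f s) y := by
      intro f y hf
      have e1 : (fun s => inner ℝ (f s) ((Ioc 0 t).indicator (fun _ => y) s))
          = (Ioc 0 t).indicator fun s => inner ℝ (f s) y := by
        ext s
        by_cases hs : s ∈ Ioc 0 t <;> simp [hs]
      rw [e1, setIntegral_indicator measurableSet_Ioc, inter_eq_right.2 hsub,
        intervalIntegral.integral_of_le ht.1, real_inner_comm,
        ← integral_inner (hf.mono_set hsub)]
      simp only [real_inner_comm]
    refine ext_inner_right ℝ fun y => ?_
    have hψ : MemLp ((Ioc 0 t).indicator fun _ => y) 2 (volume.restrict (Ioc 0 T)) :=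
      (memLp_const y).indicator measurableSet_Ioc
    have h1 := hwk _ hψ
    rw [hset _ _ hi] at h1
    have h2 : ∀ i, ∫ s in Ioc 0 T, inner ℝ (an i s) ((Ioc 0 t).indicator (fun _ => y) s)
        = inner ℝ (Zn i t - S.ι v₀) y := by
      intro i
      rw [hset _ _ ((h.interp i).a_memLp.integrable one_le_two), (h.interp i).Z_prim.eq t ht,
        (h.interp i).Z_zero, add_sub_cancel_left]
    simp only [h2] at h1
    have h3 : Tendsto (fun i => inner ℝ (Zn i t - S.ι v₀) y) 𝒰
        (𝓝 (inner ℝ (S.ι (v t) - S.ι v₀) y)) :=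
      (((h.Z_lim t ht).sub_const _).inner tendsto_const_nhds).mono_left h𝒰
    have h4 := tendsto_nhds_unique h3 h1
    rw [h.v_zero, inner_add_left, ← h4, inner_sub_left]
    ring

theorem integral_norm_le (h : S.IsLimit T K ε u₀ v₀ τ un vn Zn an v) (hT : 0 < T) (i : ℕ) :
    ∫ t in Ioc 0 T, ‖an i t‖ ≤ T + ε := by
  have h1 := intervalIntegrable_norm_sq hT.le (h.interp i).a_memLp
  have h2 := (h.interp i).a_le
  rw [intervalIntegrable_iff_integrableOn_Ioc_of_le hT.le] at h1
  rw [intervalIntegral.integral_of_le hT.le] at h2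
  calc ∫ t in Ioc 0 T, ‖an i t‖ ≤ ∫ t in Ioc 0 T, (1 + ‖an i t‖ ^ 2) := by
        refine integral_mono ((h.interp i).a_memLp.integrable one_le_two).norm
          ((integrable_const _).add h1) fun t => ?_
        simp only
        linarith [sq_nonneg (‖an i t‖ - 1), sq_nonneg (‖an i t‖)]
    _ = T + ∫ t in Ioc 0 T, ‖an i t‖ ^ 2 := by
        rw [integral_add (integrable_const _) h1]; simp [hT.le]
    _ ≤ T + ε := by linarith

/-- The left-hand side of the equation minus its right-hand side, tested with `w`. -/
def _root_.Westervelt.DampedWave.defect (S : DampedWave V H G) (u v : V) (a : H) (w : V) : ℝ :=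
  inner ℝ (a - S.B u a) (S.ι w) + S.c2 * inner ℝ (S.D u) (S.D w) + S.A v w
      - inner ℝ (S.B v (S.ι v)) (S.ι w)

/-- The part of the defect that does not involve the acceleration. -/
def _root_.Westervelt.DampedWave.defect' (S : DampedWave V H G) (u v w : V) : ℝ :=
  S.c2 * inner ℝ (S.D u) (S.D w) + S.A v w - inner ℝ (S.B v (S.ι v)) (S.ι w)

theorem _root_.Westervelt.DampedWave.defect_eq (S : DampedWave V H G) (u v : V) (a : H) (w : V) :
    S.defect u v a w = inner ℝ a (S.ι w - S.B u (S.ι w)) + S.defect' u v w := by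
  unfold defect defect'
  rw [inner_sub_left, inner_sub_right, S.B_symm]
  ring

theorem _root_.Westervelt.DampedWave.continuous_defect' (S : DampedWave V H G) (w : V) :
    Continuous fun x : V × V => S.defect' x.1 x.2 w := by
  unfold defect'
  have := S.continuous_A_apply w
  fun_prop

theorem _root_.Westervelt.DampedWave.exists_defect'_le (S : DampedWave V H G) (w : V) (R : ℝ) :
    ∃ C, ∀ u v, ‖u‖ ≤ R → ‖v‖ ≤ R → ‖S.defect' u v w‖ ≤ C := by
  obtain ⟨C, hC⟩ := S.A_bdd R
  have hc := S.c2_pos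
  refine ⟨S.c2 * (‖S.D‖ * R * ‖S.D w‖) + C * ‖w‖ + ‖S.B‖ * R * (‖S.ι‖ * R) * ‖S.ι w‖,
    fun u v hu hv => ?_⟩
  have hR : 0 ≤ R := (norm_nonneg _).trans hu
  unfold defect'
  have h1 : ‖S.c2 * inner ℝ (S.D u) (S.D w)‖ ≤ S.c2 * (‖S.D‖ * R * ‖S.D w‖) := by
    rw [norm_mul, Real.norm_of_nonneg hc.le]
    gcongr
    refine (norm_inner_le_norm _ _).trans ?_
    gcongr
    exact (S.D.le_opNorm u).trans (by gcongr)
  have h2 : ‖S.A v w‖ ≤ C * ‖w‖ := (S.A v).le_of_opNorm_le (hC v hv) w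
  have h3 : ‖inner ℝ (S.B v (S.ι v)) (S.ι w)‖ ≤ ‖S.B‖ * R * (‖S.ι‖ * R) * ‖S.ι w‖ := by
    refine (norm_inner_le_norm _ _).trans ?_
    gcongr
    refine (S.norm_B_le hv _).trans ?_
    gcongr
    exact (S.ι.le_opNorm v).trans (by gcongr)
  exact (norm_sub_le _ _).trans (add_le_add ((norm_add_le _ _).trans (add_le_add h1 h2)) h3)

set_option maxHeartbeats 1000000 in
theorem integral_defect_eq_zero (h : S.IsLimit T K ε u₀ v₀ τ un vn Zn an v) (hT : 0 < T)
    {u : ℝ → V} (hu : IsPrim T u v) (hu0 : u 0 = u₀) {𝒰 : Ultrafilter ℕ}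
    (h𝒰 : (𝒰 : Filter ℕ) ≤ atTop) {a : ℝ → H}
    (ha : MemLp a 2 (volume.restrict (Ioc 0 T)))
    (hwk : ∀ ψ : ℝ → H, MemLp ψ 2 (volume.restrict (Ioc 0 T)) →
        Tendsto (fun i => ∫ t in Ioc 0 T, inner ℝ (an i t) (ψ t)) 𝒰
          (𝓝 (∫ t in Ioc 0 T, inner ℝ (a t) (ψ t)))) (w : V) :
    Integrable (fun t => S.defect (u t) (v t) (a t) w) (volume.restrict (Ioc 0 T)) ∧
    ∀ s, MeasurableSet s →
      ∫ t in s, S.defect (u t) (v t) (a t) w ∂(volume.restrict (Ioc 0 T)) = 0 := by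
  set μ := volume.restrict (Ioc (0 : ℝ) T) with hμ
  obtain ⟨R₁, hR₁, hvR⟩ := h.exists_bound
  obtain ⟨θ, hθ, hθu⟩ := h.exists_uniform hT hu hu0
  obtain ⟨C₀, hC₀⟩ : ∃ C, ∀ t ∈ Icc 0 T, ‖u t‖ ≤ C :=
    isCompact_Icc.exists_bound_of_continuousOn (hu.continuousOn hT.le)
  set R := max R₁ (max C₀ K)
  have huR : ∀ t ∈ Icc 0 T, ‖u t‖ ≤ R := fun t ht =>
    (hC₀ t ht).trans ((le_max_left _ _).trans (le_max_right _ _))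
  have hvR' : ∀ t ∈ Icc 0 T, ‖v t‖ ≤ R := fun t ht => (hvR t ht).trans (le_max_left _ _)
  have hunR : ∀ i, ∀ t ∈ Icc 0 T, ‖un i t‖ ≤ R := fun i t ht =>
    ((h.interp i).u_bdd t ht).trans ((le_max_right _ _).trans (le_max_right _ _))
  have hvnR : ∀ i, ∀ t ∈ Icc 0 T, ‖vn i t‖ ≤ R := fun i t ht =>
    ((h.interp i).v_le t ht).trans (hR₁.trans (le_max_left _ _))
  obtain ⟨C, hC⟩ := S.exists_defect'_le w R
  have aeI : ∀ {P : ℝ → Prop}, (∀ t ∈ Icc 0 T, P t) → ∀ᵐ t ∂μ, P t := fun hP =>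
    (ae_restrict_iff' measurableSet_Ioc).2
      (Eventually.of_forall fun t ht => hP t (Ioc_subset_Icc_self ht))
  have umeas : ∀ {U x : ℝ → V}, IsPrim T U x → AEStronglyMeasurable U μ := fun hU =>
    ((hU.continuousOn hT.le).mono Ioc_subset_Icc_self).aestronglyMeasurable measurableSet_Ioc
  have dmeas : ∀ {U W : ℝ → V}, AEStronglyMeasurable U μ → AEStronglyMeasurable W μ →
      AEStronglyMeasurable (fun t => S.defect' (U t) (W t) w) μ := fun hU hW =>
    (S.continuous_defect' w).comp_aestronglyMeasurable (hU.prodMk hW)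
  have dint : Integrable (fun t => S.defect' (u t) (v t) w) μ :=
    Integrable.of_bound (dmeas (umeas hu) h.v_meas) C
      (aeI fun t ht => hC _ _ (huR t ht) (hvR' t ht))
  have dnint : ∀ i, Integrable (fun t => S.defect' (un i t) (vn i t) w) μ := fun i =>
    Integrable.of_bound (dmeas (umeas (h.interp i).u_prim) (h.interp i).v_meas) C
      (aeI fun t ht => hC _ _ (hunR i t ht) (hvnR i t ht))
  set ψ : ℝ → H := fun t => S.ι w - S.B (u t) (S.ι w) with hψ
  have ψmem : ∀ {U x : ℝ → V}, IsPrim T U x → (∀ t ∈ Icc 0 T, ‖U t‖ ≤ R) →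
      MemLp (fun t => S.ι w - S.B (U t) (S.ι w)) 2 μ := by
    intro U x hU hUR
    refine MemLp.of_bound ?_ (‖S.ι w‖ + ‖S.B‖ * R * ‖S.ι w‖) (aeI fun t ht => ?_)
    · have hc : Continuous fun y : V => S.ι w - S.B y (S.ι w) := by fun_prop
      exact hc.comp_aestronglyMeasurable (umeas hU)
    · exact (norm_sub_le _ _).trans (add_le_add le_rfl (S.norm_B_le (hUR t ht) _))
  have iint : ∀ {x y : ℝ → H}, MemLp x 2 μ → MemLp y 2 μ →
      Integrable (fun t => inner ℝ (x t) (y t)) μ := by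
    intro x y hx hy
    refine (L2.integrable_inner (𝕜 := ℝ) (hx.toLp x) (hy.toLp y)).congr ?_
    filter_upwards [hx.coeFn_toLp, hy.coeFn_toLp] with t h1 h2
    rw [h1, h2]
  have hψm : MemLp ψ 2 μ := ψmem hu huR
  have dfint : Integrable (fun t => S.defect (u t) (v t) (a t) w) μ := by
    simp only [defect_eq]
    exact (iint ha hψm).add dint
  refine ⟨dfint, fun s hs => ?_⟩
  have hdf : ∀ i, Integrable (fun t => S.defect (un i t) (vn i t) (an i t) w) μ := by
    intro i
    simp only [defect_eq]
    exact (iint (h.interp i).a_memLp (ψmem (h.interp i).u_prim (hunR i))).add (dnint i)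
  -- the approximate defects vanish in the limit
  have hz : Tendsto (fun i => ∫ t in s, S.defect (un i t) (vn i t) (an i t) w ∂μ) atTop (𝓝 0) := by
    have hae : ∀ i, ∀ᵐ t ∂μ, ‖S.defect (un i t) (vn i t) (an i t) w‖
        ≤ τ i * K * ((1 + ‖an i t‖) * ‖S.ι w‖ + ‖S.D w‖) := by
      intro i
      have h0 : ∀ᵐ t : ℝ, t ≠ T := by simp [ae_iff]
      refine (ae_restrict_iff' measurableSet_Ioc).2 ?_
      filter_upwards [(h.interp i).eqn, h0] with t ht h0 htm
      exact ht ⟨htm.1, lt_of_le_of_ne htm.2 h0⟩ w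
    have hbint : ∀ i, Integrable (fun t => τ i * K * ((1 + ‖an i t‖) * ‖S.ι w‖ + ‖S.D w‖)) μ :=
      fun i => ((((integrable_const _).add
        ((h.interp i).a_memLp.integrable one_le_two).norm).mul_const _).add
          (integrable_const _)).const_mul _
    have hK : 0 ≤ K := (norm_nonneg _).trans ((h.interp 0).u_bdd 0 ⟨le_rfl, hT.le⟩)
    have hb : ∀ i, ‖∫ t in s, S.defect (un i t) (vn i t) (an i t) w ∂μ‖
        ≤ τ i * (K * ((T + (T + ε)) * ‖S.ι w‖ + T * ‖S.D w‖)) := by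
      intro i
      have hτ := h.τ_nonneg i
      calc _ ≤ ∫ t in s, ‖S.defect (un i t) (vn i t) (an i t) w‖ ∂μ :=
            norm_integral_le_integral_norm _
        _ ≤ ∫ t, ‖S.defect (un i t) (vn i t) (an i t) w‖ ∂μ :=
            setIntegral_le_integral (hdf i).norm (Eventually.of_forall fun _ => norm_nonneg _)
        _ ≤ ∫ t, τ i * K * ((1 + ‖an i t‖) * ‖S.ι w‖ + ‖S.D w‖) ∂μ :=
            integral_mono_ae (hdf i).norm (hbint i) (hae i)
        _ = τ i * (K * ((T + ∫ t, ‖an i t‖ ∂μ) * ‖S.ι w‖ + T * ‖S.D w‖)) := by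
            have i1 : Integrable (fun t => 1 + ‖an i t‖) μ :=
              (integrable_const _).add ((h.interp i).a_memLp.integrable one_le_two).norm
            rw [integral_const_mul, integral_add (i1.mul_const _) (integrable_const _),
              integral_mul_const, integral_add (integrable_const _)
              ((h.interp i).a_memLp.integrable one_le_two).norm]
            simp [hμ, hT.le]
            ring
        _ ≤ _ := by
            have := h.integral_norm_le hT i
            gcongr
    rw [tendsto_zero_iff_norm_tendsto_zero]
    refine squeeze_zero (fun _ => norm_nonneg _) hb ?_
    have := h.τ_lim.mul_const (K * ((T + (T + ε)) * ‖S.ι w‖ + T * ‖S.D w‖))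
    rwa [zero_mul] at this
  -- and converge to the defect of the limit
  have hl : Tendsto (fun i => ∫ t in s, S.defect (un i t) (vn i t) (an i t) w ∂μ) 𝒰
      (𝓝 (∫ t in s, S.defect (u t) (v t) (a t) w ∂μ)) := by
    have l1 : Tendsto (fun i => ∫ t in s, S.defect' (un i t) (vn i t) w ∂μ) atTop
        (𝓝 (∫ t in s, S.defect' (u t) (v t) w ∂μ)) := by
      refine tendsto_integral_of_dominated_convergence (fun _ => C)
        (fun i => (dnint i).aestronglyMeasurable.restrict) (integrable_const _)
        (fun i => ae_restrict_of_ae (aeI fun t ht => hC _ _ (hunR i t ht) (hvnR i t ht))) ?_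
      refine ae_restrict_of_ae ((ae_restrict_iff' measurableSet_Ioc).2 ?_)
      filter_upwards [h.ae_lim] with t ht htm
      have hu1 : Tendsto (fun i => un i t) atTop (𝓝 (u t)) :=
        tendsto_iff_norm_sub_tendsto_zero.2
          (squeeze_zero (fun _ => norm_nonneg _) (fun i => hθu i t (Ioc_subset_Icc_self htm)) hθ)
      exact ((S.continuous_defect' w).tendsto (u t, v t)).comp (hu1.prodMk_nhds (ht htm))
    have hind : ∀ x y : ℝ → H, ∫ t in s, inner ℝ (x t) (y t) ∂μ
        = ∫ t, inner ℝ (x t) (s.indicator y t) ∂μ := by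
      intro x y
      rw [← integral_indicator hs]
      congr 1
      ext t
      by_cases ht : t ∈ s <;> simp [ht]
    have l2 : Tendsto (fun i => ∫ t in s, inner ℝ (an i t) (ψ t) ∂μ) 𝒰
        (𝓝 (∫ t in s, inner ℝ (a t) (ψ t) ∂μ)) := by
      simp only [hind]
      exact hwk _ (hψm.indicator hs)
    have l3 : Tendsto (fun i => ∫ t in s, inner ℝ (an i t) (S.B (u t - un i t) (S.ι w)) ∂μ) atTop
        (𝓝 0) := by
      rw [tendsto_zero_iff_norm_tendsto_zero]
      have hb : ∀ i, ‖∫ t in s, inner ℝ (an i t) (S.B (u t - un i t) (S.ι w)) ∂μ‖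
          ≤ (T + ε) * (‖S.B‖ * θ i * ‖S.ι w‖) := by
        intro i
        have hai := ((h.interp i).a_memLp.integrable one_le_two).norm
        have hθ0 : 0 ≤ θ i := (norm_nonneg _).trans (hθu i 0 ⟨le_rfl, hT.le⟩)
        calc _ ≤ ∫ t in s, ‖an i t‖ * (‖S.B‖ * θ i * ‖S.ι w‖) ∂μ := by
              refine norm_integral_le_of_norm_le (hai.mul_const _).restrict ?_
              refine ae_restrict_of_ae (aeI fun t ht => ?_)
              refine (norm_inner_le_norm _ _).trans ?_
              gcongr
              exact S.norm_B_le (by rw [norm_sub_rev]; exact hθu i t ht) _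
          _ ≤ ∫ t, ‖an i t‖ * (‖S.B‖ * θ i * ‖S.ι w‖) ∂μ :=
              setIntegral_le_integral (hai.mul_const _)
                (Eventually.of_forall fun _ => by positivity)
          _ = (∫ t, ‖an i t‖ ∂μ) * (‖S.B‖ * θ i * ‖S.ι w‖) := integral_mul_const _ _
          _ ≤ _ := by
              have := h.integral_norm_le hT i
              gcongr
      refine squeeze_zero (fun _ => norm_nonneg _) hb ?_
      have := ((hθ.const_mul ‖S.B‖).mul_const ‖S.ι w‖).const_mul (T + ε)
      simpa using this
    have e : ∀ i, ∫ t in s, S.defect (un i t) (vn i t) (an i t) w ∂μ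
        = ∫ t in s, inner ℝ (an i t) (ψ t) ∂μ
          + ∫ t in s, inner ℝ (an i t) (S.B (u t - un i t) (S.ι w)) ∂μ
          + ∫ t in s, S.defect' (un i t) (vn i t) w ∂μ := by
      intro i
      have j1 := iint (h.interp i).a_memLp hψm
      have j2 : Integrable (fun t => inner ℝ (an i t) (S.B (u t - un i t) (S.ι w))) μ := by
        have j3 := iint (h.interp i).a_memLp (ψmem (h.interp i).u_prim (hunR i))
        refine (j3.sub j1).congr (Eventually.of_forall fun t => ?_)
        simp only [hψ, Pi.sub_apply]
        rw [← inner_sub_right, map_sub, sub_apply]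
        congr 1
        abel
      have j4 : Integrable (fun t => inner ℝ (an i t) (ψ t)
          + inner ℝ (an i t) (S.B (u t - un i t) (S.ι w))) μ := j1.add j2
      rw [← integral_add j1.restrict j2.restrict, ← integral_add j4.restrict (dnint i).restrict]
      congr 1
      ext t
      rw [defect_eq, ← inner_add_right]
      congr 2
      simp only [hψ]
      rw [map_sub S.B, sub_apply]
      abel
    have e' : ∫ t in s, S.defect (u t) (v t) (a t) w ∂μ
        = ∫ t in s, inner ℝ (a t) (ψ t) ∂μ + 0 + ∫ t in s, S.defect' (u t) (v t) w ∂μ := by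
      rw [add_zero, ← integral_add (iint ha hψm).restrict dint.restrict]
      simp only [defect_eq, hψ]
    simp only [e]
    rw [e']
    exact (l2.add (l3.mono_left h𝒰)).add (l1.mono_left h𝒰)
  exact tendsto_nhds_unique hl (hz.mono_left h𝒰)

theorem ae_defect_eq_zero [SecondCountableTopology V]
    (h : S.IsLimit T K ε u₀ v₀ τ un vn Zn an v) (hT : 0 < T)
    {u : ℝ → V} (hu : IsPrim T u v) (hu0 : u 0 = u₀) {𝒰 : Ultrafilter ℕ}
    (h𝒰 : (𝒰 : Filter ℕ) ≤ atTop) {a : ℝ → H}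
    (ha : MemLp a 2 (volume.restrict (Ioc 0 T)))
    (hwk : ∀ ψ : ℝ → H, MemLp ψ 2 (volume.restrict (Ioc 0 T)) →
        Tendsto (fun i => ∫ t in Ioc 0 T, inner ℝ (an i t) (ψ t)) 𝒰
          (𝓝 (∫ t in Ioc 0 T, inner ℝ (a t) (ψ t)))) :
    ∀ᵐ t, t ∈ Ioc 0 T → ∀ w, S.defect (u t) (v t) (a t) w = 0 := by
  have h1 : ∀ n, ∀ᵐ t ∂(volume.restrict (Ioc 0 T)),
      S.defect (u t) (v t) (a t) (TopologicalSpace.denseSeq V n) = 0 := by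
    intro n
    obtain ⟨hi, hz⟩ := h.integral_defect_eq_zero hT hu hu0 h𝒰 ha hwk
      (TopologicalSpace.denseSeq V n)
    exact hi.ae_eq_zero_of_forall_setIntegral_eq_zero fun s hs _ => hz s hs
  rw [← ae_all_iff] at h1
  rw [ae_restrict_iff' measurableSet_Ioc] at h1
  filter_upwards [h1] with t ht htm w
  have hc : Continuous fun w => S.defect (u t) (v t) (a t) w := by
    unfold defect
    fun_prop
  exact congrFun ((TopologicalSpace.denseRange_denseSeq V).equalizer hc continuous_const
    (funext fun n => ht htm n)) w

end IsLimit

end DampedWave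

end Westervelt

end

noncomputable section

namespace Westervelt

open Filter Topology

variable {V H G : Type*} [NormedAddCommGroup V] [NormedSpace ℝ V] [CompleteSpace V]
    [NormedAddCommGroup H] [InnerProductSpace ℝ H] [CompleteSpace H]
    [NormedAddCommGroup G] [InnerProductSpace ℝ G]

theorem IsPrim.norm_sub_le {E : Type*} [NormedAddCommGroup E] [NormedSpace ℝ E] [CompleteSpace E]
    {T R : ℝ} {X x : ℝ → E} (h : IsPrim T X x) (hR : ∀ t ∈ Icc 0 T, ‖x t‖ ≤ R)
    {s t : ℝ} (hs : s ∈ Icc 0 T) (ht : t ∈ Icc 0 T) : ‖X t - X s‖ ≤ R * |t - s| := by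
  rw [h.sub_eq hs ht]
  refine intervalIntegral.norm_integral_le_of_norm_le_const fun r hr => hR r ?_
  have := uIoc_subset_uIcc hr
  exact uIcc_subset_Icc hs ht this

theorem sq_integral_norm_le {E : Type*} [NormedAddCommGroup E] {a : ℝ → E} {s t : ℝ} (hst : s < t)
    (h1 : IntervalIntegrable (fun r => ‖a r‖) volume s t)
    (h2 : IntervalIntegrable (fun r => ‖a r‖ ^ 2) volume s t) :
    (∫ r in s..t, ‖a r‖) ^ 2 ≤ (t - s) * ∫ r in s..t, ‖a r‖ ^ 2 := by
  set J := ∫ r in s..t, ‖a r‖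
  have hd : 0 < t - s := sub_pos.2 hst
  set l := J / (t - s)
  have h3 : 0 ≤ ∫ r in s..t, (‖a r‖ ^ 2 - 2 * l * ‖a r‖ + l ^ 2) :=
    intervalIntegral.integral_nonneg hst.le fun r _ => by nlinarith [sq_nonneg (‖a r‖ - l)]
  rw [intervalIntegral.integral_add (h2.sub (h1.const_mul _)) intervalIntegrable_const,
    intervalIntegral.integral_sub h2 (h1.const_mul _), intervalIntegral.integral_const_mul,
    intervalIntegral.integral_const, smul_eq_mul] at h3
  have e : l * (t - s) = J := div_mul_cancel₀ _ hd.ne'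
  change 0 ≤ (∫ r in s..t, ‖a r‖ ^ 2) - 2 * l * J + (t - s) * l ^ 2 at h3
  have h4 := mul_nonneg hd.le h3
  nlinarith [h4, e]

namespace DampedWave

theorem continuous_Φ (S : DampedWave V H G) : Continuous S.Φ := by
  rw [continuous_iff_continuousAt]
  intro x
  obtain ⟨C, hC⟩ := S.A_bdd (‖x‖ + 1)
  have hb : ∀ᶠ y in 𝓝 x, ‖S.Φ y - S.Φ x‖ ≤ C * ‖y - x‖ := by
    have h2 : ∀ᶠ y in 𝓝 x, ‖y‖ < ‖x‖ + 1 :=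
      (continuous_norm.tendsto x).eventually_lt_const (show ‖x‖ < ‖x‖ + 1 by linarith)
    filter_upwards [h2] with y hy
    have h3 := S.Φ_sub x y
    have h4 := S.Φ_sub y x
    have h5 := (S.A x).le_of_opNorm_le (hC x (by linarith)) (y - x)
    have h6 := (S.A y).le_of_opNorm_le (hC y hy.le) (x - y)
    rw [norm_sub_rev x y] at h6
    rw [Real.norm_eq_abs, abs_le] at h5 h6 ⊢
    constructor <;> linarith
  rw [ContinuousAt, tendsto_iff_norm_sub_tendsto_zero]
  refine squeeze_zero' (Eventually.of_forall fun _ => norm_nonneg _) hb ?_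
  have hc : Continuous fun y : V => C * ‖y - x‖ := by fun_prop
  simpa using hc.tendsto x

theorem continuous_energy (S : DampedWave V H G) : Continuous fun x : V × V => S.energy x.1 x.2 := by
  unfold energy
  have := S.continuous_Φ
  fun_prop

theorem isUnifConvex_energy (S : DampedWave V H G) (u : V) :
    IsUnifConvex (S.energy u) (fun x => S.A x + S.c2 • (innerSL ℝ (S.D u)).comp S.D) S.γ' S.p := by
  intro x y
  have h := S.isUnifConvex x y
  simp only [energy, add_apply, smul_apply, smul_eq_mul, ContinuousLinearMap.comp_apply,
    innerSL_apply_apply, map_sub] at h ⊢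
  linarith

namespace IsLimit

variable {S : DampedWave V H G} {T K ε : ℝ} {u₀ v₀ : V} {τ : ℕ → ℝ} {un vn : ℕ → ℝ → V}
  {Zn an : ℕ → ℝ → H} {v : ℝ → V}

theorem energy_le (h : S.IsLimit T K ε u₀ v₀ τ un vn Zn an v) (hT : 0 < T) {u : ℝ → V}
    (hu : IsPrim T u v) (hu0 : u 0 = u₀) {s t : ℝ} (hs : s ∈ Icc 0 T) (ht : t ∈ Icc 0 T)
    (hst : s ≤ t) (hlim : Tendsto (fun i => vn i s) atTop (𝓝 (v s))) :
    S.energy (u t) (v t) ≤ S.energy (u s) (v s) + K * (t - s) := by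
  obtain ⟨θ, hθ, hθu⟩ := h.exists_uniform hT hu hu0
  have hc := S.c2_pos
  have hul : ∀ r ∈ Icc 0 T, Tendsto (fun i => un i r) atTop (𝓝 (u r)) := fun r hr =>
    tendsto_iff_norm_sub_tendsto_zero.2
      (squeeze_zero (fun _ => norm_nonneg _) (fun i => hθu i r hr) hθ)
  refine le_of_forall_pos_lt_add fun e he => ?_
  obtain ⟨η, hη, hlsc⟩ := (S.isUnifConvex_energy (u t)).exists_lsc S.γ'_pos S.one_lt_p S.ι_inj
    (v t) (half_pos he)
  have h1 : ∀ᶠ i in atTop, ‖S.ι (vn i t) - S.ι (v t)‖ < η :=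
    (tendsto_iff_norm_sub_tendsto_zero.1 (h.ι_lim t ht)).eventually_lt_const hη
  have h2 : Tendsto (fun i => S.energy (un i s) (vn i s) + K * (t - s + τ i)
      + S.c2 * ‖S.D‖ ^ 2 * θ i) atTop (𝓝 (S.energy (u s) (v s) + K * (t - s + 0)
      + S.c2 * ‖S.D‖ ^ 2 * 0)) :=
    (((S.continuous_energy.tendsto (u s, v s)).comp ((hul s hs).prodMk_nhds hlim)).add
      ((h.τ_lim.const_add _).const_mul _)).add (hθ.const_mul _)
  rw [mul_zero, add_zero, add_zero] at h2
  have h3 := h2.eventually_lt_const (show _ < S.energy (u s) (v s) + K * (t - s) + e / 2 by linarith)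
  obtain ⟨i, hi1, hi2⟩ := (h1.and h3).exists
  have h4 := hlsc _ hi1
  have h5 := (h.interp i).energy_le s hs t ht hst
  have h6 := S.abs_energy_sub_le (un i t) (u t) (vn i t)
  have h7 : S.c2 * ‖S.D‖ ^ 2 * ‖un i t - u t‖ * ‖vn i t‖ ≤ S.c2 * ‖S.D‖ ^ 2 * θ i * 1 := by
    have h8 := hθu i t ht
    have h0 : 0 ≤ θ i := (norm_nonneg _).trans h8
    gcongr
    exact (h.interp i).v_le t ht
  have h9 := neg_abs_le (S.energy (un i t) (vn i t) - S.energy (u t) (vn i t))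
  linarith

/-- At a time where the equation holds, the energy is controlled by that of a later velocity. -/
theorem _root_.Westervelt.DampedWave.energy_le_of_defect_eq_zero (S : DampedWave V H G) {R : ℝ}
    {u v : V} {a : H} (hu : ‖u‖ ≤ R) (hv : ‖v‖ ≤ R) (hd : ∀ w, S.defect u v a w = 0) (y : V) :
    S.energy u v ≤ S.energy u y
      + (1 + ‖S.B‖ * R + ‖S.B‖ * R * (‖S.ι‖ * R)) * (1 + ‖a‖) * ‖S.ι y - S.ι v‖ := by
  have hR : 0 ≤ R := (norm_nonneg _).trans hu
  have h1 := S.Φ_sub v y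
  have h2 := hd (y - v)
  unfold defect at h2
  have h3 : |inner ℝ (a - S.B u a - S.B v (S.ι v)) (S.ι (y - v))|
      ≤ (1 + ‖S.B‖ * R + ‖S.B‖ * R * (‖S.ι‖ * R)) * (1 + ‖a‖) * ‖S.ι y - S.ι v‖ := by
    refine (abs_real_inner_le_norm _ _).trans ?_
    rw [map_sub]
    gcongr
    have e1 := S.norm_B_le hu a
    have e2 : ‖S.B v (S.ι v)‖ ≤ ‖S.B‖ * R * (‖S.ι‖ * R) := (S.norm_B_le hv _).trans (by
      gcongr
      exact (S.ι.le_opNorm v).trans (by gcongr))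
    have e3 : 0 ≤ ‖S.B‖ * R := by positivity
    have e4 : 0 ≤ ‖S.B‖ * R * (‖S.ι‖ * R) * ‖a‖ := by positivity
    calc _ ≤ ‖a‖ + ‖S.B u a‖ + ‖S.B v (S.ι v)‖ :=
          (norm_sub_le _ _).trans (add_le_add (norm_sub_le _ _) le_rfl)
      _ ≤ ‖a‖ + ‖S.B‖ * R * ‖a‖ + ‖S.B‖ * R * (‖S.ι‖ * R) := by gcongr
      _ ≤ _ := by nlinarith
  have h4 := neg_abs_le (inner ℝ (a - S.B u a - S.B v (S.ι v)) (S.ι (y - v)))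
  rw [inner_sub_left] at h4 h3
  unfold energy
  simp only [map_sub, inner_sub_right] at h1 h2 h3 h4 ⊢
  linarith [le_abs_self (inner ℝ (a - S.B u a) (S.ι y) - inner ℝ (a - S.B u a) (S.ι v)
    - (inner ℝ (S.B v (S.ι v)) (S.ι y) - inner ℝ (S.B v (S.ι v)) (S.ι v)))]

theorem exists_energy_near (h : S.IsLimit T K ε u₀ v₀ τ un vn Zn an v) (hT : 0 < T) {u : ℝ → V}
    (hu : IsPrim T u v) (hu0 : u 0 = u₀) {a : ℝ → H}
    (ha : MemLp a 2 (volume.restrict (Ioc 0 T))) (hva : IsPrim T (fun t => S.ι (v t)) a)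
    (hd : ∀ᵐ t, t ∈ Ioc 0 T → ∀ w, S.defect (u t) (v t) (a t) w = 0)
    {t₀ : ℝ} (ht₀ : t₀ ∈ Icc 0 T) {η : ℝ} (hη : 0 < η) :
    ∃ ρ > 0, ∀ s ∈ Icc 0 T, |s - t₀| < ρ →
      S.energy (u t₀) (v s) ≤ S.energy (u t₀) (v t₀) + η := by
  have hc := S.c2_pos
  have hK : 0 ≤ K := (norm_nonneg _).trans ((h.interp 0).u_bdd 0 ⟨le_rfl, hT.le⟩)
  obtain ⟨R₁, hR₁, hvR₁⟩ := h.exists_bound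
  obtain ⟨C₀, hC₀⟩ : ∃ C, ∀ t ∈ Icc 0 T, ‖u t‖ ≤ C :=
    isCompact_Icc.exists_bound_of_continuousOn (hu.continuousOn hT.le)
  set R := max R₁ C₀
  have hR : 0 ≤ R := by linarith [le_max_left R₁ C₀]
  have hvR : ∀ t ∈ Icc 0 T, ‖v t‖ ≤ R := fun t ht => (hvR₁ t ht).trans (le_max_left _ _)
  have huR : ∀ t ∈ Icc 0 T, ‖u t‖ ≤ R := fun t ht => (hC₀ t ht).trans (le_max_right _ _)
  set Q := S.c2 * ‖S.D‖ ^ 2 * R * R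
  have hQ : 0 ≤ Q := by positivity
  have hen : ∀ s ∈ Icc 0 T, ∀ t ∈ Icc 0 T, ∀ r ∈ Icc 0 T,
      S.energy (u s) (v r) ≤ S.energy (u t) (v r) + Q * |s - t| := by
    intro s hs t ht r hr
    have h1 := S.abs_energy_sub_le (u s) (u t) (v r)
    have h2 : S.c2 * ‖S.D‖ ^ 2 * ‖u s - u t‖ * ‖v r‖ ≤ S.c2 * ‖S.D‖ ^ 2 * (R * |s - t|) * R := by
      gcongr
      · exact hu.norm_sub_le hvR ht hs
      · exact hvR r hr
    have h3 := le_abs_self (S.energy (u s) (v r) - S.energy (u t) (v r))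
    have h4 : S.c2 * ‖S.D‖ ^ 2 * (R * |s - t|) * R = Q * |s - t| := by ring
    linarith
  rcases ht₀.1.eq_or_lt with h0 | h0
  · subst h0
    refine ⟨η / (K + Q + 1), by positivity, fun s hs hst => ?_⟩
    have h1 := h.energy_le hT hu hu0 ht₀ hs hs.1 (by
      simp only [(h.interp _).v_zero, h.v_zero]; exact tendsto_const_nhds)
    have h2 := hen 0 ht₀ s hs s hs
    rw [sub_zero, abs_of_nonneg hs.1] at hst
    rw [zero_sub, abs_neg, abs_of_nonneg hs.1] at h2
    rw [lt_div_iff₀ (by positivity)] at hst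
    nlinarith [hs.1]
  · set P := 1 + ‖S.B‖ * R + ‖S.B‖ * R * (‖S.ι‖ * R)
    have hP : 0 ≤ P := by positivity
    have ha2 := intervalIntegrable_norm_sq hT.le ha
    have hprim : IsPrim T (fun t => ∫ r in (0 : ℝ)..t, ‖a r‖ ^ 2) fun r => ‖a r‖ ^ 2 :=
      ⟨ha2, fun t _ => by simp⟩
    have hIc := hprim.continuousOn hT.le
    -- the right-hand side of the final estimate is small
    have hlim : Tendsto (fun ρ : ℝ => (6 * K + 3 * Q + 2 * P) * ρ + 3 * P *
        ((∫ r in (0 : ℝ)..t₀, ‖a r‖ ^ 2) - ∫ r in (0 : ℝ)..(t₀ - 2 * ρ), ‖a r‖ ^ 2)) (𝓝[>] 0)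
        (𝓝 ((6 * K + 3 * Q + 2 * P) * 0 + 3 * P *
        ((∫ r in (0 : ℝ)..t₀, ‖a r‖ ^ 2) - ∫ r in (0 : ℝ)..t₀, ‖a r‖ ^ 2))) := by
      refine ((tendsto_id.const_mul _).mono_left nhdsWithin_le_nhds).add
        (Tendsto.const_mul _ (tendsto_const_nhds.sub ?_))
      have h1 : Tendsto (fun ρ : ℝ => t₀ - 2 * ρ) (𝓝[>] 0) (𝓝[Icc 0 T] t₀) := by
        refine tendsto_nhdsWithin_iff.2 ⟨?_, ?_⟩
        · have : Continuous fun ρ : ℝ => t₀ - 2 * ρ := by fun_prop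
          have := this.tendsto 0
          rw [mul_zero, sub_zero] at this
          exact this.mono_left nhdsWithin_le_nhds
        · filter_upwards [Ioo_mem_nhdsGT (show (0 : ℝ) < t₀ / 2 by linarith)] with ρ hρ
          exact ⟨by linarith [hρ.2], by linarith [hρ.1, ht₀.2]⟩
      exact (hIc t₀ ht₀).tendsto.comp h1
    rw [mul_zero, sub_self, mul_zero, add_zero] at hlim
    obtain ⟨ρ, ⟨hρ1, hρ2⟩, hρ3⟩ := ((hlim.eventually_lt_const hη).and
      (Ioo_mem_nhdsGT (show (0 : ℝ) < t₀ / 2 by linarith))).exists.imp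
      fun ρ hρ => (⟨⟨hρ.2.1, hρ.2.2⟩, hρ.1⟩ : (0 < ρ ∧ ρ < t₀ / 2) ∧ _)
    have m2 : t₀ - 2 * ρ ∈ Icc 0 T := ⟨by linarith, by linarith [ht₀.2]⟩
    have m1 : t₀ - ρ ∈ Icc 0 T := ⟨by linarith, by linarith [ht₀.2]⟩
    have i1 := (hva.intervalIntegrable m2 ht₀).norm
    have i2 := hprim.intervalIntegrable m2 ht₀
    have hI := hprim.sub_eq m2 ht₀
    rw [hI] at hρ3
    set I := ∫ r in (t₀ - 2 * ρ)..t₀, ‖a r‖ ^ 2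
    set J := ∫ r in (t₀ - 2 * ρ)..t₀, ‖a r‖
    have hJI : J ^ 2 ≤ 2 * ρ * I := by
      have := sq_integral_norm_le (show t₀ - 2 * ρ < t₀ by linarith) i1 i2
      rwa [sub_sub_cancel] at this
    have hJ0 : 0 ≤ J := intervalIntegral.integral_nonneg (by linarith) fun _ _ => norm_nonneg _
    have hI0 : 0 ≤ I := intervalIntegral.integral_nonneg (by linarith) fun _ _ => by positivity
    have hJ1 : J ≤ 2 * ρ + I := by nlinarith [sq_nonneg (J - 2 * ρ)]
    -- a good time
    obtain ⟨σ, hσm, hσd, hσl, hσa⟩ : ∃ σ ∈ Ioc (t₀ - 2 * ρ) (t₀ - ρ),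
        (∀ w, S.defect (u σ) (v σ) (a σ) w = 0) ∧ Tendsto (fun i => vn i σ) atTop (𝓝 (v σ)) ∧
        ‖a σ‖ * ρ ≤ J := by
      set μ := volume.restrict (Ioc (t₀ - 2 * ρ) (t₀ - ρ))
      have hμ : μ ≠ 0 := by
        intro h0
        have := congrArg (fun m => m univ) h0
        simp [μ] at this
        linarith
      have i3 : Integrable (fun r => ‖a r‖) μ := by
        have := (hva.intervalIntegrable m2 m1).norm
        rwa [intervalIntegrable_iff_integrableOn_Ioc_of_le (by linarith)] at this
      have hae : ∀ᵐ σ ∂μ, σ ∈ Ioc (t₀ - 2 * ρ) (t₀ - ρ) ∧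
          (∀ w, S.defect (u σ) (v σ) (a σ) w = 0) ∧
          Tendsto (fun i => vn i σ) atTop (𝓝 (v σ)) := by
        refine (ae_restrict_iff' measurableSet_Ioc).2 ?_
        filter_upwards [hd, h.ae_lim] with σ h1 h2 h3
        have h4 : σ ∈ Ioc 0 T := ⟨by linarith [h3.1, m2.1], h3.2.trans m1.2⟩
        exact ⟨h3, h1 h4, h2 h4⟩
      obtain ⟨σ, hσ1, hσ2⟩ := exists_notMem_null_le_average hμ i3 (ae_iff.1 hae)
      simp only [mem_ofPred_eq, not_not] at hσ1
      refine ⟨σ, hσ1.1, hσ1.2.1, hσ1.2.2, ?_⟩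
      have hvol : μ.real univ = ρ := by
        simp only [μ, measureReal_restrict_apply_univ, Real.volume_real_Ioc]
        rw [max_eq_left] <;> linarith
      rw [average_eq, hvol, smul_eq_mul, inv_mul_eq_div, le_div_iff₀ hρ1] at hσ2
      refine hσ2.trans ?_
      rw [← intervalIntegral.integral_of_le (by linarith)]
      exact intervalIntegral.integral_mono_interval le_rfl (by linarith) (by linarith)
        (Eventually.of_forall fun _ => norm_nonneg _) i1
    have mσ : σ ∈ Icc 0 T := ⟨by linarith [hσm.1, m2.1], hσm.2.trans m1.2⟩
    have hιJ : ‖S.ι (v t₀) - S.ι (v σ)‖ ≤ J := by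
      rw [hva.sub_eq mσ ht₀]
      refine (intervalIntegral.norm_integral_le_integral_norm (by linarith [hσm.2])).trans ?_
      exact intervalIntegral.integral_mono_interval hσm.1.le (by linarith [hσm.2]) le_rfl
        (Eventually.of_forall fun _ => norm_nonneg _) i1
    have hprod : (1 + ‖a σ‖) * ‖S.ι (v t₀) - S.ι (v σ)‖ ≤ 2 * ρ + 3 * I := by
      have h1 : ‖a σ‖ * J ≤ 2 * I := by
        have h2 : ρ * (‖a σ‖ * J) ≤ ρ * (2 * I) := by nlinarith
        exact le_of_mul_le_mul_left h2 hρ1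
      calc _ ≤ (1 + ‖a σ‖) * J := by gcongr
        _ ≤ _ := by linarith
    have e1 := S.energy_le_of_defect_eq_zero (huR σ mσ) (hvR σ mσ) hσd (v t₀)
    have e2 := mul_le_mul_of_nonneg_left hprod hP
    have e3 := hen σ mσ t₀ ht₀ t₀ ht₀
    have e4 : |σ - t₀| ≤ 2 * ρ := by
      rw [abs_le]; constructor <;> linarith [hσm.1, hσm.2]
    have e5 := mul_le_mul_of_nonneg_left e4 hQ
    refine ⟨ρ, hρ1, fun s hs hst => ?_⟩
    have hst' := abs_lt.1 hst
    have e6 := h.energy_le hT hu hu0 mσ hs (by linarith [hσm.2]) hσl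
    have e7 := hen t₀ ht₀ s hs s hs
    rw [abs_sub_comm] at e7
    have e8 := mul_le_mul_of_nonneg_left hst.le hQ
    have e9 : K * (s - σ) ≤ K * (3 * ρ) := by
      gcongr
      linarith [hσm.1]
    have e10 : 0 ≤ K * ρ := by positivity
    linarith

theorem continuousOn (h : S.IsLimit T K ε u₀ v₀ τ un vn Zn an v) (hT : 0 < T) {u : ℝ → V}
    (hu : IsPrim T u v) (hu0 : u 0 = u₀) {a : ℝ → H}
    (ha : MemLp a 2 (volume.restrict (Ioc 0 T))) (hva : IsPrim T (fun t => S.ι (v t)) a)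
    (hd : ∀ᵐ t, t ∈ Ioc 0 T → ∀ w, S.defect (u t) (v t) (a t) w = 0) :
    ContinuousOn v (Icc 0 T) := by
  intro t₀ ht₀
  rw [Metric.continuousWithinAt_iff]
  intro e he
  obtain ⟨η, hη, hη'⟩ := (S.isUnifConvex_energy (u t₀)).exists_norm_sub_lt S.γ'_pos S.one_lt_p
    S.ι_inj (v t₀) he
  obtain ⟨ρ, hρ, hρ'⟩ := h.exists_energy_near hT hu hu0 ha hva hd ht₀ hη
  have hc := hva.continuousOn hT.le t₀ ht₀
  rw [Metric.continuousWithinAt_iff] at hc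
  obtain ⟨ρ₂, hρ₂, hρ₂'⟩ := hc η hη
  refine ⟨min ρ ρ₂, lt_min hρ hρ₂, fun s hs hst => ?_⟩
  rw [dist_eq_norm]
  refine hη' _ ?_ (hρ' s hs (hst.trans_le (min_le_left _ _)))
  have := hρ₂' hs (hst.trans_le (min_le_right _ _))
  rwa [dist_eq_norm] at this

end IsLimit

/-- `(u, v, a)` is a solution with initial data `(u₀, v₀)`, with energies bounded by `ε`. -/
structure IsSol (S : DampedWave V H G) (T ε : ℝ) (u₀ v₀ : V) (u v : ℝ → V) (a : ℝ → H) : Prop where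
  v_cont : ContinuousOn v (Icc 0 T)
  u_prim : IsPrim T u v
  u_zero : u 0 = u₀
  v_zero : v 0 = v₀
  a_memLp : MemLp a 2 (volume.restrict (Ioc 0 T))
  v_prim : IsPrim T (fun t => S.ι (v t)) a
  a_le : ∫ t in (0 : ℝ)..T, ‖a t‖ ^ 2 ≤ ε
  Φ_le : ∀ t ∈ Icc 0 T, S.Φ (v t) ≤ ε
  eqn : ∀ᵐ t, t ∈ Ioc 0 T → ∀ w, S.defect (u t) (v t) (a t) w = 0

theorem exists_isSol [SecondCountableTopology V] (S : DampedWave V H G) {T : ℝ} (hT : 0 < T) :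
    ∃ ε₀ > 0, ∃ C ≥ 0, ∀ u₀ v₀ : V, S.Φ v₀ + ‖u₀‖ ^ 2 ≤ ε₀ →
      ∃ u v a, S.IsSol T (C * (S.Φ v₀ + ‖u₀‖ ^ 2)) u₀ v₀ u v a := by
  obtain ⟨ε₀, hε₀, C, hC, K, hK, hex⟩ := S.exists_isLimit hT
  refine ⟨ε₀, hε₀, C, hC, fun u₀ v₀ he => ?_⟩
  obtain ⟨τ, un, vn, Zn, an, v, h⟩ := hex u₀ v₀ he
  have hu : IsPrim T (fun t => u₀ + ∫ s in (0 : ℝ)..t, v s) v := ⟨h.v_int hT, fun t _ => by simp⟩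
  have hu0 : (fun t => u₀ + ∫ s in (0 : ℝ)..t, v s) 0 = u₀ := by simp
  obtain ⟨a, ha, hale, hprim, hwk⟩ := h.exists_acceleration hT (hyperfilter ℕ)
    Nat.hyperfilter_le_atTop
  have hd := h.ae_defect_eq_zero hT hu hu0 Nat.hyperfilter_le_atTop ha hwk
  exact ⟨_, v, a, h.continuousOn hT hu hu0 ha hprim hd, hu, hu0, h.v_zero, ha, hprim, hale, h.Φ_le,
    hd⟩

end DampedWave

end Westervelt

end

noncomputable section

namespace Westervelt

open Filter Topology

variable {d : ℕ}

theorem eLpNorm_comp_add_smul (f : EuclideanSpace ℝ (Fin d) → EuclideanSpace ℝ (Fin d) →L[ℝ] ℝ)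
    (hf : Continuous f) (x : EuclideanSpace ℝ (Fin d)) {s : ℝ} (hs : 0 < s) {p : ℝ} (hp : 0 < p) :
    eLpNorm (fun y => f (x + s • y)) (ENNReal.ofReal p) volume
      = ENNReal.ofReal (s ^ (-(d / p))) * eLpNorm f (ENNReal.ofReal p) volume := by
  have h1 : Measure.map (fun y : EuclideanSpace ℝ (Fin d) => x + s • y) volume
      = ENNReal.ofReal ((s ^ d)⁻¹) • volume := by
    have : (fun y : EuclideanSpace ℝ (Fin d) => x + s • y) = (x + ·) ∘ (s • ·) := rfl
    rw [this, ← Measure.map_map (by fun_prop) (by fun_prop),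
      Measure.map_addHaar_smul _ hs.ne', Measure.map_smul, map_add_left_eq_self,
      finrank_euclideanSpace_fin, abs_of_pos (by positivity)]
  have h2 := eLpNorm_map_measure (p := ENNReal.ofReal p) (μ := volume)
    (f := fun y : EuclideanSpace ℝ (Fin d) => x + s • y) (g := f)
    hf.aestronglyMeasurable (by fun_prop)
  rw [h1, eLpNorm_smul_measure_of_ne_top (by simp)] at h2
  rw [show (fun y => f (x + s • y)) = f ∘ fun y => x + s • y from rfl, ← h2, smul_eq_mul]
  congr 1
  rw [one_div, ENNReal.toReal_inv, ENNReal.toReal_ofReal hp.le, ENNReal.ofReal_rpow_of_nonneg (by positivity) (by positivity),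
    ← Real.rpow_natCast, ← Real.rpow_neg hs.le, ← Real.rpow_mul hs.le]
  congr 2
  ring

theorem enorm_le_lintegral_ray {R₀ : ℝ} {φ : EuclideanSpace ℝ (Fin d) → ℝ} (hφ : ContDiff ℝ 1 φ)
    (hsupp : Function.support φ ⊆ Metric.ball 0 R₀) {x y : EuclideanSpace ℝ (Fin d)}
    (hx : x ∈ Metric.ball 0 R₀) (hy1 : 1 ≤ ‖y‖) (hy3 : ‖y‖ ≤ 3) :
    ‖φ x‖ₑ ≤ ∫⁻ s in Ioc 0 (2 * R₀), 3 * ‖fderiv ℝ φ (x + s • y)‖ₑ := by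
  rw [mem_ball_zero_iff] at hx
  have hR₀ : 0 < R₀ := (norm_nonneg _).trans_lt hx
  have hzero : φ (x + (2 * R₀) • y) = 0 := by
    by_contra hne
    have h1 := hsupp hne
    rw [mem_ball_zero_iff] at h1
    have h2 : ‖(2 * R₀) • y‖ ≤ ‖x + (2 * R₀) • y‖ + ‖x‖ := by
      have := norm_sub_le (x + (2 * R₀) • y) x
      rwa [add_sub_cancel_left] at this
    rw [norm_smul, Real.norm_of_nonneg (by positivity)] at h2
    nlinarith
  have hder : ∀ s ∈ uIcc 0 (2 * R₀),
      HasDerivAt (fun s : ℝ => φ (x + s • y)) (fderiv ℝ φ (x + s • y) y) s := by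
    intro s _
    have h1 : HasDerivAt (fun s : ℝ => x + s • y) y s := by
      simpa using ((hasDerivAt_id s).smul_const y).const_add x
    exact ((hφ.differentiable one_ne_zero) _).hasFDerivAt.comp_hasDerivAt s h1
  have hc : Continuous fun s : ℝ => fderiv ℝ φ (x + s • y) y :=
    ((hφ.continuous_fderiv one_ne_zero).comp (by fun_prop)).clm_apply continuous_const
  have h3 := intervalIntegral.integral_eq_sub_of_hasDerivAt hder (hc.intervalIntegrable _ _)
  rw [hzero, zero_smul, add_zero, zero_sub, intervalIntegral.integral_of_le (by positivity)] at h3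
  rw [← enorm_neg, ← h3]
  refine (enorm_integral_le_lintegral_enorm _).trans (lintegral_mono fun s => ?_)
  refine ((fderiv ℝ φ (x + s • y)).le_opENorm y).trans ?_
  rw [mul_comm]
  gcongr
  rw [← ofReal_norm]
  exact (ENNReal.ofReal_le_ofReal hy3).trans_eq (ENNReal.ofReal_ofNat 3)

/-- Morrey's inequality: functions supported in a fixed ball are bounded by the `L_p` norm of their
gradient when `p` exceeds the dimension. -/
theorem exists_enorm_le_eLpNorm_fderiv (hd : 1 ≤ d) {p : ℝ} (hp : (d : ℝ) < p) (R₀ : ℝ) :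
    ∃ C : ℝ≥0, ∀ φ : EuclideanSpace ℝ (Fin d) → ℝ, ContDiff ℝ 1 φ →
      Function.support φ ⊆ Metric.ball 0 R₀ →
      ∀ x, ‖φ x‖ₑ ≤ C * eLpNorm (fderiv ℝ φ) (ENNReal.ofReal p) volume := by
  have hd' : (1 : ℝ) ≤ d := by exact_mod_cast hd
  have hp0 : 0 < p := by linarith
  set y₀ : EuclideanSpace ℝ (Fin d) := EuclideanSpace.single ⟨0, hd⟩ (2 : ℝ)
  have hy₀ : ‖y₀‖ = 2 := by simp [y₀]
  set A := Metric.closedBall y₀ 1 with hA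
  have hAn : ∀ y ∈ A, 1 ≤ ‖y‖ ∧ ‖y‖ ≤ 3 := by
    intro y hy
    rw [hA, mem_closedBall_iff_norm] at hy
    constructor
    · have := norm_sub_le y (y - y₀)
      rw [sub_sub_cancel] at this
      linarith
    · have := norm_add_le (y - y₀) y₀
      rw [sub_add_cancel] at this
      linarith
  have hApos : volume A ≠ 0 := (Metric.measure_closedBall_pos _ _ one_pos).ne'
  have hAfin : volume A ≠ ⊤ := measure_closedBall_lt_top.ne
  set I : ℝ≥0∞ := ∫⁻ s in Ioc 0 (2 * R₀), ENNReal.ofReal (s ^ (-(d / p)))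
  set m : ℝ≥0∞ := volume A ^ (1 / (1 : ℝ≥0∞).toReal - 1 / (ENNReal.ofReal p).toReal)
  have hIfin : I ≠ ⊤ := by
    have h1 : IntervalIntegrable (fun s : ℝ => s ^ (-(d / p))) volume 0 (max 0 (2 * R₀)) :=
      intervalIntegral.intervalIntegrable_rpow' (by
        rw [neg_lt_neg_iff, div_lt_one hp0]; exact hp)
    rw [intervalIntegrable_iff_integrableOn_Ioc_of_le (le_max_left _ _)] at h1
    have h2 := h1.mono_set (Ioc_subset_Ioc_right (le_max_right 0 (2 * R₀)))
    refine ((lintegral_mono fun s => ?_).trans_lt h2.2).ne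
    exact Real.ofReal_le_enorm _
  have hmfin : m ≠ ⊤ := ENNReal.rpow_ne_top_of_ne_zero hApos hAfin
  refine ⟨((volume A)⁻¹ * (3 * m * I)).toNNReal, fun φ hφ hsupp x => ?_⟩
  rw [ENNReal.coe_toNNReal (by finiteness)]
  by_cases hx : x ∈ Metric.ball 0 R₀
  swap
  · have : φ x = 0 := by
      by_contra hne
      exact hx (hsupp hne)
    simp [this]
  set N := eLpNorm (fderiv ℝ φ) (ENNReal.ofReal p) volume
  have hcf := hφ.continuous_fderiv one_ne_zero
  have hcont : Continuous fun z : EuclideanSpace ℝ (Fin d) × ℝ =>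
      3 * ‖fderiv ℝ φ (x + z.2 • z.1)‖ₑ := by
    refine ENNReal.continuous_const_mul (by simp) |>.comp ?_
    exact (hcf.comp (by fun_prop)).enorm
  have key : volume A * ‖φ x‖ₑ ≤ 3 * m * I * N := by
    calc volume A * ‖φ x‖ₑ = ∫⁻ _ in A, ‖φ x‖ₑ := by
          rw [lintegral_const, Measure.restrict_apply_univ, mul_comm]
      _ ≤ ∫⁻ y in A, ∫⁻ s in Ioc 0 (2 * R₀), 3 * ‖fderiv ℝ φ (x + s • y)‖ₑ :=
          setLIntegral_mono' Metric.isClosed_closedBall.measurableSet fun y hy =>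
            enorm_le_lintegral_ray hφ hsupp hx (hAn y hy).1 (hAn y hy).2
      _ = ∫⁻ s in Ioc 0 (2 * R₀), ∫⁻ y in A, 3 * ‖fderiv ℝ φ (x + s • y)‖ₑ :=
          lintegral_lintegral_swap hcont.measurable.aemeasurable
      _ ≤ ∫⁻ s in Ioc 0 (2 * R₀), 3 * m * N * ENNReal.ofReal (s ^ (-(d / p))) := by
          refine setLIntegral_mono' measurableSet_Ioc fun s hs => ?_
          have hc : Continuous fun y => fderiv ℝ φ (x + s • y) := hcf.comp (by fun_prop)
          rw [lintegral_const_mul' _ _ (by simp), ← eLpNorm_one_eq_lintegral_enorm]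
          have h1 := eLpNorm_le_eLpNorm_mul_rpow_measure_univ (μ := volume.restrict A)
            (p := 1) (q := ENNReal.ofReal p) (ENNReal.one_le_ofReal.2 (by linarith))
            hc.aestronglyMeasurable
          rw [Measure.restrict_apply_univ] at h1
          have h2 := (eLpNorm_mono_measure (p := ENNReal.ofReal p)
            (fun y => fderiv ℝ φ (x + s • y)) (Measure.restrict_le_self (s := A) (μ := volume))).trans_eq
            (eLpNorm_comp_add_smul _ hcf x hs.1 hp0)
          calc _ ≤ 3 * (ENNReal.ofReal (s ^ (-(d / p))) * N * m) := by
                gcongr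
                exact h1.trans (by gcongr)
            _ = _ := by ring
      _ = 3 * m * I * N := by
          rw [lintegral_const_mul _ (by fun_prop)]
          ring
  calc ‖φ x‖ₑ = (volume A)⁻¹ * (volume A * ‖φ x‖ₑ) := by
        rw [← mul_assoc, ENNReal.inv_mul_cancel hApos hAfin, one_mul]
    _ ≤ (volume A)⁻¹ * (3 * m * I * N) := by gcongr
    _ = _ := by ring

theorem exists_eLpNorm_four_le (hd : 1 ≤ d) (hd3 : d ≤ 3) (R₀ : ℝ) :
    ∃ C : ℝ≥0, ∀ φ : EuclideanSpace ℝ (Fin d) → ℝ, ContDiff ℝ 1 φ →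
      Function.support φ ⊆ Metric.ball 0 R₀ →
      eLpNorm φ 4 volume ≤ C * eLpNorm (fderiv ℝ φ) 2 volume := by
  have hfin : volume (Metric.closedBall (0 : EuclideanSpace ℝ (Fin d)) R₀) ≠ ⊤ :=
    measure_closedBall_lt_top.ne
  rcases hd.eq_or_lt with h1 | h1
  · obtain ⟨C, hC⟩ := exists_enorm_le_eLpNorm_fderiv hd (p := 2) (by rw [← h1]; norm_num) R₀
    set B := Metric.closedBall (0 : EuclideanSpace ℝ (Fin d)) R₀
    refine ⟨(volume B ^ (4 : ℝ)⁻¹ * C).toNNReal, fun φ hφ hsupp => ?_⟩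
    rw [ENNReal.coe_toNNReal (by finiteness)]
    rw [← eLpNorm_restrict_eq_of_support_subset (s := B) (hsupp.trans Metric.ball_subset_closedBall)]
    have h2 := eLpNorm_le_of_ae_enorm_bound (p := 4) (μ := volume.restrict B) (f := φ)
      (Eventually.of_forall (hC φ hφ hsupp))
    rw [Measure.restrict_apply_univ, smul_eq_mul] at h2
    refine h2.trans_eq ?_
    simp only [ENNReal.toReal_ofNat, ENNReal.ofReal_ofNat]
    ring
  · set B := Metric.closedBall (0 : EuclideanSpace ℝ (Fin d)) R₀ with hB
    set p : ℝ≥0 := 4 * d / (d + 4) with hp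
    have hdR : (2 : ℝ≥0) ≤ d := by exact_mod_cast h1
    have hdR3 : (d : ℝ≥0) ≤ 3 := by exact_mod_cast hd3
    have hp1 : 1 ≤ p := by
      rw [hp, one_le_div (by positivity)]
      have h2 : (2 : ℝ) ≤ d := by exact_mod_cast h1
      have : ((d : ℝ≥0) + 4 : ℝ) ≤ 4 * d := by push_cast; linarith
      exact_mod_cast this
    have hp2 : p ≤ 2 := by
      rw [hp, div_le_iff₀ (by positivity)]
      have h2 : (d : ℝ) ≤ 3 := by exact_mod_cast hd3
      have : (4 * d : ℝ) ≤ 2 * (d + 4) := by linarith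
      exact_mod_cast this
    have hpd : p < d := by
      rw [hp, div_lt_iff₀ (by positivity)]
      have h2 : (2 : ℝ) ≤ d := by exact_mod_cast h1
      have : (4 * d : ℝ) < d * (d + 4) := by nlinarith
      exact_mod_cast this
    have hd0 : (d : ℝ) ≠ 0 := by positivity
    set e : ℝ := 1 / (p : ℝ≥0∞).toReal - 1 / (2 : ℝ≥0∞).toReal
    have he : 0 ≤ e := by
      have h3 : (0 : ℝ) < p := by
        have : (1 : ℝ) ≤ p := by exact_mod_cast hp1
        linarith
      have h2 : (p : ℝ) ≤ 2 := by exact_mod_cast hp2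
      simp only [e, ENNReal.coe_toReal, ENNReal.toReal_ofNat, sub_nonneg]
      gcongr
    refine ⟨eLpNormLESNormFDerivOfLeConst ℝ volume B p 4 * (volume B ^ e).toNNReal,
      fun φ hφ hsupp => ?_⟩
    have hs := hsupp.trans Metric.ball_subset_closedBall
    have h2 := eLpNorm_le_eLpNorm_fderiv_of_le (μ := volume) (p := p) (q := 4) hφ hs hp1
      (by rwa [finrank_euclideanSpace_fin]) (by
        rw [finrank_euclideanSpace_fin, hp]
        push_cast
        apply le_of_eq
        field_simp
        ring) Metric.isBounded_closedBall
    have h3 : eLpNorm (fderiv ℝ φ) p volume ≤ eLpNorm (fderiv ℝ φ) 2 volume * volume B ^ e := by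
      have hs' : Function.support (fderiv ℝ φ) ⊆ B := (support_fderiv_subset ℝ).trans
        (closure_minimal hs Metric.isClosed_closedBall)
      have hr : ∀ r : ℝ≥0∞, eLpNorm (fderiv ℝ φ) r (volume.restrict B)
          = eLpNorm (fderiv ℝ φ) r volume := fun r =>
        eLpNorm_restrict_eq_of_support_subset (f := fderiv ℝ φ) hs'
      rw [← hr, ← hr]
      have := eLpNorm_le_eLpNorm_mul_rpow_measure_univ (μ := volume.restrict B)
        (p := p) (q := 2) (f := fderiv ℝ φ) (by exact_mod_cast hp2)
        (hφ.continuous_fderiv one_ne_zero).aestronglyMeasurable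
      rwa [Measure.restrict_apply_univ] at this
    have h5 : (volume B ^ e) ≠ ⊤ := ENNReal.rpow_ne_top_of_nonneg he hfin
    rw [ENNReal.coe_mul, ENNReal.coe_toNNReal h5, mul_assoc, mul_comm (volume B ^ e)]
    exact h2.trans (by gcongr)

end Westervelt

end

noncomputable section

namespace Westervelt

open Filter Topology

section Inclusion

variable {α E : Type*} [MeasurableSpace α] {μ : Measure α} [IsFiniteMeasure μ]
  [NormedAddCommGroup E] [NormedSpace ℝ E]

/-- The inclusion `L_p ⊆ L_r` for `r ≤ p` on a finite measure space. -/
def lpIncl {p : ℝ≥0∞} [Fact (1 ≤ p)] (r : ℝ≥0∞) [Fact (1 ≤ r)] (h : r ≤ p) :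
    Lp E p μ →L[ℝ] Lp E r μ :=
  LinearMap.mkContinuous
    { toFun := fun f => ((Lp.memLp f).mono_exponent h).toLp f
      map_add' := fun f g => by
        rw [← MemLp.toLp_add]
        exact MemLp.toLp_congr _ _ (Lp.coeFn_add f g)
      map_smul' := fun c f => by
        rw [RingHom.id_apply, ← MemLp.toLp_const_smul]
        exact MemLp.toLp_congr _ _ (Lp.coeFn_smul c f) }
    (μ univ ^ (1 / r.toReal - 1 / p.toReal)).toReal fun f => by
      change ‖((Lp.memLp f).mono_exponent h).toLp f‖ ≤ _
      rw [Lp.norm_toLp, Lp.norm_def, ← ENNReal.toReal_mul, mul_comm]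
      have h1 : 0 ≤ 1 / r.toReal - 1 / p.toReal := by
        have hr1 := (Fact.out : 1 ≤ r)
        by_cases hp : p = ⊤
        · simp [hp]
        have hr : r ≠ ⊤ := ne_top_of_le_ne_top hp h
        have h2 : 0 < r.toReal := ENNReal.toReal_pos (by positivity) hr
        have h3 : r.toReal ≤ p.toReal := ENNReal.toReal_mono hp h
        rw [sub_nonneg]
        gcongr
      refine ENNReal.toReal_mono (ENNReal.mul_ne_top (Lp.eLpNorm_ne_top f)
        (ENNReal.rpow_ne_top_of_nonneg h1 (measure_ne_top _ _))) ?_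
      exact eLpNorm_le_eLpNorm_mul_rpow_measure_univ h (Lp.aestronglyMeasurable f)

theorem coeFn_lpIncl {p r : ℝ≥0∞} [Fact (1 ≤ p)] [Fact (1 ≤ r)] (h : r ≤ p) (f : Lp E p μ) :
    lpIncl r h f =ᵐ[μ] f :=
  MemLp.coeFn_toLp ((Lp.memLp f).mono_exponent h)

theorem eLpNorm_lpIncl {p r : ℝ≥0∞} [Fact (1 ≤ p)] [Fact (1 ≤ r)] (h : r ≤ p) (f : Lp E p μ)
    (s : ℝ≥0∞) : eLpNorm (lpIncl r h f) s μ = eLpNorm f s μ :=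
  eLpNorm_congr_ae (coeFn_lpIncl h f)

theorem eLpNorm_eq_ofReal_norm {p : ℝ≥0∞} (f : Lp E p μ) :
    eLpNorm f p μ = ENNReal.ofReal ‖f‖ := by
  rw [Lp.norm_def, ENNReal.ofReal_toReal (Lp.eLpNorm_ne_top f)]

/-- Norm inequalities between different exponents are stable under convergence in `L_p`. -/
theorem eLpNorm_le_of_tendsto {F : Type*} [NormedAddCommGroup F] [NormedSpace ℝ F]
    {p r s : ℝ≥0∞} [Fact (1 ≤ p)] [Fact (1 ≤ s)]
    (hs : s ≤ p) {f : ℕ → Lp E p μ} {f₀ : Lp E p μ} {g : ℕ → Lp F p μ} {g₀ : Lp F p μ}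
    (hf : Tendsto f atTop (𝓝 f₀)) (hg : Tendsto g atTop (𝓝 g₀)) (C : ℝ≥0)
    (h : ∀ n, eLpNorm (f n) r μ ≤ C * eLpNorm (g n) s μ) :
    eLpNorm f₀ r μ ≤ C * eLpNorm g₀ s μ := by
  obtain ⟨ns, hns, hae⟩ := (tendstoInMeasure_of_tendsto_Lp hf).exists_seq_tendsto_ae
  refine (Lp.eLpNorm_lim_le_liminf_eLpNorm (fun n => Lp.aestronglyMeasurable (f (ns n))) f₀
    hae).trans ?_
  have h1 : Tendsto (fun n => (C : ℝ≥0∞) * ENNReal.ofReal ‖lpIncl s hs (g (ns n))‖) atTop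
      (𝓝 (C * ENNReal.ofReal ‖lpIncl s hs g₀‖)) := by
    refine ENNReal.Tendsto.const_mul ?_ (Or.inr ENNReal.coe_ne_top)
    refine ENNReal.tendsto_ofReal ?_
    exact (((lpIncl s hs).continuous.tendsto g₀).comp (hg.comp hns.tendsto_atTop)).norm
  rw [← eLpNorm_lpIncl hs g₀, eLpNorm_eq_ofReal_norm, ← h1.liminf_eq]
  refine liminf_le_liminf (Eventually.of_forall fun n => ?_)
  rw [← eLpNorm_eq_ofReal_norm, eLpNorm_lpIncl]
  exact h (ns n)

end Inclusion

section Embeddings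

variable {d : ℕ} {Ω : Set (EuclideanSpace ℝ (Fin d))}

theorem norm_gradient {φ : EuclideanSpace ℝ (Fin d) → ℝ} (x : EuclideanSpace ℝ (Fin d)) :
    ‖gradient φ x‖ = ‖fderiv ℝ φ x‖ := by
  rw [gradient, LinearIsometryEquiv.norm_map]

theorem inner_gradient {φ : EuclideanSpace ℝ (Fin d) → ℝ} (x v : EuclideanSpace ℝ (Fin d)) :
    inner ℝ (gradient φ x) v = fderiv ℝ φ x v := by
  rw [gradient, InnerProductSpace.toDual_symm_apply]

theorem eLpNorm_gradient_restrict {φ : EuclideanSpace ℝ (Fin d) → ℝ} (hφ : tsupport φ ⊆ Ω)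
    (r : ℝ≥0∞) :
    eLpNorm (gradient φ) r (volume.restrict Ω) = eLpNorm (fderiv ℝ φ) r volume := by
  rw [eLpNorm_congr_norm_ae (g := fderiv ℝ φ) (Eventually.of_forall norm_gradient)]
  exact eLpNorm_restrict_eq_of_support_subset (f := fderiv ℝ φ)
    ((support_fderiv_subset ℝ).trans hφ)

/-- An inequality between norms of a test function and its gradient extends to `W_0^{1,p}(Ω)`. -/
theorem eLpNorm_fn_le_of_test [IsFiniteMeasure (volume.restrict Ω)] {p r s : ℝ≥0∞} [Fact (1 ≤ p)]
    [Fact (1 ≤ s)] (hs : s ≤ p) (C : ℝ≥0)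
    (h : ∀ φ : EuclideanSpace ℝ (Fin d) → ℝ, ContDiff ℝ ∞ φ → HasCompactSupport φ →
      tsupport φ ⊆ Ω → eLpNorm φ r (volume.restrict Ω) ≤ C * eLpNorm (fderiv ℝ φ) s volume)
    (w : W0 Ω p) :
    eLpNorm (fn w) r (volume.restrict Ω) ≤ C * eLpNorm (grad w) s (volume.restrict Ω) := by
  obtain ⟨z, hz, hzw⟩ := mem_closure_iff_seq_limit.1 w.2
  have h1 := (continuous_fst.tendsto _).comp hzw
  have h2 := (continuous_snd.tendsto _).comp hzw
  refine eLpNorm_le_of_tendsto hs h1 h2 C fun n => ?_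
  obtain ⟨φ, c1, c2, c3, c4, c5⟩ := hz n
  simp only [Function.comp_apply]
  rw [eLpNorm_congr_ae c4, eLpNorm_congr_ae c5, eLpNorm_gradient_restrict c3]
  exact h φ c1 c2 c3

theorem exists_eLpNorm_top_le (hd1 : 1 ≤ d) (hΩb : Bornology.IsBounded Ω)
    {q : ℝ} [Fact (1 ≤ q)] (hq : (d : ℝ) - 1 < q) [IsFiniteMeasure (volume.restrict Ω)] :
    ∃ C : ℝ≥0, ∀ w : W0 Ω (expo q),
      eLpNorm (fn w) ⊤ (volume.restrict Ω) ≤ C * eLpNorm (grad w) (expo q) (volume.restrict Ω) := by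
  obtain ⟨R, hR⟩ := hΩb.subset_ball 0
  obtain ⟨C, hC⟩ := exists_enorm_le_eLpNorm_fderiv hd1 (p := q + 1) (by linarith) R
  refine ⟨C, eLpNorm_fn_le_of_test le_rfl C fun φ h1 h2 h3 => ?_⟩
  rw [eLpNorm_exponent_top]
  exact eLpNormEssSup_le_of_ae_enorm_bound (Eventually.of_forall
    (hC φ (h1.of_le (by exact_mod_cast le_top)) ((subset_tsupport φ).trans (h3.trans hR))))

theorem exists_eLpNorm_fn_four_le (hd1 : 1 ≤ d) (hd3 : d ≤ 3) (hΩb : Bornology.IsBounded Ω)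
    {p : ℝ≥0∞} [Fact (1 ≤ p)] (hp : 2 ≤ p) [IsFiniteMeasure (volume.restrict Ω)] :
    ∃ C : ℝ≥0, ∀ w : W0 Ω p,
      eLpNorm (fn w) 4 (volume.restrict Ω) ≤ C * eLpNorm (grad w) 2 (volume.restrict Ω) := by
  obtain ⟨R, hR⟩ := hΩb.subset_ball 0
  obtain ⟨C, hC⟩ := exists_eLpNorm_four_le hd1 hd3 R
  refine ⟨C, eLpNorm_fn_le_of_test hp C fun φ h1 h2 h3 => ?_⟩
  exact (eLpNorm_mono_measure _ Measure.restrict_le_self).trans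
    (hC φ (h1.of_le (by exact_mod_cast le_top)) ((subset_tsupport φ).trans (h3.trans hR)))

/-- The embedding constant is attained. -/
theorem eLpNorm_top_le_embConst {q : ℝ} [Fact (1 ≤ q)]
    (hex : ∃ C : ℝ≥0, ∀ w : W0 Ω (expo q),
      eLpNorm (fn w) ⊤ (volume.restrict Ω) ≤ C * eLpNorm (grad w) (expo q) (volume.restrict Ω)) :
    0 ≤ embConst Ω q ∧ ∀ w : W0 Ω (expo q), eLpNorm (fn w) ⊤ (volume.restrict Ω)
      ≤ ENNReal.ofReal (embConst Ω q) * eLpNorm (grad w) (expo q) (volume.restrict Ω) := by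
  set s := {C : ℝ | 0 ≤ C ∧ ∀ w : W0 Ω (expo q),
    eLpNorm (fn w) ∞ (volume.restrict Ω) ≤
      ENNReal.ofReal C * eLpNorm (grad w) (expo q) (volume.restrict Ω)}
  have hne : s.Nonempty := by
    obtain ⟨C, hC⟩ := hex
    exact ⟨C, C.2, by simpa using hC⟩
  have hbdd : BddBelow s := ⟨0, fun _ h => h.1⟩
  have h0 : 0 ≤ sInf s := le_csInf hne fun _ h => h.1
  refine ⟨h0, fun w => ?_⟩
  obtain ⟨c, -, hc2, hc3⟩ := exists_seq_tendsto_sInf hne hbdd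
  have h1 : Tendsto (fun n => ENNReal.ofReal (c n) *
      eLpNorm (grad w) (expo q) (volume.restrict Ω)) atTop
      (𝓝 (ENNReal.ofReal (sInf s) * eLpNorm (grad w) (expo q) (volume.restrict Ω))) :=
    ENNReal.Tendsto.mul_const (ENNReal.tendsto_ofReal hc2) (Or.inr (Lp.eLpNorm_ne_top w.1.2))
  exact ge_of_tendsto' h1 fun n => (hc3 n).2 w

/-- The weak gradient is determined by the function. -/
theorem grad_eq_zero (hΩo : IsOpen Ω) [IsFiniteMeasure (volume.restrict Ω)] {p : ℝ≥0∞}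
    [Fact (1 ≤ p)] (hp : 2 ≤ p) {w : W0 Ω p} (hw : w.1.1 = 0) : w.1.2 = 0 := by
  have key : ∀ ψ : EuclideanSpace ℝ (Fin d) → ℝ, ContDiff ℝ ∞ ψ → HasCompactSupport ψ →
      tsupport ψ ⊆ Ω → ∀ v, ∫ x in Ω, ψ x * inner ℝ (w.1.2 x) v = 0 := by
    intro ψ h1 h2 h3 v
    have hψ' : ContDiff ℝ ∞ fun x => fderiv ℝ ψ x v :=
      (h1.fderiv_right (m := ∞) (by simp)).clm_apply contDiff_const
    have hψs : HasCompactSupport fun x => fderiv ℝ ψ x v := h2.fderiv_apply ℝ v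
    have hψv : HasCompactSupport fun x => ψ x • v := h2.smul_right
    have m1 : MemLp (fun x => fderiv ℝ ψ x v) 2 (volume.restrict Ω) :=
      (hψ'.continuous.memLp_of_hasCompactSupport hψs)
    have m2 : MemLp (fun x => ψ x • v) 2 (volume.restrict Ω) :=
      (h1.continuous.smul continuous_const).memLp_of_hasCompactSupport hψv
    set L : Lp ℝ p (volume.restrict Ω) × Lp (EuclideanSpace ℝ (Fin d)) p (volume.restrict Ω) → ℝ :=
      fun z => inner ℝ (lpIncl 2 hp z.1) (m1.toLp _) + inner ℝ (lpIncl 2 hp z.2) (m2.toLp _)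
    have hL : Continuous L := by fun_prop
    have hLi : ∀ z, L z = (∫ x in Ω, z.1 x * fderiv ℝ ψ x v) + ∫ x in Ω, ψ x * inner ℝ (z.2 x) v := by
      intro z
      simp only [L, L2.inner_def]
      congr 1
      · refine integral_congr_ae ?_
        filter_upwards [coeFn_lpIncl hp z.1, m1.coeFn_toLp] with x hx1 hx2
        rw [hx1, hx2, real_inner_comm]
        simp
      · refine integral_congr_ae ?_
        filter_upwards [coeFn_lpIncl hp z.2, m2.coeFn_toLp] with x hx1 hx2
        rw [hx1, hx2, inner_smul_right]
    have hLz : ∀ z ∈ testPairs Ω p, L z = 0 := by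
      rintro z ⟨φ, c1, c2, c3, c4, c5⟩
      have e1 : ∫ x in Ω, z.1 x * fderiv ℝ ψ x v = ∫ x, φ x * fderiv ℝ ψ x v := by
        rw [← setIntegral_eq_integral_of_forall_compl_eq_zero (s := Ω)
          (f := fun x => φ x * fderiv ℝ ψ x v)]
        · refine integral_congr_ae ?_
          filter_upwards [c4] with x hx
          rw [hx]
        · intro x hx
          rw [image_eq_zero_of_notMem_tsupport (fun h => hx (c3 h)), zero_mul]
      have e2 : ∫ x in Ω, ψ x * inner ℝ (z.2 x) v = ∫ x, fderiv ℝ φ x v * ψ x := by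
        rw [← setIntegral_eq_integral_of_forall_compl_eq_zero (s := Ω)
          (f := fun x => fderiv ℝ φ x v * ψ x)]
        · refine integral_congr_ae ?_
          filter_upwards [c5] with x hx
          rw [hx, inner_gradient, mul_comm]
        · intro x hx
          rw [image_eq_zero_of_notMem_tsupport (fun h => hx (h3 h)), mul_zero]
      have hφ' : Continuous fun x => fderiv ℝ φ x v :=
        (c1.continuous_fderiv (by simp)).clm_apply continuous_const
      rw [hLi, e1, e2, integral_mul_fderiv_eq_neg_fderiv_mul_of_integrable
        ((hφ'.mul h1.continuous).integrable_of_hasCompactSupport h2.mul_left)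
        ((c1.continuous.mul hψ'.continuous).integrable_of_hasCompactSupport c2.mul_right)
        ((c1.continuous.mul h1.continuous).integrable_of_hasCompactSupport c2.mul_right)
        (fun x _ => (c1.differentiable (by simp)) x) (fun x _ => (h1.differentiable (by simp)) x),
        neg_add_cancel]
    have h4 : L w.1 = 0 := by
      have : closure (testPairs Ω p : Set _) ⊆ {z | L z = 0} :=
        closure_minimal hLz (isClosed_eq hL continuous_const)
      exact this w.2
    rw [hLi, hw] at h4
    have h5 : ∫ x in Ω, (0 : Lp ℝ p (volume.restrict Ω)) x * fderiv ℝ ψ x v = 0 := by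
      rw [← integral_zero (EuclideanSpace ℝ (Fin d)) ℝ (μ := volume.restrict Ω)]
      refine integral_congr_ae ?_
      filter_upwards [Lp.coeFn_zero ℝ p (volume.restrict Ω)] with x hx
      rw [hx]
      simp
    rwa [h5, zero_add] at h4
  have hp1 : 1 ≤ p := Fact.out
  have h_int : IntegrableOn w.1.2 Ω := (Lp.memLp w.1.2).integrable hp1
  have hae := hΩo.ae_eq_zero_of_integral_contDiff_smul_eq_zero (μ := volume)
    (f := w.1.2) h_int.locallyIntegrableOn (fun ψ h1 h2 h3 => by
      refine ext_inner_right ℝ fun v => ?_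
      have e : ∫ x, ψ x • w.1.2 x = ∫ x in Ω, ψ x • w.1.2 x := by
        rw [setIntegral_eq_integral_of_forall_compl_eq_zero]
        intro x hx
        rw [image_eq_zero_of_notMem_tsupport (fun h => hx (h3 h)), zero_smul]
      have hi : Integrable (fun x => ψ x • w.1.2 x) (volume.restrict Ω) := by
        obtain ⟨C, hC⟩ := h1.continuous.bounded_above_of_compact_support h2
        exact h_int.bdd_smul C h1.continuous.aestronglyMeasurable (Eventually.of_forall hC)
      rw [inner_zero_left, real_inner_comm, e, ← integral_inner hi, ← key ψ h1 h2 h3 v]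
      refine integral_congr_ae (Eventually.of_forall fun x => ?_)
      simp only [inner_smul_right]
      rw [real_inner_comm])
  rw [Lp.eq_zero_iff_ae_eq_zero]
  exact (ae_restrict_iff' hΩo.measurableSet).2 hae

end Embeddings

end Westervelt

end

noncomputable section

namespace Westervelt

open Filter Topology

section Pointwise

variable {F : Type*} [NormedAddCommGroup F] [InnerProductSpace ℝ F] {q : ℝ}

theorem rpow_sub_one_mul_self (hq : 1 ≤ q) {x : ℝ} (hx : 0 ≤ x) : x ^ (q - 1) * x = x ^ q := by
  rcases hx.eq_or_lt with rfl | h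
  · rw [mul_zero, Real.zero_rpow (by linarith)]
  · rw [← Real.rpow_add_one h.ne', sub_add_cancel]

theorem rpow_mul_self (hq : 1 ≤ q) {x : ℝ} (hx : 0 ≤ x) : x ^ q * x = x ^ (q + 1) := by
  have := rpow_sub_one_mul_self (q := q + 1) (by linarith) hx
  rwa [add_sub_cancel_right] at this

theorem rpow_mul_le (hq : 1 ≤ q) {x y : ℝ} (hx : 0 ≤ x) (hy : 0 ≤ y) :
    x ^ q * y ≤ q / (q + 1) * x ^ (q + 1) + 1 / (q + 1) * y ^ (q + 1) := by
  have hq0 : 0 < q := by linarith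
  have hc : ((q + 1) / q).HolderConjugate (q + 1) :=
    Real.holderConjugate_iff.2 ⟨by rw [lt_div_iff₀ hq0]; linarith, by field_simp⟩
  have h := Real.young_inequality_of_nonneg (Real.rpow_nonneg hx q) hy hc
  rw [← Real.rpow_mul hx, mul_div_cancel₀ _ hq0.ne'] at h
  refine h.trans_eq ?_
  field_simp

/-- The nonlinear part of the flux, paired with a vector. -/
def powFlux (q : ℝ) (ξ η : F) : ℝ := ‖ξ‖ ^ (q - 1) * inner ℝ ξ η

theorem abs_powFlux_le (hq : 1 ≤ q) (ξ η : F) : |powFlux q ξ η| ≤ ‖ξ‖ ^ q * ‖η‖ := by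
  rw [powFlux, abs_mul, abs_of_nonneg (by positivity), ← rpow_sub_one_mul_self hq (norm_nonneg ξ),
    mul_assoc]
  gcongr
  exact abs_real_inner_le_norm _ _

theorem powFlux_self (hq : 1 ≤ q) (ξ : F) : powFlux q ξ ξ = ‖ξ‖ ^ (q + 1) := by
  rw [powFlux, real_inner_self_eq_norm_sq, pow_two, ← mul_assoc,
    rpow_sub_one_mul_self hq (norm_nonneg _), rpow_mul_self hq (norm_nonneg _)]

theorem powFlux_sub_le (hq : 1 ≤ q) (ξ η : F) :
    1 / (q + 1) * ‖ξ‖ ^ (q + 1) + powFlux q ξ (η - ξ) ≤ 1 / (q + 1) * ‖η‖ ^ (q + 1) := by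
  have h1 : powFlux q ξ (η - ξ) = powFlux q ξ η - ‖ξ‖ ^ (q + 1) := by
    rw [← powFlux_self hq ξ]; simp only [powFlux, inner_sub_right]; ring
  have h2 := (le_abs_self _).trans (abs_powFlux_le hq ξ η)
  have h3 := rpow_mul_le hq (norm_nonneg ξ) (norm_nonneg η)
  have h4 : 1 / (q + 1) * ‖ξ‖ ^ (q + 1) + q / (q + 1) * ‖ξ‖ ^ (q + 1) = ‖ξ‖ ^ (q + 1) := by
    field_simp
    ring
  linarith

theorem le_powFlux_sub (hq : 1 ≤ q) (ξ η : F) :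
    2 ^ (-q) * ‖η - ξ‖ ^ (q + 1) ≤ powFlux q η (η - ξ) - powFlux q ξ (η - ξ) := by
  set x := ‖ξ‖ ^ (q - 1) with hx
  set y := ‖η‖ ^ (q - 1) with hy
  have hx0 : 0 ≤ x := by positivity
  have hy0 : 0 ≤ y := by positivity
  have e : powFlux q η (η - ξ) - powFlux q ξ (η - ξ)
      = 1 / 2 * (y + x) * ‖η - ξ‖ ^ 2 + 1 / 2 * ((y - x) * (‖η‖ ^ 2 - ‖ξ‖ ^ 2)) := by
    simp only [powFlux, ← hx, ← hy, ← real_inner_self_eq_norm_sq, inner_sub_left, inner_sub_right]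
    rw [real_inner_comm η ξ]
    ring
  have h1 : 0 ≤ (y - x) * (‖η‖ ^ 2 - ‖ξ‖ ^ 2) := by
    rcases le_total ‖ξ‖ ‖η‖ with h | h
    · refine mul_nonneg (sub_nonneg.2 ?_) (sub_nonneg.2 (by gcongr))
      exact Real.rpow_le_rpow (norm_nonneg _) h (by linarith)
    · refine mul_nonneg_of_nonpos_of_nonpos (sub_nonpos.2 ?_) (sub_nonpos.2 (by gcongr))
      exact Real.rpow_le_rpow (norm_nonneg _) h (by linarith)
  have h2 : ‖η - ξ‖ ^ (q - 1) ≤ 2 ^ (q - 1) * (y + x) := by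
    have h3 : ‖η - ξ‖ ≤ 2 * max ‖η‖ ‖ξ‖ := by
      have := norm_sub_le η ξ
      linarith [le_max_left ‖η‖ ‖ξ‖, le_max_right ‖η‖ ‖ξ‖]
    calc ‖η - ξ‖ ^ (q - 1) ≤ (2 * max ‖η‖ ‖ξ‖) ^ (q - 1) :=
          Real.rpow_le_rpow (norm_nonneg _) h3 (by linarith)
      _ = 2 ^ (q - 1) * (max ‖η‖ ‖ξ‖) ^ (q - 1) := Real.mul_rpow (by norm_num) (by positivity)
      _ ≤ _ := by
          gcongr
          rcases max_cases ‖η‖ ‖ξ‖ with h | h <;> rw [h.1] <;> linarith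
  have h4 : ‖η - ξ‖ ^ (q + 1) = ‖η - ξ‖ ^ (q - 1) * ‖η - ξ‖ ^ 2 := by
    rw [← rpow_mul_self hq (norm_nonneg _), ← rpow_sub_one_mul_self hq (norm_nonneg _)]
    ring
  have h5 : (2 : ℝ) ^ (-q) * 2 ^ (q - 1) = 1 / 2 := by
    rw [← Real.rpow_add (by norm_num)]
    rw [show -q + (q - 1) = -1 by ring, Real.rpow_neg_one]
    norm_num
  have h6 : (0 : ℝ) < 2 ^ (-q) := by positivity
  rw [e, h4]
  calc 2 ^ (-q) * (‖η - ξ‖ ^ (q - 1) * ‖η - ξ‖ ^ 2)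
      ≤ 2 ^ (-q) * (2 ^ (q - 1) * (y + x) * ‖η - ξ‖ ^ 2) := by gcongr
    _ = 2 ^ (-q) * 2 ^ (q - 1) * (y + x) * ‖η - ξ‖ ^ 2 := by ring
    _ = 1 / 2 * (y + x) * ‖η - ξ‖ ^ 2 := by rw [h5]
    _ ≤ _ := by linarith

theorem continuous_powFlux (hq : 1 ≤ q) : Continuous fun z : F × F => powFlux q z.1 z.2 := by
  unfold powFlux
  have h := Real.continuous_rpow_const (q := q - 1) (by linarith)
  fun_prop

end Pointwise

section Functional

variable {α F : Type*} [MeasurableSpace α] {μ : Measure α}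
  [NormedAddCommGroup F] [InnerProductSpace ℝ F] {q : ℝ} [hq : Fact (1 ≤ q)]

theorem toReal_expo (q : ℝ) [hq : Fact (1 ≤ q)] : (expo q).toReal = q + 1 :=
  ENNReal.toReal_ofReal (by linarith [hq.out])

theorem expo_ne_zero (q : ℝ) [Fact (1 ≤ q)] : expo q ≠ 0 := by
  have := (expo_fact q).out
  positivity

theorem integrable_norm_rpow_expo (g : Lp F (expo q) μ) :
    Integrable (fun x => ‖g x‖ ^ (q + 1)) μ := by
  have h := (Lp.memLp g).integrable_norm_rpow (expo_ne_zero q) ENNReal.ofReal_ne_top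
  rwa [toReal_expo] at h

theorem norm_rpow_eq_integral (g : Lp F (expo q) μ) :
    ‖g‖ ^ (q + 1) = ∫ x, ‖g x‖ ^ (q + 1) ∂μ := by
  have hq1 := hq.out
  rw [Lp.norm_def, (Lp.memLp g).eLpNorm_eq_integral_rpow_norm (expo_ne_zero q) ENNReal.ofReal_ne_top,
    toReal_expo, ENNReal.toReal_ofReal (by positivity), ← Real.rpow_mul (by positivity),
    inv_mul_cancel₀ (by linarith), Real.rpow_one]

theorem aestronglyMeasurable_powFlux {g h : α → F} (hg : AEStronglyMeasurable g μ)
    (hh : AEStronglyMeasurable h μ) : AEStronglyMeasurable (fun x => powFlux q (g x) (h x)) μ :=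
  (continuous_powFlux hq.out).comp_aestronglyMeasurable (hg.prodMk hh)

theorem abs_powFlux_le_add (ξ η : F) :
    ‖powFlux q ξ η‖ ≤ ‖ξ‖ ^ (q + 1) + ‖η‖ ^ (q + 1) := by
  have hq1 := hq.out
  refine (abs_powFlux_le hq1 ξ η).trans ((rpow_mul_le hq1 (norm_nonneg _) (norm_nonneg _)).trans ?_)
  have h1 : q / (q + 1) ≤ 1 := by rw [div_le_one (by linarith)]; linarith
  have h2 : 1 / (q + 1) ≤ 1 := by rw [div_le_one (by linarith)]; linarith
  have h3 : 0 ≤ ‖ξ‖ ^ (q + 1) := by positivity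
  have h4 : 0 ≤ ‖η‖ ^ (q + 1) := by positivity
  nlinarith

theorem integrable_powFlux (g h : Lp F (expo q) μ) :
    Integrable (fun x => powFlux q (g x) (h x)) μ :=
  ((integrable_norm_rpow_expo g).add (integrable_norm_rpow_expo h)).mono'
    (aestronglyMeasurable_powFlux (Lp.aestronglyMeasurable g) (Lp.aestronglyMeasurable h))
    (Eventually.of_forall fun _ => abs_powFlux_le_add _ _)

/-- The linear functional `h ↦ ∫ |g|^{q-1} g · h`. -/
def powFluxₗ (g : Lp F (expo q) μ) : Lp F (expo q) μ →ₗ[ℝ] ℝ where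
  toFun h := ∫ x, powFlux q (g x) (h x) ∂μ
  map_add' h h' := by
    rw [← integral_add (integrable_powFlux g h) (integrable_powFlux g h')]
    refine integral_congr_ae ?_
    filter_upwards [Lp.coeFn_add h h'] with x hx
    simp only [powFlux, hx, Pi.add_apply, inner_add_right]
    ring
  map_smul' c h := by
    rw [RingHom.id_apply, smul_eq_mul, ← integral_const_mul]
    refine integral_congr_ae ?_
    filter_upwards [Lp.coeFn_smul c h] with x hx
    simp only [powFlux, hx, Pi.smul_apply, inner_smul_right]
    ring

theorem norm_powFluxₗ_le (g h : Lp F (expo q) μ) :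
    ‖powFluxₗ g h‖ ≤ (‖g‖ ^ (q + 1) + 1) * ‖h‖ := by
  have hb : ∀ h' ∈ Metric.closedBall (0 : Lp F (expo q) μ) 1,
      ‖powFluxₗ g h'‖ ≤ ‖g‖ ^ (q + 1) + 1 := by
    intro h' hh'
    rw [mem_closedBall_zero_iff] at hh'
    have h1 : ‖powFluxₗ g h'‖ ≤ ∫ x, (‖g x‖ ^ (q + 1) + ‖h' x‖ ^ (q + 1)) ∂μ :=
      norm_integral_le_of_norm_le ((integrable_norm_rpow_expo g).add (integrable_norm_rpow_expo h'))
        (Eventually.of_forall fun _ => abs_powFlux_le_add _ _)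
    rw [integral_add (integrable_norm_rpow_expo g) (integrable_norm_rpow_expo h'),
      ← norm_rpow_eq_integral, ← norm_rpow_eq_integral] at h1
    have h2 : ‖h'‖ ^ (q + 1) ≤ 1 :=
      Real.rpow_le_one (norm_nonneg _) hh' (by linarith [hq.out])
    linarith
  have := LinearMap.bound_of_ball_bound' one_pos _ (powFluxₗ g) hb h
  rwa [div_one] at this

/-- The continuous linear functional `h ↦ ∫ |g|^{q-1} g · h`. -/
def powFluxL (g : Lp F (expo q) μ) : Lp F (expo q) μ →L[ℝ] ℝ :=
  (powFluxₗ g).mkContinuous _ (norm_powFluxₗ_le g)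

theorem powFluxL_apply (g h : Lp F (expo q) μ) :
    powFluxL g h = ∫ x, powFlux q (g x) (h x) ∂μ := rfl

theorem norm_powFluxL_le (g : Lp F (expo q) μ) : ‖powFluxL g‖ ≤ ‖g‖ ^ (q + 1) + 1 :=
  LinearMap.mkContinuous_norm_le _ (by positivity) _

theorem powFluxL_sub_le (g h : Lp F (expo q) μ) :
    1 / (q + 1) * ‖g‖ ^ (q + 1) + powFluxL g (h - g) ≤ 1 / (q + 1) * ‖h‖ ^ (q + 1) := by
  rw [norm_rpow_eq_integral, norm_rpow_eq_integral, powFluxL_apply, ← integral_const_mul,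
    ← integral_const_mul,
    ← integral_add ((integrable_norm_rpow_expo g).const_mul _) (integrable_powFlux g (h - g))]
  refine integral_mono_ae (((integrable_norm_rpow_expo g).const_mul _).add
    (integrable_powFlux g (h - g))) ((integrable_norm_rpow_expo h).const_mul _) ?_
  filter_upwards [Lp.coeFn_sub h g] with x hx
  rw [hx]
  exact powFlux_sub_le hq.out _ _

theorem le_powFluxL_sub (g h : Lp F (expo q) μ) :
    2 ^ (-q) * ‖h - g‖ ^ (q + 1) ≤ (powFluxL h - powFluxL g) (h - g) := by
  rw [sub_apply, norm_rpow_eq_integral, powFluxL_apply, powFluxL_apply,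
    ← integral_const_mul, ← integral_sub (integrable_powFlux h (h - g))
      (integrable_powFlux g (h - g))]
  refine integral_mono_ae ((integrable_norm_rpow_expo (h - g)).const_mul _)
    ((integrable_powFlux h (h - g)).sub (integrable_powFlux g (h - g))) ?_
  filter_upwards [Lp.coeFn_sub h g] with x hx
  rw [hx]
  exact le_powFlux_sub hq.out _ _

theorem tendsto_powFluxL (g h : Lp F (expo q) μ) :
    Tendsto (fun s : ℝ => powFluxL (g + s • h) h) (𝓝 0) (𝓝 (powFluxL g h)) := by
  have hq1 := hq.out
  have e : ∀ s : ℝ, powFluxL (g + s • h) h = ∫ x, powFlux q (g x + s • h x) (h x) ∂μ := by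
    intro s
    rw [powFluxL_apply]
    refine integral_congr_ae ?_
    filter_upwards [Lp.coeFn_add g (s • h), Lp.coeFn_smul s h] with x h1 h2
    rw [h1, Pi.add_apply, h2, Pi.smul_apply]
  simp only [e]
  rw [powFluxL_apply]
  have hm : MemLp (fun x => ‖g x‖ + ‖h x‖) (expo q) μ := (Lp.memLp g).norm.add (Lp.memLp h).norm
  have hi : Integrable (fun x => ‖‖g x‖ + ‖h x‖‖ ^ (q + 1)) μ := by
    have := hm.integrable_norm_rpow (expo_ne_zero q) ENNReal.ofReal_ne_top
    rwa [toReal_expo] at this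
  refine tendsto_integral_filter_of_dominated_convergence
    (fun x => ‖‖g x‖ + ‖h x‖‖ ^ (q + 1) + ‖h x‖ ^ (q + 1)) ?_ ?_
    (hi.add (integrable_norm_rpow_expo h)) ?_
  · exact Eventually.of_forall fun s => aestronglyMeasurable_powFlux
      ((Lp.aestronglyMeasurable g).add ((Lp.aestronglyMeasurable h).const_smul s))
      (Lp.aestronglyMeasurable h)
  · have h1 : ∀ᶠ s : ℝ in 𝓝 0, ‖s‖ < 1 :=
      (continuous_norm.tendsto (0 : ℝ)).eventually_lt_const (by simp)
    filter_upwards [h1] with s hs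
    refine Eventually.of_forall fun x => (abs_powFlux_le_add _ _).trans ?_
    gcongr
    refine (norm_add_le _ _).trans ((?_ : _ ≤ ‖g x‖ + ‖h x‖).trans (Real.le_norm_self _))
    rw [norm_smul]
    nlinarith [norm_nonneg (h x)]
  · refine Eventually.of_forall fun x => ?_
    have hc : Continuous fun s : ℝ => powFlux q (g x + s • h x) (h x) :=
      (continuous_powFlux hq1).comp
        ((by fun_prop : Continuous fun s : ℝ => (g x + s • h x, h x)))
    have := hc.tendsto 0
    rwa [zero_smul, add_zero] at this

theorem powFluxL_zero : powFluxL (0 : Lp F (expo q) μ) = 0 := by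
  ext h
  rw [powFluxL_apply, zero_apply, ← integral_zero α ℝ (μ := μ)]
  refine integral_congr_ae ?_
  filter_upwards [Lp.coeFn_zero F (expo q) μ] with x hx
  rw [hx]
  simp [powFlux]

end Functional

end Westervelt

end

noncomputable section

namespace Westervelt

open Filter Topology

variable {d : ℕ} {Ω : Set (EuclideanSpace ℝ (Fin d))} {q : ℝ} [hq : Fact (1 ≤ q)]

instance completeSpace_W0 (p : ℝ≥0∞) [Fact (1 ≤ p)] : CompleteSpace (W0 Ω p) :=
  (testPairs Ω p).isClosed_topologicalClosure.completeSpace_coe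

theorem two_le_expo (q : ℝ) [hq : Fact (1 ≤ q)] : 2 ≤ expo q := by
  rw [expo, ← ENNReal.ofReal_ofNat]
  exact ENNReal.ofReal_le_ofReal (by linarith [hq.out])

instance secondCountable_W0 : SecondCountableTopology (W0 Ω (expo q)) := by
  have : Fact (expo q ≠ ⊤) := ⟨ENNReal.ofReal_ne_top⟩
  have h1 : SecondCountableTopology (Lp ℝ (expo q) (volume.restrict Ω)) :=
    Lp.SecondCountableTopology
  have h2 : SecondCountableTopology
      (Lp (EuclideanSpace ℝ (Fin d)) (expo q) (volume.restrict Ω)) :=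
    Lp.SecondCountableTopology
  exact TopologicalSpace.Subtype.secondCountableTopology _

theorem real_inner_eq_mul (x y : ℝ) : inner ℝ x y = x * y := by
  rw [real_inner_comm]; simp

theorem fn_add {p : ℝ≥0∞} [Fact (1 ≤ p)] (w w' : W0 Ω p) :
    fn (w + w') =ᵐ[volume.restrict Ω] fn w + fn w' := Lp.coeFn_add w.1.1 w'.1.1

theorem fn_smul {p : ℝ≥0∞} [Fact (1 ≤ p)] (c : ℝ) (w : W0 Ω p) :
    fn (c • w) =ᵐ[volume.restrict Ω] c • fn w := Lp.coeFn_smul c w.1.1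

/-- The continuous embeddings used in the analysis of the equation. -/
structure Embeds (Ω : Set (EuclideanSpace ℝ (Fin d))) (q : ℝ) [Fact (1 ≤ q)] (C₀ C₄ : ℝ≥0) :
    Prop where
  isOpen : IsOpen Ω
  sup : ∀ w : W0 Ω (expo q), eLpNorm (fn w) ⊤ (volume.restrict Ω)
    ≤ C₀ * eLpNorm (grad w) (expo q) (volume.restrict Ω)
  four : ∀ w : W0 Ω (expo q), eLpNorm (fn w) 4 (volume.restrict Ω)
    ≤ C₄ * eLpNorm (grad w) 2 (volume.restrict Ω)

/-- The function underlying an element of `W_0^{1,p}(Ω)`, as a continuous linear map. -/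
def valL (Ω : Set (EuclideanSpace ℝ (Fin d))) (p : ℝ≥0∞) [Fact (1 ≤ p)] :
    W0 Ω p →L[ℝ] Lp ℝ p (volume.restrict Ω) :=
  (ContinuousLinearMap.fst ℝ _ _).comp (W0 Ω p).subtypeL

/-- The weak gradient, as a continuous linear map. -/
def gradL (Ω : Set (EuclideanSpace ℝ (Fin d))) (p : ℝ≥0∞) [Fact (1 ≤ p)] :
    W0 Ω p →L[ℝ] Lp (EuclideanSpace ℝ (Fin d)) p (volume.restrict Ω) :=
  (ContinuousLinearMap.snd ℝ _ _).comp (W0 Ω p).subtypeL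

theorem coeFn_valL {p : ℝ≥0∞} [Fact (1 ≤ p)] (w : W0 Ω p) : (valL Ω p w : _ → ℝ) = fn w := rfl

theorem coeFn_gradL {p : ℝ≥0∞} [Fact (1 ≤ p)] (w : W0 Ω p) :
    (gradL Ω p w : _ → EuclideanSpace ℝ (Fin d)) = grad w := rfl

theorem norm_W0 {p : ℝ≥0∞} [Fact (1 ≤ p)] (w : W0 Ω p) :
    ‖w‖ = max ‖valL Ω p w‖ ‖gradL Ω p w‖ := rfl

section Operators

variable [IsFiniteMeasure (volume.restrict Ω)]

/-- The embedding of `W_0^{1,q+1}(Ω)` into `L_2(Ω)`. -/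
def toH (Ω : Set (EuclideanSpace ℝ (Fin d))) (q : ℝ) [Fact (1 ≤ q)]
    [IsFiniteMeasure (volume.restrict Ω)] : W0 Ω (expo q) →L[ℝ] Lp ℝ 2 (volume.restrict Ω) :=
  (lpIncl 2 (two_le_expo q)).comp (valL Ω (expo q))

/-- The weak gradient with values in `L_2(Ω)`. -/
def toG (Ω : Set (EuclideanSpace ℝ (Fin d))) (q : ℝ) [Fact (1 ≤ q)]
    [IsFiniteMeasure (volume.restrict Ω)] :
    W0 Ω (expo q) →L[ℝ] Lp (EuclideanSpace ℝ (Fin d)) 2 (volume.restrict Ω) :=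
  (lpIncl 2 (two_le_expo q)).comp (gradL Ω (expo q))

theorem coeFn_toH (w : W0 Ω (expo q)) : toH Ω q w =ᵐ[volume.restrict Ω] fn w :=
  coeFn_lpIncl (two_le_expo q) (valL Ω (expo q) w)

theorem coeFn_toG (w : W0 Ω (expo q)) : toG Ω q w =ᵐ[volume.restrict Ω] grad w :=
  coeFn_lpIncl (two_le_expo q) (gradL Ω (expo q) w)

theorem eLpNorm_grad_two (w : W0 Ω (expo q)) :
    eLpNorm (grad w) 2 (volume.restrict Ω) = ENNReal.ofReal ‖toG Ω q w‖ := by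
  rw [← eLpNorm_congr_ae (coeFn_toG w), eLpNorm_eq_ofReal_norm]

theorem eLpNorm_grad_expo (w : W0 Ω (expo q)) :
    eLpNorm (grad w) (expo q) (volume.restrict Ω) = ENNReal.ofReal ‖gradL Ω (expo q) w‖ := by
  rw [← coeFn_gradL, eLpNorm_eq_ofReal_norm]

theorem eLpNorm_fn_two (w : W0 Ω (expo q)) :
    eLpNorm (fn w) 2 (volume.restrict Ω) = ENNReal.ofReal ‖toH Ω q w‖ := by
  rw [← eLpNorm_congr_ae (coeFn_toH w), eLpNorm_eq_ofReal_norm]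

namespace Embeds

variable {C₀ C₄ : ℝ≥0}

theorem memLp_top (h : Embeds Ω q C₀ C₄) (w : W0 Ω (expo q)) :
    MemLp (fn w) ⊤ (volume.restrict Ω) :=
  ⟨Lp.aestronglyMeasurable w.1.1, (h.sup w).trans_lt
    (ENNReal.mul_lt_top ENNReal.coe_lt_top (Lp.eLpNorm_lt_top w.1.2))⟩

theorem memLp_four (h : Embeds Ω q C₀ C₄) (w : W0 Ω (expo q)) :
    MemLp (fn w) 4 (volume.restrict Ω) :=
  (h.memLp_top w).mono_exponent le_top

theorem toReal_eLpNorm_four_le (h : Embeds Ω q C₀ C₄) (w : W0 Ω (expo q)) :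
    (eLpNorm (fn w) 4 (volume.restrict Ω)).toReal ≤ C₄ * ‖toG Ω q w‖ := by
  refine ENNReal.toReal_le_of_le_ofReal (by positivity) ?_
  rw [ENNReal.ofReal_mul (NNReal.coe_nonneg C₄), ← eLpNorm_grad_two, ENNReal.ofReal_coe_nnreal]
  exact h.four w

/-- The embedding of `W_0^{1,q+1}(Ω)` into `L_∞(Ω)`. -/
def toTop (h : Embeds Ω q C₀ C₄) : W0 Ω (expo q) →L[ℝ] Lp ℝ ⊤ (volume.restrict Ω) :=
  LinearMap.mkContinuous
    { toFun := fun w => (h.memLp_top w).toLp (fn w)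
      map_add' := fun w w' => (MemLp.toLp_congr (h.memLp_top (w + w'))
        ((h.memLp_top w).add (h.memLp_top w')) (fn_add w w')).trans (MemLp.toLp_add _ _)
      map_smul' := fun c w => (MemLp.toLp_congr (h.memLp_top (c • w))
        ((h.memLp_top w).const_smul c) (fn_smul c w)).trans (MemLp.toLp_const_smul c _) }
    C₀ fun w => by
      change ‖(h.memLp_top w).toLp (fn w)‖ ≤ _
      rw [Lp.norm_toLp]
      refine ENNReal.toReal_le_of_le_ofReal (by positivity) ?_
      refine (h.sup w).trans ?_
      rw [ENNReal.ofReal_mul (NNReal.coe_nonneg C₀), eLpNorm_grad_expo, ENNReal.ofReal_coe_nnreal]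
      gcongr
      rw [norm_W0]
      exact le_max_right _ _

theorem coeFn_toTop (h : Embeds Ω q C₀ C₄) (w : W0 Ω (expo q)) :
    h.toTop w =ᵐ[volume.restrict Ω] fn w := MemLp.coeFn_toLp (h.memLp_top w)

theorem norm_toTop_le (h : Embeds Ω q C₀ C₄) (w : W0 Ω (expo q)) :
    ‖h.toTop w‖ ≤ C₀ * ‖gradL Ω (expo q) w‖ := by
  change ‖(h.memLp_top w).toLp (fn w)‖ ≤ _
  rw [Lp.norm_toLp]
  refine ENNReal.toReal_le_of_le_ofReal (by positivity) ?_
  refine (h.sup w).trans_eq ?_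
  rw [ENNReal.ofReal_mul (NNReal.coe_nonneg C₀), eLpNorm_grad_expo, ENNReal.ofReal_coe_nnreal]

end Embeds

end Operators

end Westervelt

end

noncomputable section

namespace Westervelt

open Filter Topology

variable {d : ℕ} {Ω : Set (EuclideanSpace ℝ (Fin d))} {q : ℝ} [hq : Fact (1 ≤ q)]

theorem inv_four_add_inv_four : (4 : ℝ≥0∞)⁻¹ + 4⁻¹ = 2⁻¹ := by
  rw [← ENNReal.toReal_eq_toReal_iff' (by simp) (by simp), ENNReal.toReal_add (by simp) (by simp)]
  norm_num

theorem exists_mul_four {α : Type*} [MeasurableSpace α] {μ : Measure α} {f g : α → ℝ}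
    (hf : MemLp f 4 μ) (hg : MemLp g 4 μ) :
    ∃ P : Lp ℝ 2 μ, (P =ᵐ[μ] fun x => f x * g x) ∧
      ‖P‖ ≤ (eLpNorm f 4 μ).toReal * (eLpNorm g 4 μ).toReal := by
  have : ENNReal.HolderTriple 4 4 2 := ⟨inv_four_add_inv_four⟩
  have hm : MemLp (fun x => f x * g x) 2 μ := hg.mul' hf
  refine ⟨hm.toLp _, hm.coeFn_toLp, ?_⟩
  rw [Lp.norm_toLp, ← ENNReal.toReal_mul]
  refine ENNReal.toReal_mono (ENNReal.mul_ne_top hf.2.ne hg.2.ne) ?_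
  have h := eLpNorm_smul_le_mul_eLpNorm (p := 4) (q := 4) (r := 2) hg.1 hf.1
  exact h

theorem abs_two_mul_inner_le {E : Type*} [NormedAddCommGroup E] [InnerProductSpace ℝ E] (f P : E)
    {k C x y x' y' : ℝ} (hP : ‖P‖ ≤ x' * y') (hx : x' ≤ C * x) (hy : y' ≤ C * y) (hy' : 0 ≤ y')
    (hCx : 0 ≤ C * x) : |2 * k * inner ℝ f P| ≤ 2 * |k| * C ^ 2 * ‖f‖ * x * y := by
  rw [abs_mul, abs_mul, abs_two]
  calc 2 * |k| * |inner ℝ f P| ≤ 2 * |k| * (‖f‖ * ((C * x) * (C * y))) := by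
        gcongr
        exact (abs_real_inner_le_norm f P).trans (mul_le_mul_of_nonneg_left
          (hP.trans (mul_le_mul hx hy hy' hCx)) (norm_nonneg f))
    _ = _ := by ring

theorem mono_aux {β γ q P n m F₁ F₂ D I₁ I₂ : ℝ} (hγ : 0 ≤ γ) (hP : 0 < P) (hq : 1 ≤ q)
    (hn : 0 ≤ n) (hm : 0 ≤ m) (hnm : n ≤ P * m) (hF : 2 ^ (-q) * m ^ (q + 1) ≤ F₁ - F₂)
    (hD : D ^ 2 = I₁ - I₂) :
    β * D ^ 2 + γ * 2 ^ (-q) / P ^ (q + 1) * n ^ (q + 1)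
      ≤ β * I₁ + γ * F₁ - (β * I₂ + γ * F₂) := by
  have h3 : n ^ (q + 1) ≤ P ^ (q + 1) * m ^ (q + 1) := by
    rw [← Real.mul_rpow hP.le hm]
    exact Real.rpow_le_rpow hn hnm (by linarith)
  have h4 : γ * 2 ^ (-q) / P ^ (q + 1) * n ^ (q + 1) ≤ γ * (2 ^ (-q) * m ^ (q + 1)) := by
    calc _ ≤ γ * 2 ^ (-q) / P ^ (q + 1) * (P ^ (q + 1) * m ^ (q + 1)) := by gcongr
      _ = _ := by
          have : P ^ (q + 1) ≠ 0 := by positivity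
          field_simp
  have h5 := mul_le_mul_of_nonneg_left hF hγ
  rw [hD]
  linarith

section Flux

variable {V H G L : Type*} [NormedAddCommGroup V] [NormedSpace ℝ V]
    [NormedAddCommGroup H] [InnerProductSpace ℝ H]
    [NormedAddCommGroup G] [InnerProductSpace ℝ G] [NormedAddCommGroup L] [NormedSpace ℝ L]
    {ι : V →L[ℝ] H} {D : V →L[ℝ] G} {B : V →L[ℝ] H →L[ℝ] H} {g : V →L[ℝ] L} {N : L → L →L[ℝ] ℝ}
    {q P C₁ C₂ c2 b δ : ℝ}

/-- A damping operator with a linear part, acting on `D`, and a monotone part `N`, acting on `g`. -/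
def damping (D : V →L[ℝ] G) (g : V →L[ℝ] L) (N : L → L →L[ℝ] ℝ) (b δ : ℝ) (x : V) : V →L[ℝ] ℝ :=
  (b * (1 - δ)) • (innerSL ℝ (D x)).comp D + (b * δ) • (N (g x)).comp g

theorem damping_apply (x w : V) : damping D g N b δ x w
    = b * (1 - δ) * inner ℝ (D x) (D w) + b * δ * N (g x) (g w) := rfl

/-- The damped wave equation whose damping consists of a linear part and a part with polynomial
growth. -/
def DampedWave.ofFlux (hq : 1 ≤ q) (hP : 0 < P) (hc : 0 < c2) (hb : 0 < b) (hδ : 0 < δ)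
    (hδ' : 0 < 1 - δ) (hC₁ : 0 ≤ C₁) (hC₂ : 0 ≤ C₂) (hι : Function.Injective ι)
    (hBs : ∀ u h h', inner ℝ (B u h) h' = inner ℝ h (B u h'))
    (hBc : ∀ u w, B u (ι w) = B w (ι u))
    (hBb : ∀ u h w, |inner ℝ (B u h) (ι w)| ≤ C₁ * ‖h‖ * ‖D u‖ * ‖D w‖)
    (hιD : ∀ w, ‖ι w‖ ≤ C₂ * ‖D w‖) (hg : ∀ w, ‖w‖ ≤ P * ‖g w‖)
    (hN1 : ∀ x y, 1 / (q + 1) * ‖x‖ ^ (q + 1) + N x (y - x) ≤ 1 / (q + 1) * ‖y‖ ^ (q + 1))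
    (hN2 : ∀ x y, 2 ^ (-q) * ‖y - x‖ ^ (q + 1) ≤ (N y - N x) (y - x)) (hN0 : N 0 = 0)
    (hNb : ∀ x, ‖N x‖ ≤ ‖x‖ ^ (q + 1) + 1)
    (hNc : ∀ x w, Tendsto (fun s : ℝ => N (x + s • w) w) (𝓝 0) (𝓝 (N x w))) :
    DampedWave V H G where
  ι := ι
  D := D
  B := B
  Φ x := b * (1 - δ) / 2 * ‖D x‖ ^ 2 + b * δ * (1 / (q + 1) * ‖g x‖ ^ (q + 1))
  A := damping D g N b δ
  p := q + 1
  β := b * (1 - δ)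
  γ := b * δ * 2 ^ (-q) / P ^ (q + 1)
  c2 := c2
  C₁ := C₁
  C₂ := C₂
  one_lt_p := by linarith
  β_pos := by positivity
  γ_pos := by positivity
  c2_pos := hc
  C₁_nonneg := hC₁
  C₂_nonneg := hC₂
  ι_inj := hι
  B_symm := hBs
  B_comm := hBc
  B_bound := hBb
  ι_le := hιD
  Φ_sub x y := by
    rw [damping_apply, map_sub, map_sub]
    have h1 := mul_le_mul_of_nonneg_left (hN1 (g x) (g y)) (mul_pos hb hδ).le
    have h2 : ‖D x‖ ^ 2 + 2 * inner ℝ (D x) (D y - D x) ≤ ‖D y‖ ^ 2 := by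
      have h3 := norm_add_sq_real (D x) (D y - D x)
      rw [add_sub_cancel] at h3
      linarith [sq_nonneg ‖D y - D x‖]
    have h4 := mul_le_mul_of_nonneg_left h2 (mul_pos hb hδ').le
    linarith
  A_mono x y := by
    have h1 := hN2 (g x) (g y)
    have h2 := hg (y - x)
    rw [map_sub] at h2
    rw [sub_apply] at h1
    rw [sub_apply, damping_apply, damping_apply, map_sub, map_sub]
    exact mono_aux (mul_pos hb hδ).le hP hq (norm_nonneg _) (norm_nonneg _) h2 h1
      (by rw [← inner_sub_left, real_inner_self_eq_norm_sq])
  Φ_zero := by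
    have : q + 1 ≠ 0 := by linarith
    simp [Real.zero_rpow this]
  A_zero := by
    ext w
    rw [damping_apply, map_zero, map_zero, inner_zero_left, hN0]
    simp
  A_bdd R := by
    refine ⟨b * (1 - δ) * (‖D‖ * R * ‖D‖) + b * δ * (((‖g‖ * R) ^ (q + 1) + 1) * ‖g‖),
      fun x hx => ?_⟩
    have hR : 0 ≤ R := (norm_nonneg _).trans hx
    unfold damping
    refine (norm_add_le _ _).trans ?_
    rw [norm_smul, norm_smul, Real.norm_of_nonneg (mul_pos hb hδ').le,
      Real.norm_of_nonneg (mul_pos hb hδ).le]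
    gcongr
    · refine (ContinuousLinearMap.opNorm_comp_le _ _).trans ?_
      rw [innerSL_apply_norm]
      gcongr
      exact D.le_of_opNorm_le_of_le le_rfl hx
    · refine (ContinuousLinearMap.opNorm_comp_le _ _).trans ?_
      gcongr
      refine (hNb _).trans ?_
      gcongr
      exact g.le_of_opNorm_le_of_le le_rfl hx
  A_hemi x w := by
    simp only [damping_apply, map_add, map_smul]
    refine Tendsto.add ?_ ((hNc _ _).const_mul _)
    have hcont : Continuous fun s : ℝ => b * (1 - δ) * inner ℝ (D x + s • D w) (D w) := by fun_prop
    have := hcont.tendsto 0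
    rwa [zero_smul, add_zero] at this

end Flux

section Operators

variable [IsFiniteMeasure (volume.restrict Ω)]

namespace Embeds

variable {C₀ C₄ : ℝ≥0}

/-- The constant of the Poincaré inequality in `W_0^{1,q+1}(Ω)`. -/
def poincare (_ : Embeds Ω q C₀ C₄) : ℝ :=
  1 + (volume.restrict Ω univ ^ (1 / (q + 1))).toReal * C₀

theorem poincare_pos (h : Embeds Ω q C₀ C₄) : 0 < h.poincare := by
  unfold poincare; positivity

theorem norm_valL_le (h : Embeds Ω q C₀ C₄) (w : W0 Ω (expo q)) :
    ‖valL Ω (expo q) w‖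
      ≤ (volume.restrict Ω univ ^ (1 / (q + 1))).toReal * C₀ * ‖gradL Ω (expo q) w‖ := by
  have hq1 := hq.out
  have h1 := eLpNorm_le_eLpNorm_mul_rpow_measure_univ (p := expo q) (q := ⊤) le_top
    (h.memLp_top w).1
  rw [toReal_expo, ENNReal.toReal_top, div_zero, sub_zero] at h1
  have h2 : volume.restrict Ω univ ^ (1 / (q + 1)) ≠ ⊤ :=
    ENNReal.rpow_ne_top_of_nonneg (by positivity) (measure_ne_top _ _)
  have h3 := h1.trans (mul_le_mul_left (h.sup w) _)
  rw [eLpNorm_grad_expo, ← ENNReal.ofReal_toReal h2, ← ENNReal.ofReal_coe_nnreal,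
    ← ENNReal.ofReal_mul (NNReal.coe_nonneg C₀), ← ENNReal.ofReal_mul (by positivity),
    ← coeFn_valL, eLpNorm_eq_ofReal_norm, ENNReal.ofReal_le_ofReal_iff (by positivity)] at h3
  linarith

theorem norm_le_poincare (h : Embeds Ω q C₀ C₄) (w : W0 Ω (expo q)) :
    ‖w‖ ≤ h.poincare * ‖gradL Ω (expo q) w‖ := by
  have h1 := h.norm_valL_le w
  have h2 := norm_nonneg (gradL Ω (expo q) w)
  have h3 := norm_nonneg (valL Ω (expo q) w)
  have e : h.poincare * ‖gradL Ω (expo q) w‖ = ‖gradL Ω (expo q) w‖ +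
      (volume.restrict Ω univ ^ (1 / (q + 1))).toReal * C₀ * ‖gradL Ω (expo q) w‖ := by
    unfold poincare; ring
  rw [norm_W0, e]
  exact max_le (by linarith) (by linarith)

/-- Multiplication by `2 k u`. -/
def mulOp (h : Embeds Ω q C₀ C₄) (k : ℝ) :
    W0 Ω (expo q) →L[ℝ] Lp ℝ 2 (volume.restrict Ω) →L[ℝ] Lp ℝ 2 (volume.restrict Ω) :=
  (2 * k) • ((ContinuousLinearMap.mul ℝ ℝ).holderL (volume.restrict Ω) ⊤ 2 2).comp h.toTop

theorem coeFn_mulOp (h : Embeds Ω q C₀ C₄) (k : ℝ) (u : W0 Ω (expo q))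
    (f : Lp ℝ 2 (volume.restrict Ω)) :
    h.mulOp k u f =ᵐ[volume.restrict Ω] fun x => 2 * k * (fn u x * f x) := by
  have e : h.mulOp k u f
      = (2 * k) • (ContinuousLinearMap.mul ℝ ℝ).holder 2 (h.toTop u) f := rfl
  rw [e]
  filter_upwards [Lp.coeFn_smul (2 * k) ((ContinuousLinearMap.mul ℝ ℝ).holder 2 (h.toTop u) f),
    (ContinuousLinearMap.mul ℝ ℝ).coeFn_holder (r := 2) (h.toTop u) f, h.coeFn_toTop u]
    with x h1 h2 h3
  rw [h1, Pi.smul_apply, h2, h3, smul_eq_mul, ContinuousLinearMap.mul_apply']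

theorem inner_mulOp (h : Embeds Ω q C₀ C₄) (k : ℝ) (u : W0 Ω (expo q))
    (f g : Lp ℝ 2 (volume.restrict Ω)) :
    inner ℝ (h.mulOp k u f) g = ∫ x in Ω, 2 * k * fn u x * f x * g x := by
  rw [L2.inner_def]
  refine integral_congr_ae ?_
  filter_upwards [h.coeFn_mulOp k u f] with x hx
  rw [hx, real_inner_eq_mul]
  ring

theorem mulOp_comm (h : Embeds Ω q C₀ C₄) (k : ℝ) (u w : W0 Ω (expo q)) :
    h.mulOp k u (toH Ω q w) = h.mulOp k w (toH Ω q u) := by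
  have h1 := h.coeFn_mulOp k u (toH Ω q w)
  have h2 := h.coeFn_mulOp k w (toH Ω q u)
  refine Lp.ext (h1.trans (EventuallyEq.trans ?_ h2.symm))
  filter_upwards [coeFn_toH u, coeFn_toH w] with x h3 h4
  rw [h3, h4]
  ring

theorem mulOp_symm (h : Embeds Ω q C₀ C₄) (k : ℝ) (u : W0 Ω (expo q))
    (f g : Lp ℝ 2 (volume.restrict Ω)) :
    inner ℝ (h.mulOp k u f) g = inner ℝ f (h.mulOp k u g) := by
  rw [real_inner_comm (h.mulOp k u g), h.inner_mulOp, h.inner_mulOp]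
  congr 1
  ext x
  ring

theorem inner_mulOp_toH (h : Embeds Ω q C₀ C₄) (k : ℝ) (u : W0 Ω (expo q))
    (f : Lp ℝ 2 (volume.restrict Ω)) (w : W0 Ω (expo q)) {P : Lp ℝ 2 (volume.restrict Ω)}
    (hP : P =ᵐ[volume.restrict Ω] fun x => fn u x * fn w x) :
    inner ℝ (h.mulOp k u f) (toH Ω q w) = 2 * k * inner ℝ f P := by
  rw [h.inner_mulOp, L2.inner_def, ← integral_const_mul]
  refine integral_congr_ae ?_
  filter_upwards [coeFn_toH w, hP] with x h1 h2
  rw [h1, h2, real_inner_eq_mul]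
  ring

theorem abs_inner_mulOp_le (h : Embeds Ω q C₀ C₄) (k : ℝ) (u : W0 Ω (expo q))
    (f : Lp ℝ 2 (volume.restrict Ω)) (w : W0 Ω (expo q)) :
    |inner ℝ (h.mulOp k u f) (toH Ω q w)|
      ≤ 2 * |k| * C₄ ^ 2 * ‖f‖ * ‖toG Ω q u‖ * ‖toG Ω q w‖ := by
  obtain ⟨P, hP, hP'⟩ := exists_mul_four (h.memLp_four u) (h.memLp_four w)
  exact (congrArg abs (h.inner_mulOp_toH k u f w hP)).trans_le
    (abs_two_mul_inner_le f P hP' (h.toReal_eLpNorm_four_le u) (h.toReal_eLpNorm_four_le w)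
      ENNReal.toReal_nonneg (mul_nonneg (NNReal.coe_nonneg C₄) (norm_nonneg _)))

theorem norm_toH_le (h : Embeds Ω q C₀ C₄) (w : W0 Ω (expo q)) :
    ‖toH Ω q w‖ ≤ (volume.restrict Ω univ ^ (1 / 2 - 1 / 4 : ℝ)).toReal * C₄ * ‖toG Ω q w‖ := by
  have h1 := eLpNorm_le_eLpNorm_mul_rpow_measure_univ (p := 2) (q := 4) (by norm_num)
    (h.memLp_four w).1
  have h2 : volume.restrict Ω univ ^ (1 / 2 - 1 / 4 : ℝ) ≠ ⊤ :=
    ENNReal.rpow_ne_top_of_nonneg (by norm_num) (measure_ne_top _ _)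
  rw [eLpNorm_fn_two, ENNReal.toReal_ofNat, ENNReal.toReal_ofNat] at h1
  have h3 := h1.trans (mul_le_mul_left (h.four w) _)
  rw [eLpNorm_grad_two, ← ENNReal.ofReal_toReal h2, ← ENNReal.ofReal_coe_nnreal,
    ← ENNReal.ofReal_mul (NNReal.coe_nonneg C₄), ← ENNReal.ofReal_mul (by positivity)] at h3
  rw [ENNReal.ofReal_le_ofReal_iff (by positivity)] at h3
  linarith

theorem toH_injective (h : Embeds Ω q C₀ C₄) : Function.Injective (toH Ω q) := by
  rw [injective_iff_map_eq_zero]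
  intro w hw
  have h1 : w.1.1 = 0 := by
    rw [Lp.eq_zero_iff_ae_eq_zero] at hw ⊢
    exact (coeFn_toH w).symm.trans hw
  have h2 := grad_eq_zero h.isOpen (two_le_expo q) h1
  exact Subtype.ext (Prod.ext h1 h2)

/-- The Westervelt equation with nonlinear strong damping as an abstract damped wave equation. -/
def system (h : Embeds Ω q C₀ C₄) {c b δ : ℝ} (k : ℝ) (hc : 0 < c ^ 2) (hb : 0 < b) (hδ : 0 < δ)
    (hδ' : 0 < 1 - δ) :
    DampedWave (W0 Ω (expo q)) (Lp ℝ 2 (volume.restrict Ω))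
      (Lp (EuclideanSpace ℝ (Fin d)) 2 (volume.restrict Ω)) :=
  DampedWave.ofFlux (ι := toH Ω q) (D := toG Ω q) (B := h.mulOp k) (g := gradL Ω (expo q))
    (N := powFluxL) (q := q) (P := h.poincare) (C₁ := 2 * |k| * C₄ ^ 2)
    (C₂ := (volume.restrict Ω univ ^ (1 / 2 - 1 / 4 : ℝ)).toReal * C₄) (c2 := c ^ 2)
    (b := b) (δ := δ)
    hq.out h.poincare_pos hc hb hδ hδ' (by positivity) (by positivity) h.toH_injective
    (h.mulOp_symm k) (h.mulOp_comm k) (h.abs_inner_mulOp_le k) h.norm_toH_le h.norm_le_poincare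
    powFluxL_sub_le le_powFluxL_sub powFluxL_zero norm_powFluxL_le tendsto_powFluxL

end Embeds

end Operators

end Westervelt

end

noncomputable section

namespace Westervelt

open Filter Topology

section TimeDerivatives

variable {E : Type*} [NormedAddCommGroup E] [NormedSpace ℝ E] [CompleteSpace E]

theorem IsPrim.hasDerivWithinAt {T : ℝ} (hT : 0 < T) {X x : ℝ → E} (h : IsPrim T X x)
    (hx : ContinuousOn x (Icc 0 T)) {t : ℝ} (ht : t ∈ Icc 0 T) :
    HasDerivWithinAt X (x t) (Icc 0 T) t := by
  set y : ℝ → E := IccExtend hT.le ((Icc 0 T).domRestrict x)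
  have hy : Continuous y := (continuousOn_iff_continuous_domRestrict.1 hx).Icc_extend'
  have hyx : ∀ s ∈ Icc 0 T, y s = x s := fun s hs => IccExtend_of_mem hT.le _ hs
  have h1 := ((intervalIntegral.integral_hasDerivAt_right (hy.intervalIntegrable 0 t)
    (hy.stronglyMeasurableAtFilter _ _) hy.continuousAt).const_add (X 0)).hasDerivWithinAt
    (s := Icc 0 T)
  rw [hyx t ht] at h1
  have e : ∀ s ∈ Icc 0 T, X s = X 0 + ∫ r in (0 : ℝ)..s, y r := by
    intro s hs
    rw [h.eq s hs]
    congr 1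
    refine intervalIntegral.integral_congr fun r hr => ?_
    rw [uIcc_of_le hs.1] at hr
    exact (hyx r ⟨hr.1, hr.2.trans hs.2⟩).symm
  exact h1.congr e (e t ht)

theorem IsPrim.dt_eq {T : ℝ} (hT : 0 < T) {X x : ℝ → E} (h : IsPrim T X x)
    (hx : ContinuousOn x (Icc 0 T)) {t : ℝ} (ht : t ∈ Icc 0 T) : dt T X t = x t :=
  (h.hasDerivWithinAt hT hx ht).derivWithin (uniqueDiffOn_Icc hT t ht)

theorem IsPrim.contDiffOn {T : ℝ} (hT : 0 < T) {X x : ℝ → E} (h : IsPrim T X x)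
    (hx : ContinuousOn x (Icc 0 T)) : ContDiffOn ℝ 1 X (Icc 0 T) := by
  rw [contDiffOn_one_iff_derivWithin (uniqueDiffOn_Icc hT)]
  exact ⟨fun t ht => (h.hasDerivWithinAt hT hx ht).differentiableWithinAt,
    hx.congr fun t ht => h.dt_eq hT hx ht⟩

theorem isPrim_dt {T : ℝ} (hT : 0 < T) {X : ℝ → E} (h : ContDiffOn ℝ 1 X (Icc 0 T)) :
    ContinuousOn (dt T X) (Icc 0 T) ∧ IsPrim T X (dt T X) := by
  rw [contDiffOn_one_iff_derivWithin (uniqueDiffOn_Icc hT)] at h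
  have hc : ContinuousOn (dt T X) (Icc 0 T) := h.2
  have hi : IntervalIntegrable (dt T X) volume 0 T :=
    ContinuousOn.intervalIntegrable (by rwa [uIcc_of_le hT.le])
  refine ⟨hc, hi, fun t ht => ?_⟩
  have h1 := intervalIntegral.integral_eq_sub_of_hasDeriv_right_of_le ht.1 (f := X)
    (f' := dt T X) (h.1.continuousOn.mono (Icc_subset_Icc_right ht.2)) (fun s hs => by
      have hs' : s ∈ Icc 0 T := ⟨hs.1.le, hs.2.le.trans ht.2⟩
      have h2 : HasDerivWithinAt X (dt T X s) (Icc 0 T) s := (h.1 s hs').hasDerivWithinAt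
      exact (h2.hasDerivAt (Icc_mem_nhds hs.1 (hs.2.trans_le ht.2))).hasDerivWithinAt)
    (hi.mono_set (by rw [uIcc_of_le ht.1, uIcc_of_le hT.le]; exact Icc_subset_Icc_right ht.2))
  rw [h1]
  abel

theorem IsPrim.clm_comp {F : Type*} [NormedAddCommGroup F] [NormedSpace ℝ F] [CompleteSpace F]
    {T : ℝ} {X x : ℝ → E} (h : IsPrim T X x) (L : E →L[ℝ] F) :
    IsPrim T (fun t => L (X t)) (fun t => L (x t)) := by
  refine ⟨⟨L.integrable_comp h.int.1, L.integrable_comp h.int.2⟩, fun t ht => ?_⟩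
  have h0 : (0 : ℝ) ∈ Icc 0 T := ⟨le_rfl, ht.1.trans ht.2⟩
  rw [L.intervalIntegral_comp_comm (h.intervalIntegrable h0 ht), h.eq t ht, map_add]

theorem setIntegral_Ioo_eq {T : ℝ} (hT : 0 ≤ T) (f : ℝ → E) :
    ∫ t in Ioo 0 T, f t = ∫ t in (0 : ℝ)..T, f t := by
  rw [intervalIntegral.integral_of_le hT, integral_Ioc_eq_integral_Ioo]

theorem test_endpoints {T : ℝ} {φ : ℝ → ℝ} (hs : tsupport φ ⊆ Ioo 0 T) : φ 0 = 0 ∧ φ T = 0 :=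
  ⟨image_eq_zero_of_notMem_tsupport fun h => (hs h).1.false,
    image_eq_zero_of_notMem_tsupport fun h => (hs h).2.false⟩

theorem integrable_smul_test {T : ℝ} {φ : ℝ → ℝ} (hφ : Continuous φ) {f : ℝ → E}
    (hf : IntegrableOn f (Ioo 0 T)) : IntegrableOn (fun t => φ t • f t) (Ioo 0 T) := by
  obtain ⟨C, hC⟩ := (isCompact_Icc (a := 0) (b := T)).exists_bound_of_continuousOn hφ.continuousOn
  refine hf.bdd_smul C hφ.aestronglyMeasurable ?_
  exact (ae_restrict_iff' measurableSet_Ioo).2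
    (Eventually.of_forall fun t ht => hC t (Ioo_subset_Icc_self ht))

theorem IsPrim.isWeakTimeDeriv {H : Type*} [NormedAddCommGroup H] [InnerProductSpace ℝ H]
    [CompleteSpace H] {T : ℝ} (hT : 0 < T) {X x : ℝ → H} (h : IsPrim T X x) :
    IsWeakTimeDeriv T X x := by
  intro φ hφ _ hs
  have hφ1 : ContDiff ℝ 1 φ := hφ.of_le (by exact_mod_cast le_top)
  have hφ' : Continuous (deriv φ) := hφ1.continuous_deriv le_rfl
  have hXi : IntegrableOn X (Ioo 0 T) :=
    ((h.continuousOn hT.le).integrableOn_Icc).mono_set Ioo_subset_Icc_self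
  have hxi : IntegrableOn x (Ioo 0 T) := by
    have := h.int
    rw [intervalIntegrable_iff_integrableOn_Ioo_of_le hT.le] at this
    exact this
  have i1 := integrable_smul_test hφ' hXi
  have i2 := integrable_smul_test hφ.continuous hxi
  refine eq_neg_of_add_eq_zero_left ?_
  rw [← integral_add i1 i2]
  refine ext_inner_left ℝ fun y => ?_
  have i3 : Integrable (fun t => deriv φ t • X t + φ t • x t) (volume.restrict (Ioo 0 T)) :=
    i1.add i2
  rw [← integral_inner i3, inner_zero_right, setIntegral_Ioo_eq hT.le]
  have hp : IsPrim T φ (deriv φ) :=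
    ⟨hφ'.intervalIntegrable _ _, fun t _ => by
      rw [intervalIntegral.integral_deriv_eq_sub (fun s _ => (hφ1.differentiable one_ne_zero) s)
        (hφ'.intervalIntegrable _ _)]; ring⟩
  have hΨ : ContDiff ℝ 1 fun z : ℝ × H => z.1 * inner ℝ y z.2 :=
    contDiff_fst.mul ((contDiff_const (c := y)).inner ℝ contDiff_snd)
  have h1 := ((hp.prodMk h).absolutelyContinuous_comp hT.le hΨ).integral_deriv_eq_sub
  simp only [(test_endpoints hs).1, (test_endpoints hs).2, zero_mul, sub_zero] at h1
  refine Eq.trans (intervalIntegral.integral_congr_ae ?_) h1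
  have hne : ∀ᵐ t : ℝ, t ≠ T := by simp [ae_iff]
  filter_upwards [h.ae_hasDerivAt, hne] with t ht htT htm
  rw [uIoc_of_le hT.le] at htm
  have hd := ht ⟨htm.1, lt_of_le_of_ne htm.2 htT⟩
  have hd1 : HasDerivAt φ (deriv φ t) t := ((hφ1.differentiable one_ne_zero) t).hasDerivAt
  have hd2 := hd1.mul ((hasDerivAt_const t y).inner ℝ hd)
  rw [show (fun t => φ t * inner ℝ y (X t)) = φ * fun t => inner ℝ y (X t) from rfl, hd2.deriv]
  simp only [inner_add_right, inner_smul_right, inner_zero_left, add_zero]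

theorem ae_eq_of_forall_test {T : ℝ} {f g : ℝ → E} (hf : IntegrableOn f (Ioo 0 T))
    (hg : IntegrableOn g (Ioo 0 T))
    (h : ∀ φ : ℝ → ℝ, ContDiff ℝ ∞ φ → HasCompactSupport φ → tsupport φ ⊆ Ioo 0 T →
      ∫ t in Ioo 0 T, φ t • f t = ∫ t in Ioo 0 T, φ t • g t) :
    ∀ᵐ t, t ∈ Ioo 0 T → f t = g t := by
  have h1 := isOpen_Ioo.ae_eq_zero_of_integral_contDiff_smul_eq_zero (μ := volume) (U := Ioo 0 T)
    (f := fun t => f t - g t) (hf.sub hg).locallyIntegrableOn (fun φ h1 h2 h3 => by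
      rw [← setIntegral_eq_integral_of_forall_compl_eq_zero (s := Ioo 0 T)]
      · simp only [smul_sub]
        rw [integral_sub (integrable_smul_test h1.continuous hf)
          (integrable_smul_test h1.continuous hg), h φ h1 h2 h3, sub_self]
      · intro t ht
        rw [image_eq_zero_of_notMem_tsupport (fun hm => ht (h3 hm)), zero_smul])
  filter_upwards [h1] with t ht htm
  exact sub_eq_zero.1 (ht htm)

theorem IsWeakTimeDeriv.ae_unique {T : ℝ} {f g g' : ℝ → E} (h : IsWeakTimeDeriv T f g)
    (h' : IsWeakTimeDeriv T f g') (hg : IntegrableOn g (Ioo 0 T))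
    (hg' : IntegrableOn g' (Ioo 0 T)) : ∀ᵐ t, t ∈ Ioo 0 T → g t = g' t :=
  ae_eq_of_forall_test hg hg' fun φ h1 h2 h3 =>
    neg_injective ((h φ h1 h2 h3).symm.trans (h' φ h1 h2 h3))

/-- A test function of mean zero is the derivative of a test function. -/
theorem exists_test_primitive {T : ℝ} (hT : 0 < T) {η : ℝ → ℝ} (hη : ContDiff ℝ ∞ η)
    (hc : HasCompactSupport η) (hs : tsupport η ⊆ Ioo 0 T) (h0 : ∫ t in Ioo 0 T, η t = 0) :
    ∃ φ : ℝ → ℝ, ContDiff ℝ ∞ φ ∧ HasCompactSupport φ ∧ tsupport φ ⊆ Ioo 0 T ∧ deriv φ = η := by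
  set φ : ℝ → ℝ := fun t => ∫ s in (0 : ℝ)..t, η s
  have hd : ∀ t, HasDerivAt φ (η t) t := fun t =>
    intervalIntegral.integral_hasDerivAt_right (hη.continuous.intervalIntegrable _ _)
      (hη.continuous.stronglyMeasurableAtFilter _ _) hη.continuous.continuousAt
  have hder : deriv φ = η := funext fun t => (hd t).deriv
  have hφ : ContDiff ℝ ∞ φ := by
    rw [contDiff_infty_iff_deriv]
    exact ⟨fun t => (hd t).differentiableAt, by rwa [hder]⟩
  obtain ⟨α, β, hα, hβ, hsub⟩ : ∃ α β, 0 < α ∧ β < T ∧ tsupport η ⊆ Icc α β := by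
    by_cases hne : (tsupport η).Nonempty
    · obtain ⟨α, hα, hαl⟩ := hc.isCompact.exists_isLeast hne
      obtain ⟨β, hβ, hβl⟩ := hc.isCompact.exists_isGreatest hne
      exact ⟨α, β, (hs hα).1, (hs hβ).2, fun t ht => ⟨hαl ht, hβl ht⟩⟩
    · rw [not_nonempty_iff_eq_empty] at hne
      exact ⟨T, 0, hT, hT, by simp [hne]⟩
  have hz : ∀ t, t ∉ Icc α β → η t = 0 := fun t ht =>
    image_eq_zero_of_notMem_tsupport fun h => ht (hsub h)
  have hsupp : tsupport φ ⊆ Icc α β := by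
    refine closure_minimal (fun t ht => ?_) isClosed_Icc
    by_contra hcon
    refine ht ?_
    rw [mem_Icc, not_and_or, not_le, not_le] at hcon
    rcases hcon with h1 | h1
    · rw [← intervalIntegral.integral_zero (μ := volume) (a := 0) (b := t)]
      refine intervalIntegral.integral_congr fun s hs => hz s fun hm => ?_
      have := (mem_uIcc.1 hs)
      rcases this with h2 | h2 <;> linarith [hm.1, h2.1, h2.2]
    · have e : φ t = φ T - ∫ s in t..T, η s := by
        rw [eq_sub_iff_add_eq]
        exact intervalIntegral.integral_add_adjacent_intervals
          (hη.continuous.intervalIntegrable _ _) (hη.continuous.intervalIntegrable _ _)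
      have e1 : φ T = 0 := by
        rw [setIntegral_Ioo_eq hT.le] at h0
        exact h0
      have e2 : ∫ s in t..T, η s = 0 := by
        rw [← intervalIntegral.integral_zero (μ := volume) (a := t) (b := T)]
        refine intervalIntegral.integral_congr fun s hs => hz s fun hm => ?_
        rcases mem_uIcc.1 hs with h2 | h2 <;> linarith [hm.2, h2.1, h2.2]
      rw [e, e1, e2, sub_zero]
  exact ⟨φ, hφ, HasCompactSupport.of_support_subset_isCompact isCompact_Icc
    ((subset_tsupport φ).trans hsupp), hsupp.trans (Icc_subset_Ioo hα hβ), hder⟩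

/-- The lemma of du Bois-Reymond for continuous functions. -/
theorem exists_eq_const {T : ℝ} (hT : 0 < T) {f : ℝ → E} (hf : ContinuousOn f (Icc 0 T))
    (h : ∀ φ : ℝ → ℝ, ContDiff ℝ ∞ φ → HasCompactSupport φ → tsupport φ ⊆ Ioo 0 T →
      ∫ t in Ioo 0 T, deriv φ t • f t = 0) : ∃ c, ∀ t ∈ Icc 0 T, f t = c := by
  have hfi : IntegrableOn f (Ioo 0 T) := hf.integrableOn_Icc.mono_set Ioo_subset_Icc_self
  let b : ContDiffBump (T / 2) := ⟨T / 8, T / 4, by linarith, by linarith⟩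
  set ψ : ℝ → ℝ := b.normed volume
  have ψ1 : ContDiff ℝ ∞ ψ := b.contDiff_normed
  have ψ2 : HasCompactSupport ψ := b.hasCompactSupport_normed
  have ψ3 : tsupport ψ ⊆ Ioo 0 T := by
    rw [b.tsupport_normed_eq, Real.closedBall_eq_Icc]
    exact Icc_subset_Ioo (by simp only [b]; linarith) (by simp only [b]; linarith)
  have ψ4 : ∫ t in Ioo 0 T, ψ t = 1 := by
    rw [setIntegral_eq_integral_of_forall_compl_eq_zero]
    · exact b.integral_normed
    · exact fun t ht => image_eq_zero_of_notMem_tsupport fun hm => ht (ψ3 hm)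
  set c := ∫ t in Ioo 0 T, ψ t • f t
  have hci : IntegrableOn (fun _ : ℝ => c) (Ioo 0 T) := integrableOn_const (by simp)
  have hae : ∀ᵐ t, t ∈ Ioo 0 T → f t = c := by
    refine ae_eq_of_forall_test hfi hci fun η h1 h2 h3 => ?_
    set m := ∫ t in Ioo 0 T, η t with hm
    have cint : ∀ {χ : ℝ → ℝ}, Continuous χ → IntegrableOn χ (Ioo 0 T) := fun hχ =>
      (hχ.integrableOn_Icc).mono_set Ioo_subset_Icc_self
    obtain ⟨φ, k1, k2, k3, k4⟩ := exists_test_primitive hT (η := fun t => η t - m * ψ t)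
      (h1.sub (contDiff_const.mul ψ1)) (h2.sub ψ2.mul_left)
      ((tsupport_sub _ _).trans (union_subset h3 ((tsupport_mul_subset_right).trans ψ3))) (by
        rw [integral_sub (cint h1.continuous) ((cint ψ1.continuous).const_mul m),
          integral_const_mul, ψ4, mul_one, sub_self])
    have h5 := h φ k1 k2 k3
    rw [k4] at h5
    simp only [sub_smul, mul_smul] at h5
    have i : Integrable (fun t => m • ψ t • f t) (volume.restrict (Ioo 0 T)) :=
      (integrable_smul_test ψ1.continuous hfi).smul m
    rw [integral_sub (integrable_smul_test h1.continuous hfi) i, integral_smul] at h5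
    rw [sub_eq_zero.1 h5, integral_smul_const]
  refine ⟨c, fun t ht => ?_⟩
  have hae' : f =ᵐ[volume.restrict (Icc 0 T)] fun _ => c := by
    rw [← restrict_Ioo_eq_restrict_Icc]
    exact (ae_restrict_iff' measurableSet_Ioo).2 hae
  exact Measure.eqOn_Icc_of_ae_eq volume hT.ne hae' hf continuousOn_const ht

theorem isPrim_of_isWeakTimeDeriv {H : Type*} [NormedAddCommGroup H] [InnerProductSpace ℝ H]
    [CompleteSpace H] {T : ℝ} (hT : 0 < T) {X x : ℝ → H} (hX : ContinuousOn X (Icc 0 T))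
    (hx : IntegrableOn x (Ioo 0 T)) (h : IsWeakTimeDeriv T X x) : IsPrim T X x := by
  have hxi : IntervalIntegrable x volume 0 T := by
    rwa [intervalIntegrable_iff_integrableOn_Ioo_of_le hT.le]
  set Y : ℝ → H := fun t => ∫ s in (0 : ℝ)..t, x s
  have hY : IsPrim T Y x := ⟨hxi, fun t _ => by simp [Y]⟩
  have hYc := hY.continuousOn hT.le
  have hYw := hY.isWeakTimeDeriv hT
  obtain ⟨c, hc⟩ := exists_eq_const hT (hX.sub hYc) (fun φ h1 h2 h3 => by
    have hφ' : Continuous (deriv φ) := h1.continuous_deriv (by simp)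
    simp only [Pi.sub_apply, smul_sub]
    rw [integral_sub (integrable_smul_test hφ' (hX.integrableOn_Icc.mono_set Ioo_subset_Icc_self))
      (integrable_smul_test hφ' (hYc.integrableOn_Icc.mono_set Ioo_subset_Icc_self)),
      h φ h1 h2 h3, hYw φ h1 h2 h3, sub_self])
  refine ⟨hxi, fun t ht => ?_⟩
  have h1 : X t - Y t = c := hc t ht
  have h2 : X 0 - Y 0 = c := hc 0 ⟨le_rfl, hT.le⟩
  have hY0 : Y 0 = 0 := by simp [Y]
  rw [hY0, sub_zero] at h2
  rw [h2, ← h1]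
  abel

end TimeDerivatives

end Westervelt

end

noncomputable section

namespace Westervelt

open Filter Topology

variable {d : ℕ} {Ω : Set (EuclideanSpace ℝ (Fin d))} {q : ℝ} [hq : Fact (1 ≤ q)]
  [IsFiniteMeasure (volume.restrict Ω)]

theorem powFlux_grad_integrable (v w : W0 Ω (expo q)) :
    Integrable (fun x => ‖grad v x‖ ^ (q - 1) * inner ℝ (grad v x) (grad w x))
      (volume.restrict Ω) :=
  integrable_powFlux (gradL Ω (expo q) v) (gradL Ω (expo q) w)

theorem inner_toG (u w : W0 Ω (expo q)) : inner ℝ (toG Ω q u) (toG Ω q w)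
    = ∫ x in Ω, inner ℝ (grad u x) (grad w x) := by
  rw [L2.inner_def]
  refine integral_congr_ae ?_
  filter_upwards [coeFn_toG u, coeFn_toG w] with x h1 h2
  rw [h1, h2]

theorem integrable_inner_grad (u w : W0 Ω (expo q)) :
    Integrable (fun x => inner ℝ (grad u x) (grad w x)) (volume.restrict Ω) := by
  refine (L2.integrable_inner (𝕜 := ℝ) (toG Ω q u) (toG Ω q w)).congr ?_
  filter_upwards [coeFn_toG u, coeFn_toG w] with x h1 h2
  rw [h1, h2]

namespace Embeds

variable {C₀ C₄ : ℝ≥0}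

theorem sub_mulOp_ae (h : Embeds Ω q C₀ C₄) (k : ℝ) (u w : W0 Ω (expo q))
    (a : Lp ℝ 2 (volume.restrict Ω)) :
    (fun x => inner ℝ ((a - h.mulOp k u a : Lp ℝ 2 (volume.restrict Ω)) x) (toH Ω q w x))
      =ᵐ[volume.restrict Ω] fun x => (1 - 2 * k * fn u x) * a x * fn w x := by
  filter_upwards [Lp.coeFn_sub a (h.mulOp k u a), h.coeFn_mulOp k u a, coeFn_toH w] with x h1 h2 h3
  rw [h1, Pi.sub_apply, h2, h3, real_inner_eq_mul]
  ring

theorem inner_sub_mulOp (h : Embeds Ω q C₀ C₄) (k : ℝ) (u w : W0 Ω (expo q))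
    (a : Lp ℝ 2 (volume.restrict Ω)) :
    inner ℝ (a - h.mulOp k u a) (toH Ω q w)
      = ∫ x in Ω, (1 - 2 * k * fn u x) * a x * fn w x := by
  rw [L2.inner_def]
  exact integral_congr_ae (h.sub_mulOp_ae k u w a)

theorem integrable_sub_mul (h : Embeds Ω q C₀ C₄) (k : ℝ) (u w : W0 Ω (expo q))
    (a : Lp ℝ 2 (volume.restrict Ω)) :
    Integrable (fun x => (1 - 2 * k * fn u x) * a x * fn w x) (volume.restrict Ω) :=
  (L2.integrable_inner (𝕜 := ℝ) (a - h.mulOp k u a) (toH Ω q w)).congr (h.sub_mulOp_ae k u w a)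

theorem inner_mulOp_self (h : Embeds Ω q C₀ C₄) (k : ℝ) (v w : W0 Ω (expo q)) :
    inner ℝ (h.mulOp k v (toH Ω q v)) (toH Ω q w)
      = ∫ x in Ω, 2 * k * (fn v x) ^ 2 * fn w x := by
  rw [h.inner_mulOp]
  refine integral_congr_ae ?_
  filter_upwards [coeFn_toH v, coeFn_toH w] with x h1 h2
  rw [h1, h2]
  ring

theorem integral_weak_form (h : Embeds Ω q C₀ C₄) (c b δ k : ℝ) (u v w : W0 Ω (expo q))
    (a : Lp ℝ 2 (volume.restrict Ω)) :
    ∫ x in Ω, ((1 - 2 * k * fn u x) * a x * fn w x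
          + c ^ 2 * inner ℝ (grad u x) (grad w x)
          + b * ((1 - δ) + δ * ‖grad v x‖ ^ (q - 1)) * inner ℝ (grad v x) (grad w x))
      = (∫ x in Ω, (1 - 2 * k * fn u x) * a x * fn w x)
        + c ^ 2 * (∫ x in Ω, inner ℝ (grad u x) (grad w x))
        + (b * (1 - δ) * (∫ x in Ω, inner ℝ (grad v x) (grad w x))
          + b * δ * ∫ x in Ω, ‖grad v x‖ ^ (q - 1) * inner ℝ (grad v x) (grad w x)) := by
  have i1 := h.integrable_sub_mul k u w a
  have i2 := (integrable_inner_grad u w).const_mul (c ^ 2)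
  have i3 := (integrable_inner_grad v w).const_mul (b * (1 - δ))
  have i4 := (powFlux_grad_integrable v w).const_mul (b * δ)
  rw [← integral_const_mul, ← integral_const_mul, ← integral_const_mul, ← integral_add i3 i4,
    ← integral_add i1 i2]
  refine Eq.trans (integral_congr_ae (Eventually.of_forall fun x => ?_))
    (integral_add (i1.add i2) (i3.add i4))
  simp only
  ring

theorem system_defect (h : Embeds Ω q C₀ C₄) {c b δ : ℝ} (k : ℝ) (hc : 0 < c ^ 2) (hb : 0 < b)
    (hδ : 0 < δ) (hδ' : 0 < 1 - δ) (u v w : W0 Ω (expo q)) (a : Lp ℝ 2 (volume.restrict Ω)) :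
    (h.system k hc hb hδ hδ').defect u v a w
      = inner ℝ (a - h.mulOp k u a) (toH Ω q w) + c ^ 2 * inner ℝ (toG Ω q u) (toG Ω q w)
        + (b * (1 - δ) * inner ℝ (toG Ω q v) (toG Ω q w)
          + b * δ * ∫ x in Ω, ‖grad v x‖ ^ (q - 1) * inner ℝ (grad v x) (grad w x))
        - inner ℝ (h.mulOp k v (toH Ω q v)) (toH Ω q w) := rfl

theorem defect_eq (h : Embeds Ω q C₀ C₄) {c b δ : ℝ} (k : ℝ) (hc : 0 < c ^ 2) (hb : 0 < b)
    (hδ : 0 < δ) (hδ' : 0 < 1 - δ) (u v w : W0 Ω (expo q)) (a : Lp ℝ 2 (volume.restrict Ω)) :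
    (h.system k hc hb hδ hδ').defect u v a w
      = (∫ x in Ω, ((1 - 2 * k * fn u x) * a x * fn w x
          + c ^ 2 * inner ℝ (grad u x) (grad w x)
          + b * ((1 - δ) + δ * ‖grad v x‖ ^ (q - 1)) * inner ℝ (grad v x) (grad w x)))
        - ∫ x in Ω, 2 * k * (fn v x) ^ 2 * fn w x := by
  have congr : ∀ {i₁ i₂ i₃ i₄ j₁ j₂ j₃ j₄ n : ℝ}, i₁ = j₁ → i₂ = j₂ → i₃ = j₃ → i₄ = j₄ →
      i₁ + c ^ 2 * i₂ + (b * (1 - δ) * i₃ + b * δ * n) - i₄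
        = j₁ + c ^ 2 * j₂ + (b * (1 - δ) * j₃ + b * δ * n) - j₄ := by
    rintro _ _ _ _ _ _ _ _ _ rfl rfl rfl rfl
    rfl
  rw [h.integral_weak_form c b δ k u v w a]
  exact (h.system_defect k hc hb hδ hδ' u v w a).trans (congr (h.inner_sub_mulOp k u w a)
    (inner_toG u w) (inner_toG v w) (h.inner_mulOp_self k v w))

theorem defect_eq_zero_iff (h : Embeds Ω q C₀ C₄) {c b δ : ℝ} (k : ℝ) (hc : 0 < c ^ 2) (hb : 0 < b)
    (hδ : 0 < δ) (hδ' : 0 < 1 - δ) (u v w : W0 Ω (expo q)) (a : Lp ℝ 2 (volume.restrict Ω)) :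
    (h.system k hc hb hδ hδ').defect u v a w = 0 ↔
      ∫ x in Ω, ((1 - 2 * k * fn u x) * a x * fn w x
          + c ^ 2 * inner ℝ (grad u x) (grad w x)
          + b * ((1 - δ) + δ * ‖grad v x‖ ^ (q - 1)) * inner ℝ (grad v x) (grad w x))
        = ∫ x in Ω, 2 * k * (fn v x) ^ 2 * fn w x := by
  rw [h.defect_eq k hc hb hδ hδ' u v w a, sub_eq_zero]

/-- The multiplication operator is bounded on `L_2(Ω)` by the maximum norm. -/
theorem norm_mulOp_le (h : Embeds Ω q C₀ C₄) (k : ℝ) (u : W0 Ω (expo q))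
    (f : Lp ℝ 2 (volume.restrict Ω)) :
    ‖h.mulOp k u f‖ ≤ 2 * |k| * (C₀ * ‖gradL Ω (expo q) u‖) * ‖f‖ := by
  have e : h.mulOp k u f
      = (2 * k) • (ContinuousLinearMap.mul ℝ ℝ).holder 2 (h.toTop u) f := rfl
  have h1 : ‖(ContinuousLinearMap.mul ℝ ℝ).holder 2 (h.toTop u) f‖ ≤ ‖h.toTop u‖ * ‖f‖ := by
    refine ((ContinuousLinearMap.mul ℝ ℝ).norm_holder_apply_apply_le _ _).trans ?_
    have := ContinuousLinearMap.opNorm_mul_le ℝ ℝ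
    have h0 : 0 ≤ ‖h.toTop u‖ * ‖f‖ := by positivity
    nlinarith
  have h2 := mul_le_mul_of_nonneg_right (h.norm_toTop_le u) (norm_nonneg f)
  have h3 := mul_le_mul_of_nonneg_left (h1.trans h2) (abs_nonneg (2 * k))
  rw [e]
  refine (norm_smul_le _ _).trans (h3.trans_eq ?_)
  rw [abs_mul, abs_two]
  ring

theorem coercive (h : Embeds Ω q C₀ C₄) (k : ℝ) (u : W0 Ω (expo q)) {R : ℝ}
    (hR : ‖gradL Ω (expo q) u‖ ≤ R) (f : Lp ℝ 2 (volume.restrict Ω)) :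
    (1 - 2 * |k| * C₀ * R) * ‖f‖ ^ 2 ≤ inner ℝ (f - h.mulOp k u f) f := by
  have h1 := (real_inner_le_norm (h.mulOp k u f) f).trans
    (mul_le_mul_of_nonneg_right (h.norm_mulOp_le k u f) (norm_nonneg f))
  have h2 : 2 * |k| * (C₀ * ‖gradL Ω (expo q) u‖) * ‖f‖ * ‖f‖ ≤ 2 * |k| * (C₀ * R) * ‖f‖ * ‖f‖ := by
    gcongr
  rw [inner_sub_left, real_inner_self_eq_norm_sq]
  nlinarith

end Embeds

end Westervelt

end

noncomputable section

namespace Westervelt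

open Filter Topology

section Abstract

variable {V H G : Type*} [NormedAddCommGroup V] [NormedSpace ℝ V] [CompleteSpace V]
    [NormedAddCommGroup H] [InnerProductSpace ℝ H] [CompleteSpace H]
    [NormedAddCommGroup G] [InnerProductSpace ℝ G]

theorem memLp_Ioo_of_continuousOn {E : Type*} [NormedAddCommGroup E] {T : ℝ} {f : ℝ → E}
    (hf : ContinuousOn f (Icc 0 T)) (p : ℝ≥0∞) : MemLp f p (volume.restrict (Ioo 0 T)) := by
  obtain ⟨C, hC⟩ := isCompact_Icc.exists_bound_of_continuousOn hf
  refine MemLp.of_bound ((hf.mono Ioo_subset_Icc_self).aestronglyMeasurable measurableSet_Ioo) C ?_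
  exact (ae_restrict_iff' measurableSet_Ioo).2
    (Eventually.of_forall fun t ht => hC t (Ioo_subset_Icc_self ht))

theorem IsWeakTimeDeriv.congr {E : Type*} [NormedAddCommGroup E] [NormedSpace ℝ E] {T : ℝ}
    {f f' g g' : ℝ → E} (h : IsWeakTimeDeriv T f g) (hf : ∀ᵐ t, t ∈ Ioo 0 T → f t = f' t)
    (hg : ∀ᵐ t, t ∈ Ioo 0 T → g t = g' t) : IsWeakTimeDeriv T f' g' := by
  intro φ h1 h2 h3
  have e1 : ∫ t in Ioo 0 T, deriv φ t • f t = ∫ t in Ioo 0 T, deriv φ t • f' t :=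
    setIntegral_congr_ae measurableSet_Ioo (by
      filter_upwards [hf] with t ht htm
      rw [ht htm])
  have e2 : ∫ t in Ioo 0 T, φ t • g t = ∫ t in Ioo 0 T, φ t • g' t :=
    setIntegral_congr_ae measurableSet_Ioo (by
      filter_upwards [hg] with t ht htm
      rw [ht htm])
  rw [← e1, ← e2]
  exact h φ h1 h2 h3

/-- If `u` is continuously differentiable and `L u` has a second weak derivative `a`, then
`L u_t` is a primitive of `a`. -/
theorem isPrim_dt_of_weak {T : ℝ} (hT : 0 < T) (L : V →L[ℝ] H) {u : ℝ → V}
    (hu : ContDiffOn ℝ 1 u (Icc 0 T)) {U U' a : ℝ → H} (hU : ∀ t ∈ Icc 0 T, U t = L (u t))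
    (hU' : IntegrableOn U' (Ioo 0 T)) (ha : IntegrableOn a (Ioo 0 T))
    (h1 : IsWeakTimeDeriv T U U') (h2 : IsWeakTimeDeriv T U' a) :
    IsPrim T (fun t => L (dt T u t)) a := by
  obtain ⟨hc, hp⟩ := isPrim_dt hT hu
  have hLc : ContinuousOn (fun t => L (dt T u t)) (Icc 0 T) := L.continuous.comp_continuousOn hc
  have h3 : IsWeakTimeDeriv T U (fun t => L (dt T u t)) :=
    ((hp.clm_comp L).isWeakTimeDeriv hT).congr
      (Eventually.of_forall fun t ht => (hU t (Ioo_subset_Icc_self ht)).symm)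
      (Eventually.of_forall fun _ _ => rfl)
  have h4 := h1.ae_unique h3 hU' (hLc.integrableOn_Icc.mono_set Ioo_subset_Icc_self)
  exact isPrim_of_isWeakTimeDeriv hT hLc ha (h2.congr h4 (Eventually.of_forall fun _ _ => rfl))

theorem eLpNorm_two_le_of_integral {T : ℝ} (hT : 0 ≤ T) {a : ℝ → H}
    (ha : MemLp a 2 (volume.restrict (Ioc 0 T))) {m : ℝ} (hm : 0 ≤ m)
    (h : ∫ t in (0 : ℝ)..T, ‖a t‖ ^ 2 ≤ m ^ 2) :
    eLpNorm a 2 (volume.restrict (Ioo 0 T)) ≤ ENNReal.ofReal m := by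
  rw [restrict_Ioo_eq_restrict_Ioc, ← eLpNorm_congr_ae ha.coeFn_toLp, eLpNorm_eq_ofReal_norm]
  refine ENNReal.ofReal_le_ofReal (abs_le_of_sq_le_sq' ?_ hm).2
  rwa [norm_toLp_sq hT ha]

namespace DampedWave

theorem IsSol.eqOn {S : DampedWave V H G} {T ε ε' r : ℝ} (hT : 0 < T) (hr : 0 < r) {u₀ v₀ : V}
    {u v u' v' : ℝ → V} {a a' : ℝ → H} (h : S.IsSol T ε u₀ v₀ u v a)
    (h' : S.IsSol T ε' u₀ v₀ u' v' a')
    (hc : ∀ t ∈ Icc 0 T, ∀ x, r * ‖x‖ ^ 2 ≤ inner ℝ (x - S.B (u t) x) x)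
    (hc' : ∀ t ∈ Icc 0 T, ∀ x, r * ‖x‖ ^ 2 ≤ inner ℝ (x - S.B (u' t) x) x) :
    EqOn u' u (Icc 0 T) := by
  have key : ∀ {ε : ℝ} {u v : ℝ → V} {a : ℝ → H}, S.IsSol T ε u₀ v₀ u v a →
      (∀ t ∈ Icc 0 T, ∀ x, r * ‖x‖ ^ 2 ≤ inner ℝ (x - S.B (u t) x) x) →
      ∃ K₀, ∀ K ≥ K₀, S.IsApproxSol T 0 K r u₀ v₀ u v (fun t => S.ι (v t)) a := by
    intro ε u v a h hc
    obtain ⟨K₁, hK₁⟩ := isCompact_Icc.exists_bound_of_continuousOn h.v_cont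
    obtain ⟨K₂, hK₂⟩ := isCompact_Icc.exists_bound_of_continuousOn (h.u_prim.continuousOn hT.le)
    refine ⟨max ε (max K₁ K₂), fun K hK => ?_⟩
    have hK1 : ε ≤ K := (le_max_left _ _).trans hK
    have hK2 : K₁ ≤ K := (le_max_left _ _).trans ((le_max_right _ _).trans hK)
    have hK3 : K₂ ≤ K := (le_max_right _ _).trans ((le_max_right _ _).trans hK)
    exact
      { v_meas := (h.v_cont.mono Ioc_subset_Icc_self).aestronglyMeasurable measurableSet_Ioc
        v_bdd := fun t ht => (hK₁ t (Ioc_subset_Icc_self ht)).trans hK2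
        u_bdd := fun t ht => (hK₂ t ht).trans hK3
        a_memLp := h.a_memLp
        a_bdd := h.a_le.trans hK1
        u_zero := h.u_zero
        Z_zero := by rw [h.v_zero]
        u_prim := h.u_prim
        Z_prim := h.v_prim
        near := Eventually.of_forall fun t _ => by simp
        eqn := by
          filter_upwards [h.eqn] with t ht htm w
          have := ht (Ioo_subset_Ioc_self htm) w
          rw [defect] at this
          rw [this]
          simp
        coer := hc }
  obtain ⟨K₁, h₁⟩ := key h hc
  obtain ⟨K₂, h₂⟩ := key h' hc'
  set K := max 0 (max K₁ K₂)
  obtain ⟨C, -, hC⟩ := S.stability hT (le_max_left 0 (max K₁ K₂)) hr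
  have h3 := (hC 0 0 u₀ v₀ u' v' u v _ _ _ _ le_rfl zero_le_one le_rfl zero_le_one
    (h₂ K ((le_max_right _ _).trans (le_max_right _ _)))
    (h₁ K ((le_max_left _ _).trans (le_max_right _ _)))).1
  intro t ht
  have h4 := (h3 t ht).2
  rw [add_zero, mul_zero] at h4
  have h5 : ‖S.D (u' t - u t)‖ = 0 := pow_eq_zero_iff two_ne_zero |>.1 (le_antisymm h4 (sq_nonneg _))
  have h6 := S.ι_le (u' t - u t)
  rw [h5, mul_zero] at h6
  have h7 : S.ι (u' t - u t) = 0 := norm_le_zero_iff.1 h6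
  rw [← map_zero S.ι] at h7
  exact sub_eq_zero.1 (S.ι_inj h7)

/-- A trajectory with the regularity of a solution that satisfies the equation is a solution. -/
theorem exists_isSol_of_dt {S : DampedWave V H G} {T : ℝ} (hT : 0 < T) {u : ℝ → V} {a : ℝ → H}
    (hu : ContDiffOn ℝ 1 u (Icc 0 T)) (ha : MemLp a 2 (volume.restrict (Ioo 0 T)))
    (hp : IsPrim T (fun t => S.ι (dt T u t)) a)
    (he : ∀ᵐ t ∂(volume.restrict (Ioo 0 T)), ∀ w, S.defect (u t) (dt T u t) (a t) w = 0) :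
    ∃ ε, S.IsSol T ε (u 0) (dt T u 0) u (dt T u) a := by
  obtain ⟨hc, hup⟩ := isPrim_dt hT hu
  obtain ⟨C, hC⟩ := isCompact_Icc.exists_bound_of_continuousOn (S.continuous_Φ.comp_continuousOn hc)
  rw [restrict_Ioo_eq_restrict_Ioc] at ha he
  refine ⟨max C (∫ t in (0 : ℝ)..T, ‖a t‖ ^ 2), hc, hup, rfl, rfl, ha, hp, le_max_right _ _,
    fun t ht => ((le_abs_self _).trans (hC t ht)).trans (le_max_left _ _),
    (ae_restrict_iff' measurableSet_Ioc).1 he⟩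

end DampedWave

end Abstract

end Westervelt

end

noncomputable section

namespace Westervelt

open Filter Topology

theorem eLpNorm_ofReal_norm {E : Type*} [NormedAddCommGroup E] (f : ℝ → E) (p : ℝ≥0∞)
    (μ : Measure ℝ) : eLpNorm (fun t => ENNReal.ofReal ‖f t‖) p μ = eLpNorm f p μ :=
  eLpNorm_congr_enorm_ae (Eventually.of_forall fun t => by simp)

theorem eLpNorm_top_Ioo_le {E : Type*} [NormedAddCommGroup E] {T m : ℝ} {f : ℝ → E}
    (h : ∀ t ∈ Icc 0 T, ‖f t‖ ≤ m) :
    eLpNorm f ⊤ (volume.restrict (Ioo 0 T)) ≤ ENNReal.ofReal m := by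
  rw [eLpNorm_exponent_top]
  refine eLpNormEssSup_le_of_ae_enorm_bound ?_
  refine (ae_restrict_iff' measurableSet_Ioo).2 (Eventually.of_forall fun t ht => ?_)
  rw [← ofReal_norm]
  exact ENNReal.ofReal_le_ofReal (h t (Ioo_subset_Icc_self ht))

theorem eLpNorm_expo_Ioo_le {E : Type*} [NormedAddCommGroup E] {q : ℝ} [hq : Fact (1 ≤ q)]
    {T M : ℝ} (hT : 0 ≤ T) (hM : 0 ≤ M) {f : ℝ → E}
    (h : ∀ t ∈ Icc 0 T, ‖f t‖ ^ (q + 1) * T ≤ M ^ (q + 1)) :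
    eLpNorm f (expo q) (volume.restrict (Ioo 0 T)) ≤ ENNReal.ofReal M := by
  have hq1 := hq.out
  have hq0 : 0 < q + 1 := by linarith
  rcases hT.eq_or_lt with rfl | hT0
  · simp
  have hT1 : 0 < T ^ (q + 1)⁻¹ := Real.rpow_pos_of_pos hT0 _
  have h1 : ∀ t ∈ Icc 0 T, ‖f t‖ ≤ M / T ^ (q + 1)⁻¹ := by
    intro t ht
    rw [le_div_iff₀ hT1]
    refine (Real.rpow_le_rpow_iff (by positivity) hM hq0).1 ?_
    rw [Real.mul_rpow (norm_nonneg _) hT1.le, ← Real.rpow_mul hT, inv_mul_cancel₀ hq0.ne',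
      Real.rpow_one]
    exact h t ht
  have h2 := eLpNorm_le_of_ae_bound (p := expo q) ((ae_restrict_iff' measurableSet_Ioo).2
    (Eventually.of_forall fun t ht => h1 t (Ioo_subset_Icc_self ht)) :
      ∀ᵐ t ∂(volume.restrict (Ioo 0 T)), ‖f t‖ ≤ M / T ^ (q + 1)⁻¹)
  refine h2.trans_eq ?_
  rw [Measure.restrict_apply_univ, Real.volume_Ioo, sub_zero, toReal_expo,
    ENNReal.ofReal_rpow_of_pos hT0, ← ENNReal.ofReal_mul hT1.le, mul_div_cancel₀ _ hT1.ne']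

theorem integral_norm_le_of_eLpNorm_expo {E : Type*} [NormedAddCommGroup E] {q : ℝ}
    [hq : Fact (1 ≤ q)] {T M : ℝ} (hT : 0 < T) (hM : 0 ≤ M) {f : ℝ → E}
    (hf : ContinuousOn f (Icc 0 T))
    (h : eLpNorm f (expo q) (volume.restrict (Ioo 0 T)) ≤ ENNReal.ofReal M) :
    ∫ t in (0 : ℝ)..T, ‖f t‖ ≤ T ^ (q / (q + 1)) * M := by
  have hq1 := hq.out
  have hm := memLp_Ioo_of_continuousOn hf 1
  have h1 := eLpNorm_le_eLpNorm_mul_rpow_measure_univ (p := 1) (q := expo q)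
    ((Fact.out : (1 : ℝ≥0∞) ≤ expo q)) hm.1
  rw [toReal_expo, ENNReal.toReal_one, Measure.restrict_apply_univ, Real.volume_Ioo, sub_zero,
    ENNReal.ofReal_rpow_of_pos hT, show 1 / 1 - 1 / (q + 1) = q / (q + 1) by field_simp; ring,
    eLpNorm_one_eq_lintegral_enorm, ← ofReal_integral_norm_eq_lintegral_enorm
      (memLp_one_iff_integrable.1 hm)] at h1
  have h2 := h1.trans (mul_le_mul_left h _)
  rw [← ENNReal.ofReal_mul hM, ENNReal.ofReal_le_ofReal_iff (by positivity),
    setIntegral_Ioo_eq hT.le] at h2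
  linarith

variable {d : ℕ} {Ω : Set (EuclideanSpace ℝ (Fin d))} {q : ℝ} [hq : Fact (1 ≤ q)]
  [IsFiniteMeasure (volume.restrict Ω)]

theorem eLpNorm_grad_two_time (v : ℝ → W0 Ω (expo q)) (p : ℝ≥0∞) (μ : Measure ℝ) :
    eLpNorm (fun t => eLpNorm (grad (v t)) 2 (volume.restrict Ω)) p μ
      = eLpNorm (fun t => toG Ω q (v t)) p μ := by
  simp only [eLpNorm_grad_two]
  exact eLpNorm_ofReal_norm _ p μ

theorem eLpNorm_grad_expo_time (v : ℝ → W0 Ω (expo q)) (p : ℝ≥0∞) (μ : Measure ℝ) :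
    eLpNorm (fun t => eLpNorm (grad (v t)) (expo q) (volume.restrict Ω)) p μ
      = eLpNorm (fun t => gradL Ω (expo q) (v t)) p μ := by
  simp only [eLpNorm_grad_expo]
  exact eLpNorm_ofReal_norm _ p μ

theorem isH2With_of_isPrim {T : ℝ} (hT : 0 < T) {u v : ℝ → W0 Ω (expo q)}
    {a : ℝ → Lp ℝ 2 (volume.restrict Ω)} (hu : IsPrim T u v)
    (ha : MemLp a 2 (volume.restrict (Ioc 0 T))) (hp : IsPrim T (fun t => toH Ω q (v t)) a) :
    IsH2With T u a := by
  have hu1 := hu.clm_comp (toH Ω q)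
  refine ⟨fun t => toH Ω q (u t), fun t => toH Ω q (v t), fun t _ => coeFn_toH (u t),
    memLp_Ioo_of_continuousOn (hu1.continuousOn hT.le) 2,
    memLp_Ioo_of_continuousOn (hp.continuousOn hT.le) 2, ?_, hu1.isWeakTimeDeriv hT,
    hp.isWeakTimeDeriv hT⟩
  rwa [restrict_Ioo_eq_restrict_Ioc]

theorem IsH2With.isPrim {T : ℝ} (hT : 0 < T) {u : ℝ → W0 Ω (expo q)}
    {a : ℝ → Lp ℝ 2 (volume.restrict Ω)} (hu : ContDiffOn ℝ 1 u (Icc 0 T)) (h : IsH2With T u a) :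
    MemLp a 2 (volume.restrict (Ioo 0 T)) ∧ IsPrim T (fun t => toH Ω q (dt T u t)) a := by
  obtain ⟨U, U', hU, -, hU', ha, h1, h2⟩ := h
  refine ⟨ha, isPrim_dt_of_weak hT (toH Ω q) hu (U := U) (U' := U') (fun t ht => ?_)
    (hU'.integrable one_le_two) (ha.integrable one_le_two) h1 h2⟩
  exact Lp.ext ((hU t ht).trans (coeFn_toH (u t)).symm)

namespace Embeds

variable {C₀ C₄ : ℝ≥0} {c b δ k : ℝ} {hc : 0 < c ^ 2} {hb : 0 < b} {hδ : 0 < δ} {hδ' : 0 < 1 - δ}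

theorem isWeakSolution_of_isSol (h : Embeds Ω q C₀ C₄) {T ε : ℝ} (hT : 0 < T)
    {u₀ u₁ : W0 Ω (expo q)} {u v : ℝ → W0 Ω (expo q)} {a : ℝ → Lp ℝ 2 (volume.restrict Ω)}
    (hs : (h.system k hc hb hδ hδ').IsSol T ε u₀ u₁ u v a) :
    IsH2With T u a ∧ IsWeakSolution c b δ k T u₀ u₁ u := by
  have h2 : IsH2With T u a := isH2With_of_isPrim hT hs.u_prim hs.a_memLp hs.v_prim
  have hd : ∀ t ∈ Icc 0 T, dt T u t = v t := fun t ht => hs.u_prim.dt_eq hT hs.v_cont ht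
  refine ⟨h2, ⟨hs.u_prim.contDiffOn hT hs.v_cont, a, h2⟩, hs.u_zero,
    (hd 0 ⟨le_rfl, hT.le⟩).trans hs.v_zero, a, h2, ?_⟩
  rw [restrict_Ioo_eq_restrict_Ioc]
  refine (ae_restrict_iff' measurableSet_Ioc).2 ?_
  filter_upwards [hs.eqn] with t ht htm w
  have h3 := (h.defect_eq_zero_iff k hc hb hδ hδ' (u t) (v t) w (a t)).1 (ht htm w)
  rw [hd t (Ioc_subset_Icc_self htm)]
  exact h3

theorem exists_isSol_of_isWeakSolution (h : Embeds Ω q C₀ C₄) {T : ℝ} (hT : 0 < T)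
    {u₀ u₁ : W0 Ω (expo q)} {u : ℝ → W0 Ω (expo q)} (hs : IsWeakSolution c b δ k T u₀ u₁ u) :
    ∃ ε a, (h.system k hc hb hδ hδ').IsSol T ε u₀ u₁ u (dt T u) a := by
  obtain ⟨⟨hu, -⟩, rfl, rfl, a, ha, he⟩ := hs
  obtain ⟨ha2, hp⟩ := ha.isPrim hT hu
  obtain ⟨ε, hε⟩ := DampedWave.exists_isSol_of_dt (S := h.system k hc hb hδ hδ') hT hu ha2 hp (by
    filter_upwards [he] with t ht w
    exact (h.defect_eq_zero_iff k hc hb hδ hδ' (u t) (dt T u t) w (a t)).2 (ht w))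
  exact ⟨ε, a, hε⟩

theorem system_Φ (h : Embeds Ω q C₀ C₄) (x : W0 Ω (expo q)) :
    (h.system k hc hb hδ hδ').Φ x = b * (1 - δ) / 2 * ‖toG Ω q x‖ ^ 2
      + b * δ * (1 / (q + 1) * ‖gradL Ω (expo q) x‖ ^ (q + 1)) := rfl

theorem memCalW_of_isSol (h : Embeds Ω q C₀ C₄) {T ε m M : ℝ} (hT : 0 < T) (hm : 0 ≤ m)
    (hM : 0 ≤ M) {u₀ u₁ : W0 Ω (expo q)} {u v : ℝ → W0 Ω (expo q)}
    {a : ℝ → Lp ℝ 2 (volume.restrict Ω)}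
    (hs : (h.system k hc hb hδ hδ').IsSol T ε u₀ u₁ u v a) (h1 : ε ≤ m ^ 2)
    (h2 : ε ≤ b * (1 - δ) / 2 * m ^ 2) (h3 : ε * T ≤ b * δ * (1 / (q + 1)) * M ^ (q + 1)) :
    MemCalW T m M u := by
  have hq1 := hq.out
  obtain ⟨ha, hw⟩ := h.isWeakSolution_of_isSol hT hs
  have hd : ∀ t ∈ Icc 0 T, dt T u t = v t := fun t ht => hs.u_prim.dt_eq hT hs.v_cont ht
  have hδ0 := hδ
  have hb0 := hb
  have hδ1 := hδ'
  have hΦ : ∀ t ∈ Icc 0 T, b * (1 - δ) / 2 * ‖toG Ω q (dt T u t)‖ ^ 2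
      + b * δ * (1 / (q + 1) * ‖gradL Ω (expo q) (dt T u t)‖ ^ (q + 1)) ≤ ε := fun t ht => by
    have h4 := hs.Φ_le t ht
    simp only [hd t ht]
    exact h4
  refine ⟨hw.1, ⟨a, ha, eLpNorm_two_le_of_integral hT.le hs.a_memLp hm (hs.a_le.trans h1)⟩, ?_, ?_⟩
  · rw [eLpNorm_grad_two_time]
    refine eLpNorm_top_Ioo_le fun t ht => ?_
    have h4 := hΦ t ht
    have h5 : 0 ≤ b * δ * (1 / (q + 1) * ‖gradL Ω (expo q) (dt T u t)‖ ^ (q + 1)) := by positivity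
    have h6 : b * (1 - δ) / 2 * ‖toG Ω q (dt T u t)‖ ^ 2 ≤ b * (1 - δ) / 2 * m ^ 2 := by linarith
    exact (abs_le_of_sq_le_sq' (le_of_mul_le_mul_left h6 (by positivity)) hm).2
  · rw [eLpNorm_grad_expo_time]
    refine eLpNorm_expo_Ioo_le hT.le hM fun t ht => ?_
    have h4 := hΦ t ht
    have h5 : 0 ≤ b * (1 - δ) / 2 * ‖toG Ω q (dt T u t)‖ ^ 2 := by positivity
    have h6 : b * δ * (1 / (q + 1)) * (‖gradL Ω (expo q) (dt T u t)‖ ^ (q + 1) * T)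
        ≤ b * δ * (1 / (q + 1)) * M ^ (q + 1) := by
      refine le_trans ?_ h3
      have h7 := mul_le_mul_of_nonneg_right
        (by linarith : b * δ * (1 / (q + 1) * ‖gradL Ω (expo q) (dt T u t)‖ ^ (q + 1)) ≤ ε) hT.le
      linarith
    exact le_of_mul_le_mul_left h6 (by positivity)

theorem norm_gradL_le {T m M : ℝ} (hT : 0 < T) (hM : 0 ≤ M) {u : ℝ → W0 Ω (expo q)}
    (hu : MemCalW T m M u) {t : ℝ} (ht : t ∈ Icc 0 T) :
    ‖gradL Ω (expo q) (u t)‖ ≤ ‖gradL Ω (expo q) (u 0)‖ + T ^ (q / (q + 1)) * M := by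
  obtain ⟨⟨hC1, -⟩, -, -, h3⟩ := hu
  rw [eLpNorm_grad_expo_time] at h3
  obtain ⟨hc, hp⟩ := isPrim_dt hT hC1
  have hgc : ContinuousOn (fun t => gradL Ω (expo q) (dt T u t)) (Icc 0 T) :=
    (gradL Ω (expo q)).continuous.comp_continuousOn hc
  have h4 := integral_norm_le_of_eLpNorm_expo hT hM hgc h3
  have hg := hp.clm_comp (gradL Ω (expo q))
  have h0 : (0 : ℝ) ∈ Icc 0 T := ⟨le_rfl, hT.le⟩
  have h5 : ‖gradL Ω (expo q) (u t)‖ ≤ ‖gradL Ω (expo q) (u 0)‖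
      + ‖∫ s in (0 : ℝ)..t, gradL Ω (expo q) (dt T u s)‖ :=
    (congrArg norm (hg.eq t ht)).trans_le (norm_add_le _ _)
  have h6 := intervalIntegral.norm_integral_le_integral_norm (μ := volume)
    (f := fun s => gradL Ω (expo q) (dt T u s)) ht.1
  have h7 : ∫ s in (0 : ℝ)..t, ‖gradL Ω (expo q) (dt T u s)‖
      ≤ ∫ s in (0 : ℝ)..T, ‖gradL Ω (expo q) (dt T u s)‖ :=
    intervalIntegral.integral_mono_interval le_rfl ht.1 ht.2
      (Eventually.of_forall fun _ => norm_nonneg _) hg.int.norm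
  exact h5.trans (add_le_add le_rfl (h6.trans (h7.trans h4)))

theorem eqOn_of_isWeakSolution (h : Embeds Ω q C₀ C₄) (hc : 0 < c ^ 2) (hb : 0 < b) (hδ : 0 < δ)
    (hδ' : 0 < 1 - δ) {T m M κ : ℝ} (hT : 0 < T) (hM : 0 ≤ M)
    (hκ : 2 * |k| * C₀ * (κ + T ^ (q / (q + 1)) * M) < 1) {u₀ u₁ : W0 Ω (expo q)}
    (hu₀ : ‖gradL Ω (expo q) u₀‖ ≤ κ) {u v : ℝ → W0 Ω (expo q)}
    (hu : MemCalW T m M u) (hus : IsWeakSolution c b δ k T u₀ u₁ u)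
    (hv : MemCalW T m M v) (hvs : IsWeakSolution c b δ k T u₀ u₁ v) : EqOn v u (Icc 0 T) := by
  have coer : ∀ {u : ℝ → W0 Ω (expo q)}, MemCalW T m M u → u 0 = u₀ → ∀ t ∈ Icc 0 T, ∀ x,
      (1 - 2 * |k| * C₀ * (κ + T ^ (q / (q + 1)) * M)) * ‖x‖ ^ 2
        ≤ inner ℝ (x - h.mulOp k (u t) x) x := fun {u} hu h0 t ht x =>
    h.coercive k (u t) ((norm_gradL_le hT hM hu ht).trans (by rw [h0]; linarith)) x
  obtain ⟨ε, a, hsu⟩ := h.exists_isSol_of_isWeakSolution (hc := hc) (hb := hb) (hδ := hδ)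
    (hδ' := hδ') hT hus
  obtain ⟨ε', a', hsv⟩ := h.exists_isSol_of_isWeakSolution (hc := hc) (hb := hb) (hδ := hδ)
    (hδ' := hδ') hT hvs
  exact hsu.eqOn hT (sub_pos.2 hκ) hsv (coer hu hus.2.1) (coer hv hvs.2.1)

end Embeds

end Westervelt

end

noncomputable section

namespace Westervelt

open Filter Topology

variable {d : ℕ} {Ω : Set (EuclideanSpace ℝ (Fin d))} {q : ℝ} [hq : Fact (1 ≤ q)]

theorem exists_embeds [IsFiniteMeasure (volume.restrict Ω)] (hd1 : 1 ≤ d) (hd3 : d ≤ 3)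
    (hΩo : IsOpen Ω) (hΩb : Bornology.IsBounded Ω) (hqd : (d : ℝ) - 1 < q) :
    0 ≤ embConst Ω q ∧ ∃ C₄, Embeds Ω q (embConst Ω q).toNNReal C₄ := by
  obtain ⟨h0, hsup⟩ := eLpNorm_top_le_embConst (exists_eLpNorm_top_le (Ω := Ω) hd1 hΩb hqd)
  obtain ⟨C₄, h4⟩ := exists_eLpNorm_fn_four_le (Ω := Ω) hd1 hd3 hΩb (two_le_expo q)
  exact ⟨h0, C₄, hΩo, hsup, h4⟩

variable [IsFiniteMeasure (volume.restrict Ω)]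

theorem le_of_dataEnergy_le {u₀ u₁ : W0 Ω (expo q)} {κ : ℝ}
    (h : dataEnergy u₀ u₁ ≤ ENNReal.ofReal (κ ^ 2)) :
    ‖toG Ω q u₁‖ ^ 2 ≤ κ ^ 2 ∧ ‖gradL Ω (expo q) u₁‖ ^ (q + 1) ≤ κ ^ 2 ∧
      ‖gradL Ω (expo q) u₀‖ ^ 2 ≤ κ ^ 2 := by
  have hq1 := hq.out
  unfold dataEnergy at h
  refine ⟨?_, ?_, ?_⟩ <;> rw [← ENNReal.ofReal_le_ofReal_iff (sq_nonneg κ)]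
  · rw [ENNReal.ofReal_pow (norm_nonneg _), ← eLpNorm_grad_two]
    exact (le_add_self.trans (le_self_add.trans le_self_add)).trans h
  · rw [← ENNReal.ofReal_rpow_of_nonneg (norm_nonneg _) (by linarith), ← eLpNorm_grad_expo]
    exact (le_add_self.trans le_self_add).trans h
  · rw [ENNReal.ofReal_pow (norm_nonneg _), ← eLpNorm_grad_expo]
    exact le_add_self.trans h

namespace Embeds

variable {C₀ C₄ : ℝ≥0} {c b δ k : ℝ} {hc : 0 < c ^ 2} {hb : 0 < b} {hδ : 0 < δ} {hδ' : 0 < 1 - δ}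

theorem energy_le (h : Embeds Ω q C₀ C₄) {u₀ u₁ : W0 Ω (expo q)} {κ : ℝ}
    (he : dataEnergy u₀ u₁ ≤ ENNReal.ofReal (κ ^ 2)) :
    (h.system k hc hb hδ hδ').Φ u₁ + ‖u₀‖ ^ 2
      ≤ (b * (1 - δ) / 2 + b * δ * (1 / (q + 1)) + h.poincare ^ 2) * κ ^ 2 := by
  have hq1 := hq.out
  have hδ0 := hδ
  have hb0 := hb
  have hδ1 := hδ'
  obtain ⟨h1, h2, h3⟩ := le_of_dataEnergy_le he
  have h4 := pow_le_pow_left₀ (norm_nonneg _) (h.norm_le_poincare u₀) 2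
  have h5 : b * (1 - δ) / 2 * ‖toG Ω q u₁‖ ^ 2 ≤ b * (1 - δ) / 2 * κ ^ 2 :=
    mul_le_mul_of_nonneg_left h1 (by positivity)
  have h6 : b * δ * (1 / (q + 1)) * ‖gradL Ω (expo q) u₁‖ ^ (q + 1)
      ≤ b * δ * (1 / (q + 1)) * κ ^ 2 := mul_le_mul_of_nonneg_left h2 (by positivity)
  have h7 : h.poincare ^ 2 * ‖gradL Ω (expo q) u₀‖ ^ 2 ≤ h.poincare ^ 2 * κ ^ 2 :=
    mul_le_mul_of_nonneg_left h3 (by positivity)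
  rw [mul_pow] at h4
  rw [h.system_Φ]
  linarith

theorem exists_unique_weakSolution (h : Embeds Ω q C₀ C₄) (k : ℝ) (hc : 0 < c ^ 2) (hb : 0 < b)
    (hδ : 0 < δ) (hδ' : 0 < 1 - δ) {T m M : ℝ} (hT : 0 < T) (hM : 0 < M) (hm : 0 < m)
    (hMk : 2 * |k| * C₀ * (T ^ (q / (q + 1)) * M) < 1) :
    ∃ κ : ℝ, 0 < κ ∧ 2 * |k| * C₀ * (κ + T ^ (q / (q + 1)) * M) < 1 ∧
      ∀ u₀ u₁ : W0 Ω (expo q), dataEnergy u₀ u₁ ≤ ENNReal.ofReal (κ ^ 2) →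
        ∃ u : ℝ → W0 Ω (expo q), MemCalW T m M u ∧ IsWeakSolution c b δ k T u₀ u₁ u ∧
          ∀ v : ℝ → W0 Ω (expo q), MemCalW T m M v → IsWeakSolution c b δ k T u₀ u₁ v →
            EqOn v u (Icc 0 T) := by
  have hq1 := hq.out
  obtain ⟨ε₀, hε₀, C, hC, hex⟩ := (h.system k hc hb hδ hδ').exists_isSol hT
  set N := b * (1 - δ) / 2 + b * δ * (1 / (q + 1)) + h.poincare ^ 2
  have lim : ∀ (A : ℝ) {B : ℝ}, 0 < B → ∀ᶠ κ in 𝓝[>] (0 : ℝ), A * (N * κ ^ 2) < B := by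
    intro A B hB
    have hcont : Continuous fun κ : ℝ => A * (N * κ ^ 2) := by fun_prop
    have h0 : Tendsto (fun κ : ℝ => A * (N * κ ^ 2)) (𝓝[>] 0) (𝓝 0) := by
      simpa using (hcont.tendsto 0).mono_left nhdsWithin_le_nhds
    exact h0.eventually_lt_const hB
  have hlast : ∀ᶠ κ in 𝓝[>] (0 : ℝ), 2 * |k| * C₀ * (κ + T ^ (q / (q + 1)) * M) < 1 := by
    have hcont : Continuous fun κ : ℝ => 2 * |k| * C₀ * (κ + T ^ (q / (q + 1)) * M) := by fun_prop
    have h0 := (hcont.tendsto 0).mono_left (nhdsWithin_le_nhds (s := Ioi 0))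
    rw [zero_add] at h0
    exact h0.eventually_lt_const hMk
  obtain ⟨κ, hκ0, hκ1, hκ2, hκ3, hκ4, hκ5⟩ := (eventually_mem_nhdsWithin.and (hlast.and
    ((lim 1 hε₀).and ((lim C (show 0 < m ^ 2 by positivity)).and
    ((lim C (show 0 < b * (1 - δ) / 2 * m ^ 2 by positivity)).and
    (lim (C * T) (show 0 < b * δ * (1 / (q + 1)) * M ^ (q + 1) by positivity))))))).exists
  refine ⟨κ, hκ0, hκ1, fun u₀ u₁ he => ?_⟩
  have hE := h.energy_le (k := k) (hc := hc) (hb := hb) (hδ := hδ) (hδ' := hδ') he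
  rw [one_mul] at hκ2
  obtain ⟨u, v, a, hs⟩ := hex u₀ u₁ (hE.trans hκ2.le)
  have hCE := mul_le_mul_of_nonneg_left hE hC
  have hW : MemCalW T m M u := h.memCalW_of_isSol hT hm.le hM.le hs (hCE.trans hκ3.le)
    (hCE.trans hκ4.le)
    ((mul_le_mul_of_nonneg_right hCE hT.le).trans ((mul_right_comm C (N * κ ^ 2) T).trans_le hκ5.le))
  have hws := (h.isWeakSolution_of_isSol hT hs).2
  have h0 : ‖gradL Ω (expo q) u₀‖ ≤ κ :=
    (abs_le_of_sq_le_sq' (le_of_dataEnergy_le he).2.2 (le_of_lt hκ0)).2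
  exact ⟨u, hW, hws, fun v hv hvs =>
    h.eqOn_of_isWeakSolution hc hb hδ hδ' hT hM.le hκ1 h0 hW hws hv hvs⟩

end Embeds

end Westervelt

end

theorem mainTheorem1 (d : ℕ) (hd1 : 1 ≤ d) (hd3 : d ≤ 3)
    (Ω : Set (EuclideanSpace ℝ (Fin d))) (hΩo : IsOpen Ω) (hΩb : Bornology.IsBounded Ω)
    (hΩl : Westervelt.HasLipschitzBoundary Ω)
    (c b δ k q : ℝ) (hc : 0 < c ^ 2) (hb : 0 < b) (hδ : 0 < δ) (hδ' : 0 < 1 - δ)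
    [Fact (1 ≤ q)] (hq : (d : ℝ) - 1 < q) (T : ℝ) (hT : 0 < T) :
    ∀ M : ℝ, 0 < M → 2 * |k| * Westervelt.embConst Ω q * (T ^ (q / (q + 1)) * M) < 1 →
    ∃ m₀ : ℝ, 0 < m₀ ∧ ∀ m : ℝ, 0 < m → m ≤ m₀ →
    ∃ κ : ℝ, 0 < κ ∧ 2 * |k| * Westervelt.embConst Ω q * (κ + T ^ (q / (q + 1)) * M) < 1 ∧
      ∀ u₀ u₁ : Westervelt.W0 Ω (Westervelt.expo q),
        Westervelt.dataEnergy u₀ u₁ ≤ ENNReal.ofReal (κ ^ 2) →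
        ∃ u : ℝ → Westervelt.W0 Ω (Westervelt.expo q),
          Westervelt.MemCalW T m M u ∧ Westervelt.IsWeakSolution c b δ k T u₀ u₁ u ∧
          ∀ v : ℝ → Westervelt.W0 Ω (Westervelt.expo q),
            Westervelt.MemCalW T m M v → Westervelt.IsWeakSolution c b δ k T u₀ u₁ v →
            Set.EqOn v u (Set.Icc 0 T) := by
  intro M hM hMk
  have hfin : IsFiniteMeasure (volume.restrict Ω) :=
    isFiniteMeasure_restrict.2 hΩb.measure_lt_top.ne
  obtain ⟨h0, C₄, hE⟩ := Westervelt.exists_embeds (q := q) hd1 hd3 hΩo hΩb hq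
  have e := Real.coe_toNNReal _ h0
  refine ⟨1, one_pos, fun m hm _ => ?_⟩
  have key := hE.exists_unique_weakSolution k hc hb hδ hδ' hT hM hm (by rwa [e])
  rwa [e] at key
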